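/- Let $H^k(\mathbb R)$ denote the usual real $L^2$-based Sobolev spaces, with $\|f\|_{H^1}^2=\int_{\mathbb R}(f^2+f'^2)\,dx$; functions in $H^k(\mathbb R)$, $k\ge 1$, are identified with their continuous representatives. Let $0\not\equiv u_0\in H^3(\mathbb R)$, let $\lambda\in\mathbb R$, and let $u$ be a solution of the Cauchy problem $$u_t-u_{txx}+\lambda(u-u_{xx})+3u^2u_x=u\,u_{xxx}+2u_xu_{xx},\qquad u(0,x)=u_0(x),$$ in the class $C^0([0,T);H^3(\mathbb R))\cap C^1([0,T);H^2(\mathbb R))$, where $T\in(0,\infty]$ is its maximal time of existence (that is, $u$ does not extend to a solution of the corresponding class on $[0,T')$ for any $T'>T$). Put $y(t)=\inf_{x\in\mathbb R}u_x(t,x)$. Assume that there is a point $x_0\in\mathbb R$ such that $$u_0'(x_0)<-\sqrt{\sqrt2\,\|u_0\|_{H^1}^3+\tfrac12\|u_0\|_{H^1}^2},$$ and put $$\epsilon_0=1-\frac{2\sqrt2\,\|u_0\|_{H^1}^3+\|u_0\|_{H^1}^2}{2\,(u_0'(x_0))^2},\qquad \lambda_0=-\frac{\epsilon_0\,y(0)}4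 .$$ If $0\le\lambda<\lambda_0$, then $u$ breaks in finite time: $T<\infty$, $u$ is bounded on $[0,T)\times\mathbb R$, and $y(t)\to-\infty$ as $t\uparrow T$. Moreover $T\le T_+$, where $$T_+=\begin{cases}\dfrac1\lambda\ln\!\left(\dfrac{\epsilon_0\,y(0)}{\epsilon_0\,y(0)+4\lambda}\right)&\text{if }\lambda>0,\\[2ex]-\dfrac{8}{\epsilon_0\,y(0)}&\text{if }\lambda=0.\end{cases}$$ -/

import Mathlib

open MeasureTheory Set Filter Topology
open scoped ContDiff

noncomputable section

/-- `L²(ℝ)`, real valued. -/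
abbrev L2R : Type := Lp ℝ 2 (volume : Measure ℝ)

/-- `g` is the weak derivative of `f` (both in `L²(ℝ)`), tested against `C_c^∞(ℝ)`. -/
def HasWeakDeriv (f g : L2R) : Prop :=
  ∀ φ : ℝ → ℝ, ContDiff ℝ ∞ φ → HasCompactSupport φ →
    ∫ x, f x * deriv φ x = -∫ x, g x * φ x

lemma integrable_L2R_mul (f : L2R) {φ : ℝ → ℝ} (hφ : Continuous φ)
    (hc : HasCompactSupport φ) : Integrable (fun x => f x * φ x) :=
  (Lp.memLp f).integrable_mul (hφ.memLp_of_hasCompactSupport (p := 2) hc)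

lemma HasWeakDeriv.zero : HasWeakDeriv 0 0 := by
  intro φ _ _
  have h : ∀ ψ : ℝ → ℝ, ∫ x, (0 : L2R) x * ψ x = 0 := by
    intro ψ
    have : (fun x => (0 : L2R) x * ψ x) =ᵐ[volume] fun _ => (0 : ℝ) := by
      filter_upwards [Lp.coeFn_zero ℝ 2 (volume : Measure ℝ)] with x hx
      rw [hx]; simp
    rw [integral_congr_ae this]; simp
  rw [h, h]; simp

lemma HasWeakDeriv.add {f g f' g' : L2R} (h : HasWeakDeriv f g) (h' : HasWeakDeriv f' g') :
    HasWeakDeriv (f + f') (g + g') := by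
  intro φ hφ hc
  have key : ∀ (a b : L2R) (ψ : ℝ → ℝ), Continuous ψ → HasCompactSupport ψ →
      ∫ x, (a + b : L2R) x * ψ x = (∫ x, a x * ψ x) + ∫ x, b x * ψ x := by
    intro a b ψ h1 h2
    rw [← integral_add (integrable_L2R_mul a h1 h2) (integrable_L2R_mul b h1 h2)]
    refine integral_congr_ae ?_
    filter_upwards [Lp.coeFn_add a b] with x hx
    rw [hx, Pi.add_apply, add_mul]
  rw [key _ _ _ (hφ.continuous_deriv (by simp)) hc.deriv, key _ _ _ hφ.continuous hc,
    h φ hφ hc, h' φ hφ hc]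
  ring

lemma HasWeakDeriv.smul (c : ℝ) {f g : L2R} (h : HasWeakDeriv f g) :
    HasWeakDeriv (c • f) (c • g) := by
  intro φ hφ hc
  have key : ∀ (a : L2R) (ψ : ℝ → ℝ), ∫ x, (c • a : L2R) x * ψ x = c * ∫ x, a x * ψ x := by
    intro a ψ
    rw [← integral_const_mul]
    refine integral_congr_ae ?_
    filter_upwards [Lp.coeFn_smul c a] with x hx
    simp [hx, mul_assoc]
  rw [key, key, h φ hφ hc]
  ring

/-- The Sobolev space `H^k(ℝ)`: an element `f` is recorded as the tuple `(f, f', …, f^(k))` of its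
weak derivatives, all in `L²(ℝ)` (the tuple is determined by its entry `0`). The norm is the one
inherited from the `ℓ²`-product, `‖f‖² = ∑_{i ≤ k} ‖f^(i)‖²_{L²}`. -/
def SobolevSpace (k : ℕ) : Submodule ℝ (PiLp 2 (fun _ : Fin (k + 1) => L2R)) where
  carrier := {F | ∀ i : Fin k, HasWeakDeriv (F i.castSucc) (F i.succ)}
  zero_mem' := fun _ => HasWeakDeriv.zero
  add_mem' := fun hF hG i => (hF i).add (hG i)
  smul_mem' := fun c _ hF i => (hF i).smul c

/-- The `i`-th weak derivative `∂_x^i F ∈ L²(ℝ)` of `F ∈ H^k(ℝ)`, `i ≤ k`. -/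
def wderiv {k : ℕ} (F : SobolevSpace k) (i : Fin (k + 1)) : L2R := F.1 i

/-- The inclusion `H^(k+1)(ℝ) ⊆ H^k(ℝ)`. -/
def sobolevIncl {k : ℕ} (F : SobolevSpace (k + 1)) : SobolevSpace k :=
  ⟨WithLp.toLp 2 (fun i => F.1 i.castSucc), fun i => F.2 i.castSucc⟩

/-- The function `f` is the continuous representative of `F ∈ H^k(ℝ)`, `k ≥ 1`. -/
def IsContRep {k : ℕ} (F : SobolevSpace k) (f : ℝ → ℝ) : Prop :=
  Continuous f ∧ f =ᵐ[volume] wderiv F 0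

/-- `f ∈ H^k(ℝ)`, `k ≥ 1` (such functions are identified with their continuous representative). -/
def MemHSobolev (k : ℕ) (f : ℝ → ℝ) : Prop := ∃ F : SobolevSpace k, IsContRep F f

/-- `‖f‖_{H^1(ℝ)}`, for continuously differentiable `f ∈ H^1(ℝ)`. -/
def h1Norm (f : ℝ → ℝ) : ℝ := √((∫ x, f x ^ 2) + ∫ x, deriv f x ^ 2)

/-- `[0, T)` for `T ∈ (0, ∞]`. -/
def timeInterval (T : EReal) : Set ℝ := {t | 0 ≤ t ∧ (t : EReal) < T}

/-- `U = u(t, ·) ∈ H³` and `V = u_t(t, ·) ∈ H²` satisfy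
`u_t - u_txx + lam (u - u_xx) + 3 u² u_x = u u_xxx + 2 u_x u_xx`, an identity in `L²(ℝ)`. -/
def SatisfiesEquation (lam : ℝ) (U : SobolevSpace 3) (V : SobolevSpace 2) : Prop :=
  ∀ᵐ x : ℝ, wderiv V 0 x - wderiv V 2 x + lam * (wderiv U 0 x - wderiv U 2 x)
      + 3 * wderiv U 0 x ^ 2 * wderiv U 1 x
    = wderiv U 0 x * wderiv U 3 x + 2 * wderiv U 1 x * wderiv U 2 x

/-- `u` is a solution on `[0, T)` of the Cauchy problem with datum `u₀`, of class
`C⁰([0, T); H³(ℝ)) ∩ C¹([0, T); H²(ℝ))`. Only the values `u t` with `t ∈ [0, T)` matter. -/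
def IsSolution (lam : ℝ) (u₀ : ℝ → ℝ) (T : EReal) (u : ℝ → ℝ → ℝ) : Prop :=
  0 < T ∧ u 0 = u₀ ∧
  ∃ (U : ℝ → SobolevSpace 3) (V : ℝ → SobolevSpace 2),
    (∀ t ∈ timeInterval T, IsContRep (U t) (u t)) ∧
    ContinuousOn U (timeInterval T) ∧
    ContinuousOn V (timeInterval T) ∧
    (∀ t ∈ timeInterval T,
      HasDerivWithinAt (fun s => sobolevIncl (U s)) (V t) (timeInterval T) t) ∧
    ∀ t ∈ timeInterval T, SatisfiesEquation lam (U t) (V t)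

/-- `u` is a solution on `[0, T)` that does not extend to a solution on any `[0, T')`, `T' > T`:
`T` is the maximal time of existence. -/
def IsMaximalSolution (lam : ℝ) (u₀ : ℝ → ℝ) (T : EReal) (u : ℝ → ℝ → ℝ) : Prop :=
  IsSolution lam u₀ T u ∧
  ∀ (T' : EReal) (v : ℝ → ℝ → ℝ), IsSolution lam u₀ T' v →
    (∀ t ∈ timeInterval T, v t = u t) → T' ≤ T

/-- `inf_{x ∈ ℝ} f'(x)`. -/
def infSlope (f : ℝ → ℝ) : ℝ := ⨅ x, deriv f x

/-- `ε₀`, depending on the datum `u₀` and the point `x₀`. -/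
def epsilonZero (u₀ : ℝ → ℝ) (x₀ : ℝ) : ℝ :=
  1 - (2 * √2 * h1Norm u₀ ^ 3 + h1Norm u₀ ^ 2) / (2 * deriv u₀ x₀ ^ 2)

/-- `λ₀ = -ε₀ y(0) / 4`, where `y(0) = inf u₀'`. -/
def lambdaZero (u₀ : ℝ → ℝ) (x₀ : ℝ) : ℝ :=
  -(epsilonZero u₀ x₀ * infSlope u₀ / 4)

/-- The bound `T₊` for the breaking time, for `lam ≥ 0`. -/
def tPlus (lam : ℝ) (u₀ : ℝ → ℝ) (x₀ : ℝ) : ℝ :=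
  if 0 < lam then
    1 / lam * Real.log (epsilonZero u₀ x₀ * infSlope u₀ /
      (epsilonZero u₀ x₀ * infSlope u₀ + 4 * lam))
  else -8 / (epsilonZero u₀ x₀ * infSlope u₀)

end

/-! The engine is a Riccati inequality along characteristics. For `lam ≥ 0` the H¹ norm of u does
not increase (`energy_le`): after one integration by parts the nonlinearity is paired with u_x and
becomes an exact derivative (`inner_flux`). Hence |u| ≤ c with c = ‖u₀‖_{H¹}/√2. The equation says
that P = u_tx + λu_x + u²/2 - (u³ - u u_xx - u_x²/2) solves P - P'' = u²/2 - u³ - u_x²/2. Only an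
upper bound for P is needed, so the term -u_x²/2 is dropped, and the Green function e^{-|x|}/2 is at
most 1/2. Thus w = u_x, followed along the flow of u, satisfies w' ≤ -λw - w²/2 + K with K = c²/2 +
2c³ (`SatisfiesEquation.slope_le`).

The hypothesis on u₀'(x₀) says u₀'(x₀)² > 2K, and ε₀ is the number with K = (1 - ε₀)u₀'(x₀)²/2. Take
a characteristic whose initial slope is at most both u₀'(x₀) and y(0)/2. Since λ < λ₀, the
right-hand side is negative there, so w keeps decreasing, K is absorbed, and w' ≤ -λw - (ε₀/2)w².
This is linear in 1/w, and its solutions cannot live past T₊ (`riccati_time_lt`).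

It remains to show that a finite lifetime forces the slope to -∞. In Eulerian form the equation
loses a derivative. In Lagrangian variables, with q the flow, J = q_ξ and M = (u - u_xx)∘q, it is an
ordinary differential equation with a C¹ vector field `lagField` on the open set {inf J > 0} of C_b
× H¹. The velocity U = u∘q is recovered from J U - (U'/J)' = J M by Lax–Milgram (`isUnit_Ell`). A
maximal integral curve yields a solution of the required class (`LagSol.isSolution`). If the slope
stayed bounded below up to the end, J would stay away from 0 and M would stay bounded, so the curve
would converge inside the domain and could be continued (`LagSol.exists_tendsto_of_le_slope`). A
slope that passes the Riccati threshold never recovers, so the infimum tends to -∞ as a genuine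
limit.

Finally, an H¹ estimate for differences (`IsSolution.unique`) identifies the given solution with the
constructed one. Maximality makes the given solution live at least as long; it cannot live longer,
because its H³ norm, which bounds the slope, is bounded on compact time intervals. -/

open scoped InnerProductSpace

noncomputable section

/-! ### Primitives of locally integrable functions and weak derivatives -/

/-- `F` is a primitive of the locally integrable function `g`. -/
structure IsPrimitive (F g : ℝ → ℝ) : Prop where
  locInt : LocallyIntegrable g
  sub_eq : ∀ a b, F b - F a = ∫ x in a..b, g x

namespace IsPrimitive

lemma intInt {F g : ℝ → ℝ} (h : IsPrimitive F g) (a b : ℝ) : IntervalIntegrable g volume a b :=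
  intervalIntegrable_iff.mpr <|
    (h.locInt.integrableOn_isCompact isCompact_uIcc).mono_set uIoc_subset_uIcc

lemma eq_add {F g : ℝ → ℝ} (h : IsPrimitive F g) (a : ℝ) :
    F = fun x => F a + ∫ y in a..x, g y := by
  ext x; linarith [h.sub_eq a x]

lemma ac {F g : ℝ → ℝ} (h : IsPrimitive F g) (a b : ℝ) :
    AbsolutelyContinuousOnInterval F a b := by
  have h1 : AbsolutelyContinuousOnInterval (fun x => ∫ y in a..x, g y) a b :=
    (h.intInt a b).absolutelyContinuousOnInterval_intervalIntegral (by simp)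
  have h2 : AbsolutelyContinuousOnInterval (fun _ : ℝ => F a) a b :=
    contDiffOn_const.absolutelyContinuousOnInterval
  rw [h.eq_add a]
  exact h2.add h1

lemma ae_hasDerivAt {F g : ℝ → ℝ} (h : IsPrimitive F g) : ∀ᵐ x, HasDerivAt F (g x) x := by
  filter_upwards [LocallyIntegrable.ae_hasDerivAt_integral h.locInt] with x hx
  rw [h.eq_add 0]
  exact (hx 0).const_add _

lemma continuous {F g : ℝ → ℝ} (h : IsPrimitive F g) : Continuous F := by
  rw [h.eq_add 0]
  exact continuous_const.add (intervalIntegral.continuous_primitive (fun a b => h.intInt a b) 0)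

lemma congr {F g g' : ℝ → ℝ} (h : IsPrimitive F g) (hg : g =ᵐ[volume] g') : IsPrimitive F g' :=
  ⟨(locallyIntegrable_congr hg).1 h.locInt, fun a b => by
    rw [h.sub_eq, intervalIntegral.integral_congr_ae (hg.mono fun x hx _ => hx)]⟩

lemma of_hasDerivAt {F g : ℝ → ℝ} (h : ∀ x, HasDerivAt F (g x) x) (hg : Continuous g) :
    IsPrimitive F g :=
  ⟨hg.locallyIntegrable, fun a b => (intervalIntegral.integral_eq_sub_of_hasDerivAt
    (fun x _ => h x) (hg.intervalIntegrable a b)).symm⟩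

lemma hasDerivAt {F g : ℝ → ℝ} (h : IsPrimitive F g) (hg : Continuous g) (x : ℝ) :
    HasDerivAt F (g x) x := by
  rw [h.eq_add 0]
  exact (intervalIntegral.integral_hasDerivAt_right (hg.intervalIntegrable _ _)
    hg.stronglyMeasurable.stronglyMeasurableAtFilter hg.continuousAt).const_add _

/-- Primitives are absolutely continuous on every interval, so the product rule in integrated form
is integration by parts for absolutely continuous functions. No continuity of `f` or `g` is
required. -/
lemma mul {F G f g : ℝ → ℝ} (hF : IsPrimitive F f) (hG : IsPrimitive G g) :
    IsPrimitive (F * G) (fun x => f x * G x + F x * g x) := by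
  refine ⟨?_, fun a b => ?_⟩
  · refine locallyIntegrable_iff.2 fun k hk => ?_
    exact ((hF.locInt.integrableOn_isCompact hk).mul_continuousOn hG.continuous.continuousOn
      hk).add ((hG.locInt.integrableOn_isCompact hk).continuousOn_mul
      hF.continuous.continuousOn hk)
  · simp only [Pi.mul_apply]
    rw [← (hF.ac a b).integral_deriv_mul_eq_sub (hG.ac a b)]
    apply intervalIntegral.integral_congr_ae
    filter_upwards [hF.ae_hasDerivAt, hG.ae_hasDerivAt] with x h1 h2 _
    rw [h1.deriv, h2.deriv]

/-- The integral of the derivative of a compactly supported function vanishes. -/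
lemma integral_eq_zero {F g : ℝ → ℝ} (h : IsPrimitive F g) (hc : HasCompactSupport F)
    (hg : HasCompactSupport g) : ∫ x, g x = 0 := by
  obtain ⟨R, hR⟩ := (hc.isCompact.union hg.isCompact).isBounded.subset_closedBall 0
  have hF0 : ∀ x, R < |x| → F x = 0 := fun x hx => by
    by_contra hne
    have := hR (Or.inl (subset_tsupport _ hne))
    rw [Metric.mem_closedBall, dist_zero_right, Real.norm_eq_abs] at this
    linarith
  have hg0 : ∀ x, R < |x| → g x = 0 := fun x hx => by
    by_contra hne
    have := hR (Or.inr (subset_tsupport _ hne))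
    rw [Metric.mem_closedBall, dist_zero_right, Real.norm_eq_abs] at this
    linarith
  have hpos : R < |(|R| + 1)| := by
    rw [abs_of_nonneg (by positivity)]; linarith [le_abs_self R]
  have := h.sub_eq (-(|R| + 1)) (|R| + 1)
  rw [hF0 _ hpos, hF0 _ (by rwa [abs_neg]), sub_self,
    intervalIntegral.integral_of_le (by linarith [abs_nonneg R]),
    setIntegral_eq_integral_of_forall_compl_eq_zero] at this
  · exact this.symm
  · intro x hx
    apply hg0
    rw [mem_Ioc, not_and_or] at hx
    rcases hx with hx | hx
    · rw [abs_of_neg (by linarith [abs_nonneg R])]; linarith [le_abs_self R]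
    · rw [abs_of_pos (by linarith [abs_nonneg R])]; linarith [le_abs_self R]

lemma integral_mul_deriv {F g φ : ℝ → ℝ} (h : IsPrimitive F g) (hφ : ContDiff ℝ 1 φ)
    (hc : HasCompactSupport φ) : ∫ x, F x * deriv φ x = - ∫ x, g x * φ x := by
  have hd := hφ.continuous_deriv le_rfl
  have h1 := h.mul (of_hasDerivAt (fun x => (hφ.differentiable one_ne_zero x).hasDerivAt) hd)
  have h2 := h1.integral_eq_zero hc.mul_left (hc.mul_left.add hc.deriv.mul_left)
  have i1 : Integrable (fun x => g x * φ x) := by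
    have := h.locInt.integrable_smul_left_of_hasCompactSupport hφ.continuous hc
    simpa [mul_comm] using this
  have i2 : Integrable (fun x => F x * deriv φ x) :=
    (h.continuous.mul hd).integrable_of_hasCompactSupport hc.deriv.mul_left
  rw [integral_add i1 i2] at h2
  linarith

end IsPrimitive

lemma L2R_locInt (f : L2R) : LocallyIntegrable f :=
  (Lp.memLp f).locallyIntegrable (by norm_num)

lemma integrable_L2R_mul_L2R (f g : L2R) : Integrable (fun x => f x * g x) :=
  (Lp.memLp f).integrable_mul (Lp.memLp g)

lemma inner_L2R (f g : L2R) : inner ℝ f g = ∫ x, f x * g x := by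
  rw [L2.inner_def]
  refine integral_congr_ae (Eventually.of_forall fun x => ?_)
  simp [mul_comm]

lemma norm_sq_L2R (f : L2R) : ‖f‖ ^ 2 = ∫ x, f x ^ 2 := by
  rw [← real_inner_self_eq_norm_sq, inner_L2R]
  simp [sq]

/-- A locally integrable function with vanishing distributional derivative is constant. -/
lemma ae_const_of_integral_deriv_eq_zero {h : ℝ → ℝ} (hl : LocallyIntegrable h)
    (h0 : ∀ φ : ℝ → ℝ, ContDiff ℝ ∞ φ → HasCompactSupport φ → ∫ x, h x * deriv φ x = 0) :
    ∃ c, h =ᵐ[volume] fun _ => c := by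
  let B : ContDiffBump (0 : ℝ) := ⟨1, 2, one_pos, one_lt_two⟩
  let ψ : ℝ → ℝ := B.normed volume
  have hψ1 : ∫ x, ψ x = 1 := B.integral_normed
  have hψs : ContDiff ℝ ∞ ψ := B.contDiff_normed
  have hψc : HasCompactSupport ψ := B.hasCompactSupport_normed
  have int_of : ∀ φ : ℝ → ℝ, ContDiff ℝ ∞ φ → HasCompactSupport φ →
      Integrable (fun x => h x * φ x) := fun φ hφ hc => by
    have := hl.integrable_smul_left_of_hasCompactSupport hφ.continuous hc
    simpa [mul_comm] using this
  refine ⟨∫ x, h x * ψ x, ?_⟩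
  refine ae_eq_of_integral_contDiff_smul_eq hl (locallyIntegrable_const _) fun φ hφ hc => ?_
  set I := ∫ x, φ x
  -- Subtracting the multiple of the bump ψ that matches the integral of φ leaves a function of mean
  -- zero. Its primitive is again a compactly supported test function, to which `h0` applies.
  let θ : ℝ → ℝ := fun x => φ x - I * ψ x
  have hθs : ContDiff ℝ ∞ θ := hφ.sub (contDiff_const.mul hψs)
  have hθc : HasCompactSupport θ := hc.sub hψc.mul_left
  have hθ0 : ∫ x, θ x = 0 := by
    rw [integral_sub (hφ.continuous.integrable_of_hasCompactSupport hc)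
      ((hψs.continuous.integrable_of_hasCompactSupport hψc).const_mul _), integral_const_mul, hψ1]
    simp [I]
  obtain ⟨R, hRpos, hR⟩ := hθc.isCompact.isBounded.subset_closedBall_lt 0 0
  have hθz : ∀ x, R < |x| → θ x = 0 := fun x hx => by
    by_contra hne
    have := hR (subset_tsupport _ hne)
    rw [Metric.mem_closedBall, dist_zero_right, Real.norm_eq_abs] at this
    linarith
  let Θ : ℝ → ℝ := fun x => ∫ y in (-R)..x, θ y
  have hd : ∀ x, HasDerivAt Θ (θ x) x := fun x =>
    intervalIntegral.integral_hasDerivAt_right (hθs.continuous.intervalIntegrable _ _)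
      hθs.continuous.stronglyMeasurable.stronglyMeasurableAtFilter hθs.continuous.continuousAt
  have hderiv : deriv Θ = θ := funext fun x => (hd x).deriv
  have hΘs : ContDiff ℝ ∞ Θ := by
    rw [contDiff_infty_iff_deriv]
    exact ⟨fun x => (hd x).differentiableAt, hderiv ▸ hθs⟩
  have hΘc : HasCompactSupport Θ := by
    refine HasCompactSupport.intro (isCompact_Icc (a := -R) (b := R)) fun x hx => ?_
    rw [mem_Icc, not_and_or] at hx
    rcases hx with hx | hx
    · have : ∫ y in (-R)..x, θ y = ∫ y in (-R)..x, (0 : ℝ) := by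
        apply intervalIntegral.integral_congr_ae
        have : ∀ᵐ y : ℝ, y ≠ -R := by simp [ae_iff, measure_singleton]
        filter_upwards [this] with y hy hy2
        apply hθz
        rw [uIoc_of_ge (by linarith), mem_Ioc] at hy2
        rw [abs_of_neg (by linarith)]
        have := lt_of_le_of_ne hy2.2 hy
        linarith
      simp [Θ, this]
    · rw [← hθ0]
      simp only [Θ]
      rw [intervalIntegral.integral_of_le (by linarith),
        setIntegral_eq_integral_of_ae_compl_eq_zero]
      have : ∀ᵐ y : ℝ, y ≠ -R := by simp [ae_iff, measure_singleton]
      filter_upwards [this] with y hy hy2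
      apply hθz
      rw [mem_Ioc, not_and_or] at hy2
      rcases hy2 with h | h
      · have := lt_of_le_of_ne (not_lt.1 h) hy
        rw [abs_of_neg (by linarith)]; linarith
      · rw [abs_of_pos (by linarith)]; linarith
  have key := h0 Θ hΘs hΘc
  rw [hderiv] at key
  have e : ∀ x, h x * θ x = h x * φ x - I * (h x * ψ x) := fun x => by simp only [θ]; ring
  simp_rw [e] at key
  rw [integral_sub (int_of φ hφ hc) ((int_of ψ hψs hψc).const_mul _), integral_const_mul] at key
  simp only [smul_eq_mul]
  rw [integral_mul_const]
  have e2 : ∫ x, φ x * h x = ∫ x, h x * φ x := by congr 1; ext x; ring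
  rw [e2]
  linarith

/-- An `L²` function with weak derivative `g ∈ L²` has a representative that is a primitive
of `g`. -/
lemma HasWeakDeriv.exists_primitive {f g : L2R} (h : HasWeakDeriv f g) :
    ∃ F : ℝ → ℝ, f =ᵐ[volume] F ∧ IsPrimitive F g := by
  let G : ℝ → ℝ := fun x => ∫ y in (0 : ℝ)..x, g y
  have hint : ∀ a b, IntervalIntegrable g volume a b := fun a b => intervalIntegrable_iff.mpr <|
    ((L2R_locInt g).integrableOn_isCompact isCompact_uIcc).mono_set uIoc_subset_uIcc
  have hG : IsPrimitive G g := ⟨L2R_locInt g, fun a b => by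
    simp only [G]
    rw [intervalIntegral.integral_interval_sub_left (hint _ _) (hint _ _)]⟩
  -- The difference of `f` and the primitive `G` has vanishing distributional derivative.
  obtain ⟨c, hc⟩ := ae_const_of_integral_deriv_eq_zero
    ((L2R_locInt f).sub hG.continuous.locallyIntegrable) (fun φ hφ hφc => by
      have hd : Continuous (deriv φ) := hφ.continuous_deriv (by simp)
      have e : ∀ x, ((f : ℝ → ℝ) - G) x * deriv φ x = f x * deriv φ x - G x * deriv φ x :=
        fun x => by simp [sub_mul]
      simp_rw [e]
      rw [integral_sub (integrable_L2R_mul f hd hφc.deriv)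
        (show Integrable (fun x => G x * deriv φ x) from
          (hG.continuous.mul hd).integrable_of_hasCompactSupport hφc.deriv.mul_left),
        hG.integral_mul_deriv (hφ.of_le (by simp)) hφc, h φ hφ hφc]
      ring)
  refine ⟨fun x => c + G x, ?_, ⟨L2R_locInt g, fun a b => ?_⟩⟩
  · filter_upwards [hc] with x hx
    simp only [Pi.sub_apply] at hx
    linarith
  · rw [← hG.sub_eq]; ring

lemma IsPrimitive.hasWeakDeriv {F : ℝ → ℝ} {f g : L2R} (h : IsPrimitive F g)
    (hf : f =ᵐ[volume] F) : HasWeakDeriv f g := fun φ hφ hc => by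
  rw [← h.integral_mul_deriv (hφ.of_le (by simp)) hc]
  exact integral_congr_ae (hf.mono fun x hx => by simp [hx])

namespace IsPrimitive

/-- Integrability of `h` gives a limit, and an integrable function can only have limit zero. -/
lemma tendsto_atTop_zero {H h : ℝ → ℝ} (hp : IsPrimitive H h) (iH : Integrable H)
    (ih : Integrable h) : Tendsto H atTop (𝓝 0) := by
  have A : Tendsto H atTop (𝓝 (H 0 + ∫ x in Ioi 0, h x)) := by
    rw [hp.eq_add 0]
    simp only [intervalIntegral.integral_same, add_zero]
    exact (intervalIntegral_tendsto_integral_Ioi 0 ih.integrableOn tendsto_id).const_add _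
  have B : H 0 + ∫ x in Ioi 0, h x = 0 := by
    refine IntegrableAtFilter.eq_zero_of_tendsto (μ := volume) (l := atTop)
      ⟨univ, univ_mem, iH.integrableOn⟩ (fun s hs => ?_) A
    rcases mem_atTop_sets.1 hs with ⟨b, hb⟩
    rw [← top_le_iff, ← Real.volume_Ici (a := b)]
    exact measure_mono hb
  rwa [B] at A

lemma tendsto_atBot_zero {H h : ℝ → ℝ} (hp : IsPrimitive H h) (iH : Integrable H)
    (ih : Integrable h) : Tendsto H atBot (𝓝 0) := by
  have A : Tendsto H atBot (𝓝 (H 0 - ∫ x in Iic 0, h x)) := by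
    have e : H = fun x => H 0 - ∫ y in x..0, h y := by
      ext x; linarith [hp.sub_eq x 0]
    rw [e]
    simp only [intervalIntegral.integral_same, sub_zero]
    exact (intervalIntegral_tendsto_integral_Iic 0 ih.integrableOn tendsto_id).const_sub _
  have B : H 0 - ∫ x in Iic 0, h x = 0 := by
    refine IntegrableAtFilter.eq_zero_of_tendsto (μ := volume) (l := atBot)
      ⟨univ, univ_mem, iH.integrableOn⟩ (fun s hs => ?_) A
    rcases mem_atBot_sets.1 hs with ⟨b, hb⟩
    rw [← top_le_iff, ← Real.volume_Iic (a := b)]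
    exact measure_mono hb
  rwa [B] at A

lemma integral_Ioi {H h : ℝ → ℝ} (hp : IsPrimitive H h) (iH : Integrable H)
    (ih : Integrable h) (a : ℝ) : ∫ x in Ioi a, h x = - H a := by
  refine tendsto_nhds_unique (intervalIntegral_tendsto_integral_Ioi a ih.integrableOn tendsto_id) ?_
  simp only [id, ← hp.sub_eq]
  simpa using (hp.tendsto_atTop_zero iH ih).sub_const (H a)

lemma integral_Iic {H h : ℝ → ℝ} (hp : IsPrimitive H h) (iH : Integrable H)
    (ih : Integrable h) (a : ℝ) : ∫ x in Iic a, h x = H a := by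
  refine tendsto_nhds_unique (intervalIntegral_tendsto_integral_Iic a ih.integrableOn tendsto_id) ?_
  simp only [id, ← hp.sub_eq]
  simpa using (hp.tendsto_atBot_zero iH ih).const_sub (H a)

lemma integral_eq_zero_of_integrable {H h : ℝ → ℝ} (hp : IsPrimitive H h) (iH : Integrable H)
    (ih : Integrable h) : ∫ x, h x = 0 := by
  rw [← intervalIntegral.integral_Iic_add_Ioi (b := 0) ih.integrableOn ih.integrableOn,
    hp.integral_Ioi iH ih, hp.integral_Iic iH ih]
  ring

/-- The Sobolev inequality `2 F(x)² ≤ ∫ (F² + F'²)`. -/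
lemma two_mul_sq_le {F f : ℝ → ℝ} (hp : IsPrimitive F f) (hF : MemLp F 2) (hf : MemLp f 2)
    (x : ℝ) : 2 * F x ^ 2 ≤ (∫ y, F y ^ 2) + ∫ y, f y ^ 2 := by
  have i1 : Integrable (fun y => f y * F y) := hf.integrable_mul hF
  have i2 : Integrable (fun y => F y * f y) := hF.integrable_mul hf
  have iH : Integrable (F * F) := hF.integrable_mul hF
  have ih : Integrable (fun y => f y * F y + F y * f y) := i1.add i2
  have h1 := (hp.mul hp).integral_Ioi iH ih x
  have h2 := (hp.mul hp).integral_Iic iH ih x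
  -- F(x)² is both the integral of (F²)' over the left half-line and minus the integral over the
  -- right one. Using both halves, with ±2FF' ≤ F² + F'², produces the sharp factor 2.
  have h3 : 2 * F x ^ 2 = (∫ y in Iic x, (f y * F y + F y * f y))
      + ∫ y in Ioi x, -(f y * F y + F y * f y) := by
    rw [integral_neg, h1, h2]; simp only [Pi.mul_apply]; ring
  rw [h3, ← integral_add hF.integrable_sq hf.integrable_sq]
  have hle : Integrable (fun y => F y ^ 2 + f y ^ 2) := hF.integrable_sq.add hf.integrable_sq
  rw [← intervalIntegral.integral_Iic_add_Ioi (b := x) hle.integrableOn hle.integrableOn]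
  refine add_le_add ?_ ?_
  · refine integral_mono ih.integrableOn hle.integrableOn fun y => ?_
    dsimp only
    nlinarith [sq_nonneg (F y - f y)]
  · refine integral_mono ih.neg.integrableOn hle.integrableOn fun y => ?_
    dsimp only
    nlinarith [sq_nonneg (F y + f y)]

end IsPrimitive

/-! ### The space H¹: completeness, embedding into C_b, algebra structure -/

/-- Bounded continuous functions on the line. -/
abbrev Cb : Type := BoundedContinuousFunction ℝ ℝ

/-- The space `H¹(ℝ)`. -/
abbrev H1 : Type := SobolevSpace 1

/-- The `L²` class of a test function. -/
def testLp (φ : ℝ → ℝ) (h : ContDiff ℝ ∞ φ) (hc : HasCompactSupport φ) : L2R :=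
  (h.continuous.memLp_of_hasCompactSupport (p := 2) (μ := volume) hc).toLp φ

lemma inner_testLp (f : L2R) (φ : ℝ → ℝ) (h : ContDiff ℝ ∞ φ) (hc : HasCompactSupport φ) :
    inner ℝ f (testLp φ h hc) = ∫ x, f x * φ x := by
  rw [inner_L2R]
  refine integral_congr_ae ?_
  filter_upwards [MemLp.coeFn_toLp (h.continuous.memLp_of_hasCompactSupport (p := 2)
    (μ := volume) hc)] with x hx
  simp only [testLp, hx]

lemma contDiff_deriv_infty {φ : ℝ → ℝ} (h : ContDiff ℝ ∞ φ) : ContDiff ℝ ∞ (deriv φ) :=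
  (contDiff_infty_iff_deriv.1 h).2

/-- Expressed through inner products, the relation is visibly closed in the pair (f, g); the Sobolev
spaces are therefore closed subspaces and complete. -/
lemma hasWeakDeriv_iff_inner {f g : L2R} : HasWeakDeriv f g ↔
    ∀ φ (h : ContDiff ℝ ∞ φ) (hc : HasCompactSupport φ),
      inner ℝ f (testLp (deriv φ) (contDiff_deriv_infty h) hc.deriv) = - inner ℝ g (testLp φ h hc) := by
  simp only [inner_testLp]
  rfl

lemma SobolevSpace.isClosed (k : ℕ) :
    IsClosed (SobolevSpace k : Set (PiLp 2 (fun _ : Fin (k + 1) => L2R))) := by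
  have : (SobolevSpace k : Set (PiLp 2 (fun _ : Fin (k + 1) => L2R))) =
      {F | ∀ i : Fin k, HasWeakDeriv (F i.castSucc) (F i.succ)} := rfl
  rw [this]
  simp only [hasWeakDeriv_iff_inner, ofPred_forall]
  refine isClosed_iInter fun i => isClosed_iInter fun φ => isClosed_iInter fun h =>
    isClosed_iInter fun hc => isClosed_eq ?_ ?_
  · fun_prop
  · fun_prop

instance (k : ℕ) : CompleteSpace (SobolevSpace k) :=
  (SobolevSpace.isClosed k).completeSpace_coe

/-- Pairs `(f, g)` with `f' = g`, as elements of `H¹`. -/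
def H1.mk (f g : L2R) (h : HasWeakDeriv f g) : H1 :=
  ⟨WithLp.toLp 2 ![f, g], fun i => by fin_cases i; exact h⟩

@[simp] lemma H1.mk_zero (f g : L2R) (h : HasWeakDeriv f g) : (H1.mk f g h).1 0 = f := rfl
@[simp] lemma H1.mk_one (f g : L2R) (h : HasWeakDeriv f g) : (H1.mk f g h).1 1 = g := rfl

lemma H1.hasWeakDeriv (F : H1) : HasWeakDeriv (F.1 0) (F.1 1) := F.2 0

lemma HasWeakDeriv.unique {f g g' : L2R} (h : HasWeakDeriv f g) (h' : HasWeakDeriv f g') :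
    g = g' := by
  obtain ⟨F, hF, hp⟩ := h.exists_primitive
  obtain ⟨F', hF', hp'⟩ := h'.exists_primitive
  have e : F = F' := (Continuous.ae_eq_iff_eq volume hp.continuous hp'.continuous).1
    (hF.symm.trans hF')
  subst e
  refine Lp.ext ?_
  filter_upwards [hp.ae_hasDerivAt, hp'.ae_hasDerivAt] with x h1 h2 using h1.unique h2

lemma H1.ext_zero {F G : H1} (h : F.1 0 = G.1 0) : F = G := by
  apply Subtype.ext
  ext1 i
  fin_cases i
  · exact h
  · exact HasWeakDeriv.unique F.hasWeakDeriv (h ▸ G.hasWeakDeriv)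

/-- The components of an element of `H¹`. -/
def H1.comp (i : Fin 2) : H1 →L[ℝ] L2R :=
  (PiLp.proj 2 (fun _ : Fin 2 => L2R) i).comp (SobolevSpace 1).subtypeL

@[simp] lemma H1.comp_apply (i : Fin 2) (F : H1) : H1.comp i F = F.1 i := rfl

lemma H1.norm_sq (F : H1) : ‖F‖ ^ 2 = ‖F.1 0‖ ^ 2 + ‖F.1 1‖ ^ 2 := by
  rw [← Submodule.norm_coe F, PiLp.norm_sq_eq_of_L2, Fin.sum_univ_two]

lemma H1.inner_eq (F G : H1) : inner ℝ F G = inner ℝ (F.1 0) (G.1 0) + inner ℝ (F.1 1) (G.1 1) := by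
  rw [Submodule.coe_inner, PiLp.inner_apply, Fin.sum_univ_two]

lemma H1.norm_zero_le (F : H1) : ‖F.1 0‖ ≤ ‖F‖ := by
  apply abs_le_of_sq_le_sq' _ (norm_nonneg _) |>.2
  rw [H1.norm_sq]; nlinarith [norm_nonneg (F.1 1)]

lemma H1.norm_one_le (F : H1) : ‖F.1 1‖ ≤ ‖F‖ := by
  apply abs_le_of_sq_le_sq' _ (norm_nonneg _) |>.2
  rw [H1.norm_sq]; nlinarith [norm_nonneg (F.1 0)]

lemma H1.norm_le (F : H1) : ‖F‖ ≤ ‖F.1 0‖ + ‖F.1 1‖ := by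
  apply abs_le_of_sq_le_sq' _ (by positivity) |>.2
  rw [H1.norm_sq]; nlinarith [norm_nonneg (F.1 0), norm_nonneg (F.1 1)]

/-- The continuous representative of `F ∈ H¹`. -/
def H1.rep (F : H1) : ℝ → ℝ := F.hasWeakDeriv.exists_primitive.choose

lemma H1.coe_ae_eq_rep (F : H1) : F.1 0 =ᵐ[volume] F.rep :=
  F.hasWeakDeriv.exists_primitive.choose_spec.1

lemma H1.isPrimitive_rep (F : H1) : IsPrimitive F.rep (F.1 1) :=
  F.hasWeakDeriv.exists_primitive.choose_spec.2

lemma H1.two_mul_rep_sq_le (F : H1) (x : ℝ) : 2 * F.rep x ^ 2 ≤ ‖F‖ ^ 2 := by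
  have := F.isPrimitive_rep.two_mul_sq_le
    ((memLp_congr_ae F.coe_ae_eq_rep).1 (Lp.memLp _)) (Lp.memLp _) x
  rw [H1.norm_sq, norm_sq_L2R, norm_sq_L2R]
  refine this.trans (le_of_eq ?_)
  congr 1
  exact integral_congr_ae (F.coe_ae_eq_rep.mono fun x hx => by simp [hx])

lemma H1.rep_eq {F : H1} {f : ℝ → ℝ} (hf : Continuous f) (h : F.1 0 =ᵐ[volume] f) : F.rep = f :=
  (Continuous.ae_eq_iff_eq volume F.isPrimitive_rep.continuous hf).1 (F.coe_ae_eq_rep.symm.trans h)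

lemma H1.abs_rep_le (F : H1) (x : ℝ) : ‖F.rep x‖ ≤ ‖F‖ := by
  rw [Real.norm_eq_abs]
  apply abs_le_of_sq_le_sq _ (norm_nonneg _)
  nlinarith [F.two_mul_rep_sq_le x]

/-- The Sobolev embedding `H¹(ℝ) → C_b(ℝ)`. -/
def emb : H1 →L[ℝ] Cb :=
  LinearMap.mkContinuous
    { toFun := fun F => BoundedContinuousFunction.ofNormedAddCommGroup F.rep
        F.isPrimitive_rep.continuous ‖F‖ F.abs_rep_le
      map_add' := fun F G => by
        ext x
        have : (F + G).rep = F.rep + G.rep := H1.rep_eq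
          (F.isPrimitive_rep.continuous.add G.isPrimitive_rep.continuous) (by
            filter_upwards [F.coe_ae_eq_rep, G.coe_ae_eq_rep, Lp.coeFn_add (F.1 0) (G.1 0)]
              with x h1 h2 h3
            have e : (F + G).1 0 = F.1 0 + G.1 0 := rfl
            rw [e, h3, Pi.add_apply, h1, h2, Pi.add_apply])
        simp [this]
      map_smul' := fun c F => by
        ext x
        have : (c • F).rep = c • F.rep := H1.rep_eq
          (F.isPrimitive_rep.continuous.const_smul c) (by
            filter_upwards [F.coe_ae_eq_rep, Lp.coeFn_smul c (F.1 0)] with x h1 h3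
            have e : (c • F).1 0 = c • F.1 0 := rfl
            rw [e, h3, Pi.smul_apply, h1, Pi.smul_apply])
        simp [this] } 1
    (fun F => by
      rw [one_mul]
      refine BoundedContinuousFunction.norm_ofNormedAddCommGroup_le _ (norm_nonneg _) F.abs_rep_le)

lemma ae_eq_emb (F : H1) : F.1 0 =ᵐ[volume] emb F := F.coe_ae_eq_rep

lemma isPrimitive_emb (F : H1) : IsPrimitive (emb F) (F.1 1) := F.isPrimitive_rep

lemma emb_eq {F : H1} {f : ℝ → ℝ} (hf : Continuous f) (h : F.1 0 =ᵐ[volume] f) : ⇑(emb F) = f :=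
  H1.rep_eq hf h

lemma two_mul_emb_sq_le (F : H1) (x : ℝ) : 2 * emb F x ^ 2 ≤ ‖F‖ ^ 2 := F.two_mul_rep_sq_le x

lemma norm_emb_le (F : H1) : ‖emb F‖ ≤ ‖F‖ :=
  BoundedContinuousFunction.norm_ofNormedAddCommGroup_le _ (norm_nonneg _) F.abs_rep_le

/-- Allows identities in H¹ to be checked in the ring C_b, including the bilinearity of `mulH`. -/
lemma emb_injective {F G : H1} (h : emb F = emb G) : F = G := by
  apply H1.ext_zero
  refine Lp.ext ?_
  filter_upwards [ae_eq_emb F, ae_eq_emb G] with x h1 h2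
  rw [h1, h2, h]

lemma memLp_mul_L2R (a : Cb) (f : L2R) : MemLp (fun x => a x * f x) 2 volume :=
  (Lp.memLp f).of_le_mul (c := ‖a‖)
    (a.continuous.aestronglyMeasurable.mul (Lp.aestronglyMeasurable f))
    (Eventually.of_forall fun x => by rw [norm_mul]; gcongr; exact a.norm_coe_le_norm x)

/-- Multiplication of an `L²` function by a bounded continuous function. -/
def mulL : Cb →L[ℝ] L2R →L[ℝ] L2R :=
  LinearMap.mkContinuous₂
    (LinearMap.mk₂ ℝ (fun a f => (memLp_mul_L2R a f).toLp _)
      (fun a b f => by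
        refine Lp.ext ?_
        filter_upwards [(memLp_mul_L2R a f).coeFn_toLp, (memLp_mul_L2R b f).coeFn_toLp,
          (memLp_mul_L2R (a + b) f).coeFn_toLp, Lp.coeFn_add ((memLp_mul_L2R a f).toLp _)
          ((memLp_mul_L2R b f).toLp _)] with x h1 h2 h3 h4
        rw [h3, h4, Pi.add_apply, h1, h2]; simp [add_mul])
      (fun c a f => by
        refine Lp.ext ?_
        filter_upwards [(memLp_mul_L2R a f).coeFn_toLp,
          (memLp_mul_L2R (c • a) f).coeFn_toLp, Lp.coeFn_smul c ((memLp_mul_L2R a f).toLp _)]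
          with x h1 h3 h4
        rw [h3, h4, Pi.smul_apply, h1]; simp [mul_assoc])
      (fun a f g => by
        refine Lp.ext ?_
        filter_upwards [(memLp_mul_L2R a f).coeFn_toLp, (memLp_mul_L2R a g).coeFn_toLp,
          (memLp_mul_L2R a (f + g)).coeFn_toLp, Lp.coeFn_add ((memLp_mul_L2R a f).toLp _)
          ((memLp_mul_L2R a g).toLp _), Lp.coeFn_add f g] with x h1 h2 h3 h4 h5
        rw [h3, h4, Pi.add_apply, h1, h2, h5]; simp [mul_add])
      (fun c a f => by
        refine Lp.ext ?_
        filter_upwards [(memLp_mul_L2R a f).coeFn_toLp,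
          (memLp_mul_L2R a (c • f)).coeFn_toLp, Lp.coeFn_smul c ((memLp_mul_L2R a f).toLp _),
          Lp.coeFn_smul c f] with x h1 h3 h4 h5
        rw [h3, h4, Pi.smul_apply, h1, h5]; simp; ring)) 1
    (fun a f => by
      rw [one_mul]
      refine Lp.norm_le_mul_norm_of_ae_le_mul ?_
      filter_upwards [(memLp_mul_L2R a f).coeFn_toLp] with x hx
      simp only [LinearMap.mk₂_apply]
      rw [hx, norm_mul]; gcongr; exact a.norm_coe_le_norm x)

lemma coeFn_mulL (a : Cb) (f : L2R) : mulL a f =ᵐ[volume] fun x => a x * f x :=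
  (memLp_mul_L2R a f).coeFn_toLp

lemma norm_mulL_le (a : Cb) (f : L2R) : ‖mulL a f‖ ≤ ‖a‖ * ‖f‖ := by
  refine Lp.norm_le_mul_norm_of_ae_le_mul ?_
  filter_upwards [coeFn_mulL a f] with x hx
  rw [hx, norm_mul]; gcongr; exact a.norm_coe_le_norm x

lemma mulL_mul (a b : Cb) (f : L2R) : mulL (a * b) f = mulL a (mulL b f) := by
  refine Lp.ext ?_
  filter_upwards [coeFn_mulL (a * b) f, coeFn_mulL a (mulL b f), coeFn_mulL b f] with x h1 h2 h3
  rw [h1, h2, h3]; simp [mul_assoc]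

@[simp] lemma mulL_one (f : L2R) : mulL 1 f = f := by
  refine Lp.ext ?_
  filter_upwards [coeFn_mulL 1 f] with x h1
  rw [h1]; simp

lemma inner_mulL (a : Cb) (f g : L2R) : inner ℝ (mulL a f) g = ∫ x, a x * f x * g x := by
  rw [inner_L2R]
  refine integral_congr_ae ((coeFn_mulL a f).mono fun x hx => by simp [hx])

lemma hasWeakDeriv_mul (F G : H1) :
    HasWeakDeriv (mulL (emb F) (G.1 0)) (mulL (emb F) (G.1 1) + mulL (emb G) (F.1 1)) := by
  have h := (isPrimitive_emb F).mul (isPrimitive_emb G)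
  refine (h.congr (g' := (mulL (emb F) (G.1 1) + mulL (emb G) (F.1 1) : L2R)) ?_).hasWeakDeriv ?_
  · filter_upwards [coeFn_mulL (emb F) (G.1 1), coeFn_mulL (emb G) (F.1 1),
      Lp.coeFn_add (mulL (emb F) (G.1 1)) (mulL (emb G) (F.1 1))] with x h1 h2 h3
    rw [h3, Pi.add_apply, h1, h2]; ring
  · filter_upwards [coeFn_mulL (emb F) (G.1 0), ae_eq_emb G] with x h1 h2
    rw [h1, h2]; rfl

/-- The product of two elements of `H¹`. -/
def mulH1 (F G : H1) : H1 := H1.mk _ _ (hasWeakDeriv_mul F G)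

lemma emb_mulH1 (F G : H1) : emb (mulH1 F G) = emb F * emb G := by
  ext1 x
  refine congrFun (emb_eq ((emb F * emb G).continuous) ?_) x
  filter_upwards [coeFn_mulL (emb F) (G.1 0), ae_eq_emb G] with x h1 h2
  simp only [mulH1, H1.mk_zero]
  rw [h1, h2]; rfl

/-- A tame estimate: each term contains only one H¹ norm, the other factor being measured in the sup
norm. In the continuation argument this keeps the growth of the H¹ norm of M linear once the sup
norms are under control. -/
lemma norm_mulH1_le (F G : H1) : ‖mulH1 F G‖ ≤ 2 * ‖emb F‖ * ‖G‖ + ‖emb G‖ * ‖F‖ := by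
  refine (H1.norm_le _).trans ?_
  simp only [mulH1, H1.mk_zero, H1.mk_one]
  have h1 := norm_mulL_le (emb F) (G.1 0)
  have h2 := norm_mulL_le (emb F) (G.1 1)
  have h3 := norm_mulL_le (emb G) (F.1 1)
  have h4 := norm_add_le (mulL (emb F) (G.1 1)) (mulL (emb G) (F.1 1))
  have h5 := mul_le_mul_of_nonneg_left G.norm_zero_le (norm_nonneg (emb F))
  have h6 := mul_le_mul_of_nonneg_left G.norm_one_le (norm_nonneg (emb F))
  have h7 := mul_le_mul_of_nonneg_left F.norm_one_le (norm_nonneg (emb G))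
  linarith

/-- Multiplication on `H¹`, as a continuous bilinear map. -/
def mulH : H1 →L[ℝ] H1 →L[ℝ] H1 :=
  LinearMap.mkContinuous₂
    (LinearMap.mk₂ ℝ mulH1
      (fun F F' G => emb_injective (by simp only [emb_mulH1, map_add, add_mul]))
      (fun c F G => emb_injective (by simp only [emb_mulH1, map_smul, smul_mul_assoc]))
      (fun F G G' => emb_injective (by simp only [emb_mulH1, map_add, mul_add]))
      (fun c F G => emb_injective (by simp only [emb_mulH1, map_smul, mul_smul_comm]))) 3
    (fun F G => by
      simp only [LinearMap.mk₂_apply]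
      refine (norm_mulH1_le F G).trans ?_
      nlinarith [norm_emb_le F, norm_emb_le G, norm_nonneg F, norm_nonneg G,
        mul_le_mul_of_nonneg_right (norm_emb_le F) (norm_nonneg G),
        mul_le_mul_of_nonneg_right (norm_emb_le G) (norm_nonneg F)])

@[simp] lemma emb_mulH (F G : H1) : emb (mulH F G) = emb F * emb G := emb_mulH1 F G

lemma mulH_zero (F G : H1) : (mulH F G).1 0 = mulL (emb F) (G.1 0) := rfl
lemma mulH_one (F G : H1) : (mulH F G).1 1 = mulL (emb F) (G.1 1) + mulL (emb G) (F.1 1) := rfl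

lemma norm_mulH_le (F G : H1) : ‖mulH F G‖ ≤ 2 * ‖emb F‖ * ‖G‖ + ‖emb G‖ * ‖F‖ :=
  norm_mulH1_le F G

/-- Integration by parts on the line. -/
lemma inner_one_zero (F G : H1) : inner ℝ (F.1 1) (G.1 0) = - inner ℝ (F.1 0) (G.1 1) := by
  have h := (isPrimitive_emb F).mul (isPrimitive_emb G)
  have e1 : (fun x => F.1 1 x * emb G x) =ᵐ[volume] fun x => F.1 1 x * G.1 0 x :=
    (ae_eq_emb G).mono fun x hx => by simp [hx]
  have e2 : (fun x => emb F x * G.1 1 x) =ᵐ[volume] fun x => F.1 0 x * G.1 1 x :=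
    (ae_eq_emb F).mono fun x hx => by simp [hx]
  have e3 : (⇑(emb F) * ⇑(emb G)) =ᵐ[volume] fun x => F.1 0 x * G.1 0 x := by
    filter_upwards [ae_eq_emb F, ae_eq_emb G] with x h1 h2
    simp [h1, h2]
  have i1 := (integrable_L2R_mul_L2R (F.1 1) (G.1 0)).congr e1.symm
  have i2 := (integrable_L2R_mul_L2R (F.1 0) (G.1 1)).congr e2.symm
  have := h.integral_eq_zero_of_integrable
    ((integrable_L2R_mul_L2R (F.1 0) (G.1 0)).congr e3.symm) (i1.add i2)
  rw [integral_add i1 i2, integral_congr_ae e1, integral_congr_ae e2] at this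
  rw [inner_L2R, inner_L2R]
  linarith

/-- `F ∈ H¹` whose derivative has a continuous representative is `C¹`. -/
lemma hasDerivAt_emb {F : H1} {g : ℝ → ℝ} (hg : Continuous g) (h : F.1 1 =ᵐ[volume] g) (x : ℝ) :
    HasDerivAt (emb F) (g x) x :=
  ((isPrimitive_emb F).congr h).hasDerivAt hg x

/-- A test function as an element of `H¹`. -/
def testH1 (φ : ℝ → ℝ) (h : ContDiff ℝ ∞ φ) (hc : HasCompactSupport φ) : H1 :=
  H1.mk (testLp φ h hc) (testLp (deriv φ) (contDiff_deriv_infty h) hc.deriv) <|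
    ((IsPrimitive.of_hasDerivAt
      (fun x => (h.differentiable (by simp) x).hasDerivAt)
      (h.continuous_deriv (by simp))).congr (MemLp.coeFn_toLp _).symm).hasWeakDeriv
      (MemLp.coeFn_toLp _)

/-! ### Maximal integral curves in a Banach space -/

section MaximalODE

variable {E : Type*} [NormedAddCommGroup E] [NormedSpace ℝ E]

/-- `y` is an integral curve of `f` in `Ω` on the time set `I`. -/
def IsCurveIn (f : E → E) (Ω : Set E) (I : Set ℝ) (y : ℝ → E) : Prop :=
  ∀ t ∈ I, y t ∈ Ω ∧ HasDerivAt y (f (y t)) t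

lemma IsCurveIn.mono {f : E → E} {Ω : Set E} {I I' : Set ℝ} {y : ℝ → E}
    (h : IsCurveIn f Ω I y) (hI : I' ⊆ I) : IsCurveIn f Ω I' y := fun t ht => h t (hI ht)

/-- The set of times near which the curves agree is open. It is relatively closed because the curves
are continuous and a C¹ field is locally Lipschitz, so agreement at one time spreads to a
neighbourhood. Connectedness of the interval concludes. -/
lemma IsCurveIn.eqOn {f : E → E} {Ω : Set E} (hf : ∀ x ∈ Ω, ContDiffAt ℝ 1 f x)
    {a b t₀ : ℝ} {y z : ℝ → E} (hy : IsCurveIn f Ω (Ioo a b) y) (hz : IsCurveIn f Ω (Ioo a b) z)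
    (ht₀ : t₀ ∈ Ioo a b) (h0 : y t₀ = z t₀) : EqOn y z (Ioo a b) := by
  have hsub : Ioo a b ⊆ {t | y =ᶠ[𝓝 t] z} := by
    have hloc : ∀ t ∈ Ioo a b, y t = z t → y =ᶠ[𝓝 t] z := by
      intro t ht hyz
      obtain ⟨K, s, hs, hl⟩ := (hf _ (hy t ht).1).exists_lipschitzOnWith
      have hI : ∀ᶠ τ in 𝓝 t, τ ∈ Ioo a b := Ioo_mem_nhds ht.1 ht.2
      refine ODE_solution_unique_of_eventually (v := fun _ => f) (s := fun _ => s) (K := K)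
        (Eventually.of_forall fun _ => hl) ?_ ?_ hyz
      · filter_upwards [hI, (hy t ht).2.continuousAt.preimage_mem_nhds hs] with τ h1 h2
        exact ⟨(hy τ h1).2, h2⟩
      · filter_upwards [hI, (hz t ht).2.continuousAt.preimage_mem_nhds (hyz ▸ hs)] with τ h1 h2
        exact ⟨(hz τ h1).2, h2⟩
    refine isPreconnected_Ioo.subset_of_closure_inter_subset ?_ ⟨t₀, ht₀, hloc t₀ ht₀ h0⟩ ?_
    · exact isOpen_setOfPred_eventually_nhds
    · rintro t ⟨htc, ht⟩
      apply hloc t ht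
      have hfr : ∃ᶠ τ in 𝓝 t, y τ = z τ := by
        rw [mem_closure_iff_frequently] at htc
        exact htc.mono fun τ hτ => hτ.self_of_nhds
      by_contra hne
      have hc : Tendsto (fun τ => (y τ, z τ)) (𝓝 t) (𝓝 (y t, z t)) :=
        (hy t ht).2.continuousAt.prodMk_nhds (hz t ht).2.continuousAt
      have : ∀ᶠ τ in 𝓝 t, y τ ≠ z τ :=
        hc.eventually (isOpen_ne_fun continuous_fst continuous_snd |>.mem_nhds hne)
      exact hfr this
  exact fun t ht => (hsub ht).self_of_nhds

lemma exists_local_curve [CompleteSpace E] {f : E → E} {Ω : Set E} (hΩ : IsOpen Ω)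
    (hf : ∀ x ∈ Ω, ContDiffAt ℝ 1 f x) {x₀ : E} (hx₀ : x₀ ∈ Ω) (t₀ : ℝ) :
    ∃ δ > 0, ∃ y : ℝ → E, y t₀ = x₀ ∧ IsCurveIn f Ω (Ioo (t₀ - δ) (t₀ + δ)) y := by
  obtain ⟨y, hy0, ε, hε, hy⟩ :=
    (hf x₀ hx₀).exists_forall_mem_closedBall_exists_eq_forall_mem_Ioo_hasDerivAt₀ t₀
  have hc : ContinuousAt y t₀ := (hy t₀ ⟨by linarith, by linarith⟩).continuousAt
  obtain ⟨η, hη, hb⟩ := Metric.mem_nhds_iff.1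
    (hc.preimage_mem_nhds (hΩ.mem_nhds (hy0.symm ▸ hx₀)))
  refine ⟨min ε η, lt_min hε hη, y, hy0, fun t ht => ⟨hb ?_, hy t ⟨?_, ?_⟩⟩⟩
  · rw [Metric.mem_ball, Real.dist_eq, abs_lt]
    constructor <;> linarith [ht.1, ht.2, min_le_right ε η]
  · linarith [ht.1, min_le_left ε η]
  · linarith [ht.2, min_le_left ε η]

/-- The maximal forward solution of an autonomous `C¹` differential equation in an open set of a
Banach space: at a finite maximal time, it has no limit in the open set. -/
theorem exists_maximal_curve [CompleteSpace E] {f : E → E} {Ω : Set E} (hΩ : IsOpen Ω)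
    (hf : ∀ x ∈ Ω, ContDiffAt ℝ 1 f x) {x₀ : E} (hx₀ : x₀ ∈ Ω) :
    ∃ (δ : ℝ) (T : EReal) (x : ℝ → E), 0 < δ ∧ 0 < T ∧ x 0 = x₀ ∧
      IsCurveIn f Ω {t : ℝ | -δ < t ∧ (t : EReal) < T} x ∧
      ∀ Tb : ℝ, T = Tb → ∀ z ∈ Ω, ¬ Tendsto x (𝓝[<] Tb) (𝓝 z) := by
  obtain ⟨δ, hδ, y₀, hy₀0, hy₀⟩ := exists_local_curve hΩ hf hx₀ 0
  rw [zero_sub, zero_add] at hy₀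
  let P : ℝ → (ℝ → E) → Prop := fun τ y => y 0 = x₀ ∧ IsCurveIn f Ω (Ioo (-δ) τ) y
  -- The end times of curves through x₀. By uniqueness the curves agree on overlaps, so they glue to
  -- one curve up to the supremum of `S`.
  let S : Set ℝ := {τ | 0 < τ ∧ ∃ y, P τ y}
  have hδS : δ ∈ S := ⟨hδ, y₀, hy₀0, hy₀⟩
  let T : EReal := sSup ((fun r : ℝ => (r : EReal)) '' S)
  have hST : ∀ τ ∈ S, (τ : EReal) ≤ T := fun τ hτ => le_sSup ⟨τ, hτ, rfl⟩
  have hlt : ∀ t : ℝ, (t : EReal) < T → ∃ τ, t < τ ∧ τ ∈ S := fun t ht => by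
    obtain ⟨_, ⟨τ, hτ, rfl⟩, h⟩ := lt_sSup_iff.1 ht
    exact ⟨τ, EReal.coe_lt_coe_iff.1 h, hτ⟩
  have huniq : ∀ {τ τ' : ℝ} {y y' : ℝ → E}, 0 < τ → 0 < τ' → P τ y → P τ' y' →
      ∀ t, -δ < t → t < τ → t < τ' → y t = y' t := by
    intro τ τ' y y' h h' hy hy' t h1 h2 h3
    refine IsCurveIn.eqOn hf (a := -δ) (b := min τ τ') (t₀ := 0)
      (hy.2.mono (Ioo_subset_Ioo_right (min_le_left _ _)))
      (hy'.2.mono (Ioo_subset_Ioo_right (min_le_right _ _))) ⟨by linarith, lt_min h h'⟩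
      (hy.1.trans hy'.1.symm) ⟨h1, lt_min h2 h3⟩
  classical
  let x : ℝ → E := fun t => if h : ∃ τ y, 0 < τ ∧ t < τ ∧ P τ y then h.choose_spec.choose t else x₀
  have hx : ∀ {τ : ℝ} {y : ℝ → E}, 0 < τ → P τ y → ∀ t, -δ < t → t < τ → x t = y t := by
    intro τ y h0 hy t h1 h2
    have h : ∃ τ y, 0 < τ ∧ t < τ ∧ P τ y := ⟨τ, y, h0, h2, hy⟩
    have e : x t = h.choose_spec.choose t := dif_pos h
    rw [e]
    have hs := h.choose_spec.choose_spec
    exact huniq hs.1 h0 hs.2.2 hy t h1 hs.2.1 h2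
  have hcurve : IsCurveIn f Ω {t : ℝ | -δ < t ∧ (t : EReal) < T} x := by
    rintro t ⟨h1, h2⟩
    obtain ⟨τ, htτ, hτ, y, hy⟩ := hlt t h2
    have e : x =ᶠ[𝓝 t] y := by
      filter_upwards [Ioo_mem_nhds h1 htτ] with s hs using hx hτ hy s hs.1 hs.2
    rw [e.self_of_nhds]
    exact ⟨(hy.2 t ⟨h1, htτ⟩).1, (hy.2 t ⟨h1, htτ⟩).2.congr_of_eventuallyEq e⟩
  have hTpos : 0 < T := lt_of_lt_of_le (EReal.coe_pos.2 hδ) (hST δ hδS)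
  have hx0 : x 0 = x₀ := (hx hδ ⟨hy₀0, hy₀⟩ 0 (by linarith) hδ).trans hy₀0
  refine ⟨δ, T, x, hδ, hTpos, hx0, hcurve, ?_⟩
  intro Tb hTb z hz hlim
  obtain ⟨ε, hε, α, hα0, hα⟩ := exists_local_curve hΩ hf hz Tb
  have hTb0 : 0 < Tb := by rw [hTb] at hTpos; exact EReal.coe_pos.1 hTpos
  have hxI : ∀ t, -δ < t → t < Tb → x t ∈ Ω ∧ HasDerivAt x (f (x t)) t := fun t h1 h2 =>
    hcurve t ⟨h1, by rw [hTb]; exact EReal.coe_lt_coe_iff.2 h2⟩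
  -- If the limit `z` existed in Ω, a local curve issued from it would prolong the maximal one past
  -- its lifetime.
  let w : ℝ → E := fun t => if t < Tb then x t else α t
  have hwl : ∀ t, t < Tb → w t = x t := fun t h => if_pos h
  have hwr : ∀ t, Tb ≤ t → w t = α t := fun t h => if_neg (not_lt.2 h)
  have hwS : Tb + ε ∈ S := by
    refine ⟨by linarith, w, (hwl 0 hTb0).trans hx0, ?_⟩
    rintro t ⟨h1, h2⟩
    rcases lt_trichotomy t Tb with h | h | h
    · have e : w =ᶠ[𝓝 t] x := by
        filter_upwards [Iio_mem_nhds h] with s hs using hwl s hs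
      rw [hwl t h]
      exact ⟨(hxI t h1 h).1, (hxI t h1 h).2.congr_of_eventuallyEq e⟩
    · subst h
      rw [hwr t le_rfl, hα0]
      refine ⟨hz, ?_⟩
      have hr : HasDerivWithinAt w (f z) (Ici t) t := by
        have := ((hα t ⟨by linarith, by linarith⟩).2).hasDerivWithinAt (s := Ici t)
        rw [hα0] at this
        exact this.congr (fun s hs => hwr s hs) (hwr t le_rfl)
      -- At the junction the left derivative is the limit of the derivatives f(x(s)), which converge
      -- to f(z) by continuity of the field.
      have hl : HasDerivWithinAt w (f z) (Iic t) t := by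
        have hmem : Ioo (-δ) t ∈ 𝓝[<] t := Ioo_mem_nhdsLT (by linarith)
        refine hasDerivWithinAt_Iic_of_tendsto_deriv (s := Ioo (-δ) t) ?_ ?_ hmem ?_
        · intro s hs
          have e : w =ᶠ[𝓝 s] x := by
            filter_upwards [Iio_mem_nhds hs.2] with r hr using hwl r hr
          exact ((hxI s hs.1 hs.2).2.congr_of_eventuallyEq e).differentiableAt.differentiableWithinAt
        · rw [ContinuousWithinAt, hwr t le_rfl, hα0]
          refine (hlim.mono_left (nhdsWithin_mono _ fun s hs => hs.2)).congr' ?_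
          filter_upwards [self_mem_nhdsWithin] with s hs using (hwl s hs.2).symm
        · have h3 : Tendsto (fun s => f (x s)) (𝓝[<] t) (𝓝 (f z)) :=
            (hf z hz).continuousAt.tendsto.comp hlim
          refine h3.congr' ?_
          filter_upwards [hmem] with s hs
          have e : w =ᶠ[𝓝 s] x := by
            filter_upwards [Iio_mem_nhds hs.2] with r hr using hwl r hr
          exact ((hxI s hs.1 hs.2).2.congr_of_eventuallyEq e).deriv.symm
      have := hl.union hr
      rwa [Iic_union_Ici, hasDerivWithinAt_univ] at this
    · have e : w =ᶠ[𝓝 t] α := by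
        filter_upwards [Ioi_mem_nhds h] with s hs using hwr s (le_of_lt hs)
      rw [hwr t h.le]
      have := hα t ⟨by linarith, h2⟩
      exact ⟨this.1, this.2.congr_of_eventuallyEq e⟩
  have := hST _ hwS
  rw [hTb, EReal.coe_le_coe_iff] at this
  linarith

end MaximalODE

/-! ### The Lagrangian vector field and its smoothness -/

/-- Bounded continuous functions with a positive lower bound. -/
def PosCb : Set Cb := {J | ∃ c > 0, ∀ x, c ≤ J x}

lemma isOpen_PosCb : IsOpen PosCb := by
  rw [Metric.isOpen_iff]
  rintro J ⟨c, hc, hJ⟩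
  refine ⟨c / 2, by positivity, fun K hK => ⟨c / 2, by positivity, fun x => ?_⟩⟩
  have h1 := (BoundedContinuousFunction.dist_coe_le_dist (f := K) (g := J) x).trans_lt hK
  rw [Real.dist_eq, abs_lt] at h1
  linarith [hJ x]

lemma norm_inv_coe_le {J : Cb} {c : ℝ} (hc : 0 < c) (hJ : ∀ x, c ≤ J x) (x : ℝ) :
    ‖(J x)⁻¹‖ ≤ c⁻¹ := by
  rw [norm_inv, Real.norm_of_nonneg (hc.le.trans (hJ x))]
  exact inv_anti₀ hc (hJ x)

lemma exists_inverse_Cb {J : Cb} (hJ : J ∈ PosCb) : ∃ K : Cb, J * K = 1 ∧ ∀ x, K x = (J x)⁻¹ := by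
  obtain ⟨c, hc, hJ⟩ := hJ
  have hne : ∀ x, J x ≠ 0 := fun x => (lt_of_lt_of_le hc (hJ x)).ne'
  refine ⟨BoundedContinuousFunction.ofNormedAddCommGroup (fun x => (J x)⁻¹)
    (J.continuous.inv₀ hne) c⁻¹ (norm_inv_coe_le hc hJ), ?_, fun x => rfl⟩
  ext x
  simp [hne x]

lemma isUnit_of_PosCb {J : Cb} (hJ : J ∈ PosCb) : IsUnit J := by
  obtain ⟨K, hK, -⟩ := exists_inverse_Cb hJ
  exact IsUnit.of_mul_eq_one K hK

lemma inverse_Cb_apply {J : Cb} (hJ : J ∈ PosCb) (x : ℝ) : Ring.inverse J x = (J x)⁻¹ := by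
  obtain ⟨K, hK, hx⟩ := exists_inverse_Cb hJ
  have : Ring.inverse J = K := by
    have h1 := Ring.inverse_mul_cancel J (isUnit_of_PosCb hJ)
    calc Ring.inverse J = Ring.inverse J * (J * K) := by rw [hK, mul_one]
      _ = K := by rw [← mul_assoc, h1, one_mul]
  rw [this, hx]

lemma mulL_inverse_mulL {J : Cb} (hJ : J ∈ PosCb) (f : L2R) :
    mulL (Ring.inverse J) (mulL J f) = f := by
  rw [← mulL_mul, Ring.inverse_mul_cancel J (isUnit_of_PosCb hJ), mulL_one]

lemma mulL_mulL_inverse {J : Cb} (hJ : J ∈ PosCb) (f : L2R) :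
    mulL J (mulL (Ring.inverse J) f) = f := by
  rw [← mulL_mul, Ring.mul_inverse_cancel J (isUnit_of_PosCb hJ), mulL_one]

/-- The operator of the weighted elliptic form `∫ (J u φ + u' φ' / J)` on `H¹`. -/
def Ell (J : Cb) : H1 →L[ℝ] H1 :=
  ((H1.comp 0).adjoint.comp ((mulL J).comp (H1.comp 0))) +
    ((H1.comp 1).adjoint.comp ((mulL (Ring.inverse J)).comp (H1.comp 1)))

lemma inner_Ell (J : Cb) (F G : H1) : ⟪Ell J F, G⟫_ℝ =
    ⟪mulL J (F.1 0), G.1 0⟫_ℝ + ⟪mulL (Ring.inverse J) (F.1 1), G.1 1⟫_ℝ := by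
  simp [Ell, inner_add_left, ContinuousLinearMap.adjoint_inner_left]

lemma le_inner_mulL_self {a : Cb} {c : ℝ} (ha : ∀ x, c ≤ a x) (f : L2R) :
    c * ‖f‖ ^ 2 ≤ ⟪mulL a f, f⟫_ℝ := by
  rw [inner_mulL, norm_sq_L2R, ← integral_const_mul]
  refine integral_mono ((Lp.memLp f).integrable_sq.const_mul c) ?_ fun x => ?_
  · exact (MemLp.integrable_mul (memLp_mul_L2R a f) (Lp.memLp f))
  · have := mul_le_mul_of_nonneg_right (ha x) (sq_nonneg (f x))
    dsimp only
    linarith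

/-- Lax–Milgram: the weights J and 1/J are bounded below by c and (‖J‖ + 1)⁻¹, so the form is
coercive on H¹. -/
lemma isUnit_Ell {J : Cb} (hJ : J ∈ PosCb) : IsUnit (Ell J) := by
  let B : H1 →L[ℝ] H1 →L[ℝ] ℝ := (innerSL ℝ).comp (Ell J)
  have hB : IsCoercive B := by
    obtain ⟨c, hc, hcJ⟩ := hJ
    have hJ : J ∈ PosCb := ⟨c, hc, hcJ⟩
    have hinv : ∀ x, (‖J‖ + 1)⁻¹ ≤ Ring.inverse J x := fun x => by
      rw [inverse_Cb_apply hJ]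
      have := (le_abs_self _).trans (J.norm_coe_le_norm x)
      exact inv_anti₀ (lt_of_lt_of_le hc (hcJ x)) (by linarith)
    refine ⟨min c (‖J‖ + 1)⁻¹, lt_min hc (by positivity), fun F => ?_⟩
    have h1 := le_inner_mulL_self hcJ (F.1 0)
    have h2 := le_inner_mulL_self hinv (F.1 1)
    have e : B F F = ⟪Ell J F, F⟫_ℝ := rfl
    rw [e, inner_Ell, mul_assoc, ← sq, H1.norm_sq, mul_add]
    refine add_le_add (le_trans ?_ h1) (le_trans ?_ h2)
    · gcongr; exact min_le_left _ _
    · gcongr; exact min_le_right _ _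
  have he : ∀ F, hB.continuousLinearEquivOfBilin F = Ell J F := fun F => by
    refine ext_inner_right ℝ fun G => ?_
    rw [hB.continuousLinearEquivOfBilin_apply]; rfl
  rw [ContinuousLinearMap.isUnit_iff_bijective]
  have : ⇑(Ell J) = hB.continuousLinearEquivOfBilin := funext fun F => (he F).symm
  rw [this]
  exact hB.continuousLinearEquivOfBilin.bijective

/-- The Lagrangian velocity: the solution `U ∈ H¹` of `J U - (U' / J)' = J M`. -/
def velocity (p : Cb × H1) : H1 :=
  Ring.inverse (Ell p.1) ((H1.comp 0).adjoint (mulL p.1 (p.2.1 0)))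

/-- The pair `(U' / J, J (U - M))`. -/
def slopePair (p : Cb × H1) : PiLp 2 (fun _ : Fin 2 => L2R) :=
  WithLp.toLp 2 ![mulL (Ring.inverse p.1) ((velocity p).1 1),
    mulL p.1 ((velocity p).1 0 - p.2.1 0)]

/-- The Lagrangian slope `W = U' / J ∈ H¹`. -/
def slope' (p : Cb × H1) : H1 := (SobolevSpace 1).orthogonalProjectionOnto (slopePair p)

lemma inner_velocity {J : Cb} (hJ : J ∈ PosCb) (M G : H1) :
    ⟪mulL J ((velocity (J, M)).1 0), G.1 0⟫_ℝ
      + ⟪mulL (Ring.inverse J) ((velocity (J, M)).1 1), G.1 1⟫_ℝ = ⟪mulL J (M.1 0), G.1 0⟫_ℝ := by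
  rw [← inner_Ell]
  have : Ell J (velocity (J, M)) = (H1.comp 0).adjoint (mulL J (M.1 0)) := by
    simp only [velocity]
    rw [← mul_apply_eq_comp, Ring.mul_inverse_cancel _ (isUnit_Ell hJ)]
    rfl
  rw [this, ContinuousLinearMap.adjoint_inner_left]
  rfl

/-- Tested against smooth functions, the weak elliptic equation says precisely that U'/J has weak
derivative J(U - M). This is how W = U'/J gains a derivative although J is merely continuous. -/
lemma slopePair_mem {J : Cb} (hJ : J ∈ PosCb) (M : H1) : slopePair (J, M) ∈ SobolevSpace 1 := by
  intro i
  fin_cases i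
  change HasWeakDeriv (mulL (Ring.inverse J) ((velocity (J, M)).1 1))
    (mulL J ((velocity (J, M)).1 0 - M.1 0))
  rw [hasWeakDeriv_iff_inner]
  intro φ h hc
  have : ⟪mulL J ((velocity (J, M)).1 0), testLp φ h hc⟫_ℝ + ⟪mulL (Ring.inverse J)
      ((velocity (J, M)).1 1), testLp (deriv φ) (contDiff_deriv_infty h) hc.deriv⟫_ℝ
      = ⟪mulL J (M.1 0), testLp φ h hc⟫_ℝ := inner_velocity hJ M (testH1 φ h hc)
  rw [map_sub, inner_sub_left]
  linarith

/-- The projection in the definition only makes `slope'` a total H¹-valued function, smooth as soon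
as `slopePair` is; at positive J the pair already lies in H¹ and the projection does nothing. -/
lemma coe_slope' {J : Cb} (hJ : J ∈ PosCb) (M : H1) : (slope' (J, M)).1 = slopePair (J, M) := by
  exact Submodule.starProjection_eq_self_iff.2 (slopePair_mem hJ M)

lemma velocity_one {J : Cb} (hJ : J ∈ PosCb) (M : H1) :
    (velocity (J, M)).1 1 = mulL J ((slope' (J, M)).1 0) := by
  rw [coe_slope' hJ]
  exact (mulL_mulL_inverse hJ _).symm

lemma slope'_one {J : Cb} (hJ : J ∈ PosCb) (M : H1) :
    (slope' (J, M)).1 1 = mulL J ((velocity (J, M)).1 0 - M.1 0) := by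
  rw [coe_slope' hJ]; rfl

/-- Integrating by parts turns the first-order system for (U, W) into the weak elliptic equation,
and `Ell J` is injective. -/
lemma velocity_unique {J : Cb} (hJ : J ∈ PosCb) {M U W : H1} (h1 : U.1 1 = mulL J (W.1 0))
    (h2 : W.1 1 = mulL J (U.1 0 - M.1 0)) : velocity (J, M) = U := by
  have h : Ell J U = Ell J (velocity (J, M)) := by
    refine ext_inner_right ℝ fun G => ?_
    rw [inner_Ell, inner_Ell, inner_velocity hJ, h1, mulL_inverse_mulL hJ]
    have := inner_one_zero W G
    rw [h2, map_sub, inner_sub_left] at this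
    linarith
  have hb := (ContinuousLinearMap.isUnit_iff_bijective.1 (isUnit_Ell hJ)).1
  exact (hb h).symm

/-- The vector field of the Lagrangian equations. -/
def lagField (lam : ℝ) (p : Cb × H1) : Cb × H1 :=
  (emb (slope' p) * p.1,
    -- With u_xx = u - m and u_xxx = u_x - m_x, the equation reads m_t + u m_x = -2u_x m - λm + 3u
    -- u_x - 3u² u_x. Along the flow no derivative of m survives.
    (-(2 : ℝ)) • mulH (slope' p) p.2 - lam • p.2 + (3 : ℝ) • mulH (velocity p) (slope' p)
      - (3 : ℝ) • mulH (velocity p) (mulH (velocity p) (slope' p)))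

/-- Inversion is smooth at units of the Banach algebras C_b and of bounded operators on H¹;
everything else is continuous and linear or bilinear. This makes the Lagrangian system an ordinary
differential equation. -/
lemma contDiffAt_velocity {p : Cb × H1} (hp : p.1 ∈ PosCb) : ContDiffAt ℝ 1 velocity p := by
  have hinv : ContDiffAt ℝ 1 (fun q : Cb × H1 => Ring.inverse q.1) p := by
    obtain ⟨u, hu⟩ := isUnit_of_PosCb hp
    have h : ContDiffAt ℝ 1 (Ring.inverse : Cb → Cb) p.1 := hu ▸ contDiffAt_ringInverse ℝ u
    exact h.comp p contDiffAt_fst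
  have hm0 : ContDiff ℝ 1 (fun a : Cb => mulL a) := mulL.contDiff
  have hm1 : ContDiffAt ℝ 1 (fun q : Cb × H1 => mulL q.1) p := hm0.contDiffAt.comp p contDiffAt_fst
  have hm2 : ContDiffAt ℝ 1 (fun q : Cb × H1 => mulL (Ring.inverse q.1)) p :=
    hm0.contDiffAt.comp p hinv
  have hE : ContDiffAt ℝ 1 (fun q : Cb × H1 => Ell q.1) p := by
    unfold Ell
    refine ContDiffAt.add ?_ ?_
    · exact contDiffAt_const.clm_comp (hm1.clm_comp contDiffAt_const)
    · exact contDiffAt_const.clm_comp (hm2.clm_comp contDiffAt_const)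
  have hEi : ContDiffAt ℝ 1 (fun q : Cb × H1 => Ring.inverse (Ell q.1)) p := by
    obtain ⟨u, hu⟩ := isUnit_Ell hp
    have h : ContDiffAt ℝ 1 (Ring.inverse : (H1 →L[ℝ] H1) → (H1 →L[ℝ] H1)) (Ell p.1) :=
      hu ▸ contDiffAt_ringInverse (R := H1 →L[ℝ] H1) ℝ u
    exact h.comp p hE
  refine hEi.clm_apply ?_
  have hc : ContDiffAt ℝ 1 (fun q : Cb × H1 => q.2.1 0) p :=
    (H1.comp 0).contDiff.contDiffAt.comp p contDiffAt_snd
  exact ((H1.comp 0).adjoint).contDiff.contDiffAt.comp p (hm1.clm_apply hc)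

lemma contDiffAt_slope' {p : Cb × H1} (hp : p.1 ∈ PosCb) : ContDiffAt ℝ 1 slope' p := by
  have hinv : ContDiffAt ℝ 1 (fun q : Cb × H1 => Ring.inverse q.1) p := by
    obtain ⟨u, hu⟩ := isUnit_of_PosCb hp
    have h : ContDiffAt ℝ 1 (Ring.inverse : Cb → Cb) p.1 := hu ▸ contDiffAt_ringInverse ℝ u
    exact h.comp p contDiffAt_fst
  have hm0 : ContDiff ℝ 1 (fun a : Cb => mulL a) := mulL.contDiff
  have hm1 : ContDiffAt ℝ 1 (fun q : Cb × H1 => mulL q.1) p := hm0.contDiffAt.comp p contDiffAt_fst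
  have hm2 : ContDiffAt ℝ 1 (fun q : Cb × H1 => mulL (Ring.inverse q.1)) p :=
    hm0.contDiffAt.comp p hinv
  have hv := contDiffAt_velocity hp
  have hv1 : ContDiffAt ℝ 1 (fun q : Cb × H1 => (velocity q).1 1) p :=
    (H1.comp 1).contDiff.contDiffAt.comp p hv
  have hv0 : ContDiffAt ℝ 1 (fun q : Cb × H1 => (velocity q).1 0) p :=
    (H1.comp 0).contDiff.contDiffAt.comp p hv
  have hc : ContDiffAt ℝ 1 (fun q : Cb × H1 => q.2.1 0) p :=
    (H1.comp 0).contDiff.contDiffAt.comp p contDiffAt_snd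
  have hs : ContDiffAt ℝ 1 slopePair p := by
    have : ContDiffAt ℝ 1 (fun q : Cb × H1 => ![mulL (Ring.inverse q.1) ((velocity q).1 1),
        mulL q.1 ((velocity q).1 0 - q.2.1 0)]) p := by
      rw [contDiffAt_pi]
      intro i
      fin_cases i
      · exact hm2.clm_apply hv1
      · exact hm1.clm_apply (hv0.sub hc)
    exact (PiLp.continuousLinearEquiv 2 ℝ (fun _ : Fin 2 => L2R)).symm.contDiff.contDiffAt.comp p
      this
  exact ((SobolevSpace 1).orthogonalProjectionOnto).contDiff.contDiffAt.comp p hs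

lemma ContDiffAt.bilin {E F G X : Type*} [NormedAddCommGroup E] [NormedSpace ℝ E]
    [NormedAddCommGroup F] [NormedSpace ℝ F] [NormedAddCommGroup G] [NormedSpace ℝ G]
    [NormedAddCommGroup X] [NormedSpace ℝ X] (B : E →L[ℝ] F →L[ℝ] G) {f : X → E} {g : X → F}
    {p : X} (hf : ContDiffAt ℝ 1 f p) (hg : ContDiffAt ℝ 1 g p) :
    ContDiffAt ℝ 1 (fun q => B (f q) (g q)) p :=
  B.isBoundedBilinearMap.contDiff.contDiffAt.comp p (hf.prodMk hg)

lemma contDiffAt_mulH {f g : Cb × H1 → H1} {p : Cb × H1} (hf : ContDiffAt ℝ 1 f p)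
    (hg : ContDiffAt ℝ 1 g p) : ContDiffAt ℝ 1 (fun q => mulH (f q) (g q)) p :=
  hf.bilin mulH hg

lemma contDiffAt_const_smul_H1 {f : Cb × H1 → H1} {p : Cb × H1} (c : ℝ)
    (hf : ContDiffAt ℝ 1 f p) : ContDiffAt ℝ 1 (fun q => c • f q) p :=
  (ContinuousLinearMap.contDiff (c • ContinuousLinearMap.id ℝ H1)).contDiffAt.comp p hf

lemma contDiffAt_lagField (lam : ℝ) {p : Cb × H1} (hp : p.1 ∈ PosCb) :
    ContDiffAt ℝ 1 (lagField lam) p := by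
  have hv := contDiffAt_velocity hp
  have hs := contDiffAt_slope' hp
  have h1 := contDiffAt_const_smul_H1 (-2) (contDiffAt_mulH hs contDiffAt_snd)
  have h2 := contDiffAt_const_smul_H1 (p := p) lam contDiffAt_snd
  have h3 := contDiffAt_const_smul_H1 3 (contDiffAt_mulH hv hs)
  have h4 := contDiffAt_const_smul_H1 3 (contDiffAt_mulH hv (contDiffAt_mulH hv hs))
  have h5 : ContDiffAt ℝ 1 (fun q => emb (slope' q) * q.1) p :=
    (emb.contDiff.contDiffAt.comp p hs).mul contDiffAt_fst
  exact h5.prodMk (((h1.sub h2).add h3).sub h4)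

lemma isOpen_PosCb_prod : IsOpen {p : Cb × H1 | p.1 ∈ PosCb} :=
  isOpen_PosCb.preimage continuous_fst

/-! ### From weak to strong continuity and differentiability of curves -/

section Hilbert

variable {H : Type*} [NormedAddCommGroup H] [InnerProductSpace ℝ H]

lemma norm_le_of_inner_dense {D : Set H} (hD : Dense D) {x : H} {c : ℝ} (hc : 0 ≤ c)
    (h : ∀ φ ∈ D, |⟪x, φ⟫_ℝ| ≤ c * ‖φ‖) : ‖x‖ ≤ c := by
  have h1 : ∀ φ : H, |⟪x, φ⟫_ℝ| ≤ c * ‖φ‖ := fun φ =>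
    (isClosed_le (by fun_prop) (by fun_prop) : IsClosed {φ : H | |⟪x, φ⟫_ℝ| ≤ c * ‖φ‖})
      |>.closure_subset_iff.2 h (hD φ)
  have h2 := h1 x
  rw [real_inner_self_eq_norm_sq, abs_of_nonneg (sq_nonneg _)] at h2
  rcases (norm_nonneg x).eq_or_lt with h0 | h0
  · rw [← h0]; exact hc
  · nlinarith

/-- A curve in a Hilbert space is differentiable as soon as its pairings with a dense set are, with
a continuous candidate derivative. -/
lemma hasDerivAt_of_inner_dense {D : Set H} (hD : Dense D) {f g : ℝ → H} {s : ℝ}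
    (hg : ContinuousAt g s)
    (h : ∀ᶠ t in 𝓝 s, ∀ φ ∈ D, HasDerivAt (fun τ => ⟪f τ, φ⟫_ℝ) ⟪g t, φ⟫_ℝ t) :
    HasDerivAt f (g s) s := by
  rw [hasDerivAt_iff_isLittleO, Asymptotics.isLittleO_iff]
  intro ε hε
  have h2 : ∀ᶠ t in 𝓝 s, ‖g t - g s‖ ≤ ε := by
    filter_upwards [hg.eventually (Metric.closedBall_mem_nhds (g s) hε)] with t ht
    simpa [dist_eq_norm] using ht
  obtain ⟨r, hr, hb⟩ := Metric.eventually_nhds_iff_ball.1 (h.and h2)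
  filter_upwards [Metric.ball_mem_nhds s hr] with t ht
  refine norm_le_of_inner_dense hD (by positivity) fun φ hφ => ?_
  -- Mean value inequality for the pairing minus its linear part. The radius does not depend on φ,
  -- so the bound is uniform over the dense set.
  have := Convex.norm_image_sub_le_of_norm_hasDerivWithin_le (s := Metric.ball s r)
    (f := fun τ => ⟪f τ, φ⟫_ℝ - τ * ⟪g s, φ⟫_ℝ) (f' := fun τ => ⟪g τ, φ⟫_ℝ - ⟪g s, φ⟫_ℝ)
    (C := ε * ‖φ‖) (x := s) (y := t) ?_ ?_ (convex_ball s r) (Metric.mem_ball_self hr) ht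
  · rw [inner_sub_left, inner_sub_left, real_inner_smul_left]
    rw [← Real.norm_eq_abs]
    calc _ = ‖⟪f t, φ⟫_ℝ - t * ⟪g s, φ⟫_ℝ - (⟪f s, φ⟫_ℝ - s * ⟪g s, φ⟫_ℝ)‖ := by congr 1; ring
      _ ≤ _ := this
      _ = _ := by ring
  · intro τ hτ
    have h1 : HasDerivAt (fun τ => ⟪f τ, φ⟫_ℝ - τ * ⟪g s, φ⟫_ℝ)
        (⟪g τ, φ⟫_ℝ - 1 * ⟪g s, φ⟫_ℝ) τ :=
      ((hb τ hτ).1 φ hφ).sub ((hasDerivAt_id τ).mul_const ⟪g s, φ⟫_ℝ)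
    rw [one_mul] at h1
    exact h1.hasDerivWithinAt
  · intro τ hτ
    rw [← inner_sub_left]
    refine (norm_inner_le_norm _ _).trans ?_
    gcongr
    exact (hb τ hτ).2

/-- Weak continuity together with continuity of the norm implies strong continuity. -/
lemma continuousAt_of_inner_dense {D : Set H} (hD : Dense D) {f : ℝ → H} {s : ℝ}
    (hn : ContinuousAt (fun t => ‖f t‖ ^ 2) s)
    (h : ∀ φ ∈ D, ContinuousAt (fun τ => ⟪f τ, φ⟫_ℝ) s) : ContinuousAt f s := by
  have key : ∀ ε > 0, ∀ᶠ t in 𝓝 s, ‖f t - f s‖ ^ 2 ≤ ε := by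
    intro ε hε
    let N := ‖f s‖ + 1
    have hNpos : 0 < N := by positivity
    obtain ⟨φ, hφ, hφD⟩ := Metric.dense_iff.1 hD (f s) (ε / (8 * N)) (by positivity)
    rw [Metric.mem_ball, dist_eq_norm] at hφ
    have e1 : ∀ᶠ t in 𝓝 s, |‖f t‖ ^ 2 - ‖f s‖ ^ 2| < min (ε / 4) 1 :=
      (Metric.tendsto_nhds.1 hn (min (ε / 4) 1) (by positivity)).mono fun t ht => by rwa [Real.dist_eq] at ht
    have e2 : ∀ᶠ t in 𝓝 s, |⟪f t, φ⟫_ℝ - ⟪f s, φ⟫_ℝ| < ε / 8 :=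
      (Metric.tendsto_nhds.1 (h φ hφD) (ε / 8) (by positivity)).mono fun t ht => by
        rwa [Real.dist_eq] at ht
    filter_upwards [e1, e2] with t h1 h2
    have h3 : ‖f t‖ ≤ N := by
      have := (abs_lt.1 h1).2.trans_le (min_le_right _ _)
      by_contra hcon
      push Not at hcon
      nlinarith [norm_nonneg (f s), norm_nonneg (f t)]
    have h5 : ‖f t - f s‖ ≤ 2 * N := (norm_sub_le _ _).trans (by
      have : ‖f s‖ ≤ N := by simp [N]
      linarith)
    have h4 : |⟪f t - f s, f s - φ⟫_ℝ| ≤ ε / 4 := by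
      refine (abs_real_inner_le_norm _ _).trans ?_
      rw [norm_sub_rev] at hφ
      calc ‖f t - f s‖ * ‖f s - φ‖ ≤ (2 * N) * (ε / (8 * N)) := by gcongr
        _ = ε / 4 := by field_simp; norm_num
    -- Only φ, an approximation of f(s), lies in the dense set; the cross term is split into a
    -- pairing with φ, which converges, and one with f(s) - φ, which is small.
    have h6 : ‖f t - f s‖ ^ 2 = (‖f t‖ ^ 2 - ‖f s‖ ^ 2) - 2 * (⟪f t, φ⟫_ℝ - ⟪f s, φ⟫_ℝ)
        - 2 * ⟪f t - f s, f s - φ⟫_ℝ := by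
      rw [norm_sub_sq_real, inner_sub_right, inner_sub_left, inner_sub_left,
        real_inner_self_eq_norm_sq]
      ring
    have := (abs_lt.1 h1).2.trans_le (min_le_left _ _)
    have := (abs_lt.1 h2).1
    have := (abs_le.1 h4).1
    linarith
  rw [ContinuousAt, tendsto_iff_norm_sub_tendsto_zero]
  rw [Metric.tendsto_nhds]
  intro ε hε
  filter_upwards [key (ε ^ 2 / 4) (by positivity)] with t ht
  rw [Real.dist_eq, sub_zero, abs_norm]
  by_contra hcon
  push Not at hcon
  nlinarith

end Hilbert

/-- The square integrable functions with a test function as representative. -/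
def testSet : Set L2R := {f | ∃ φ : ℝ → ℝ, ∃ (h : ContDiff ℝ ∞ φ) (hc : HasCompactSupport φ),
  f = testLp φ h hc}

lemma dense_testSet : Dense testSet := by
  refine (Lp.dense_hasCompactSupport_contDiff (E := ℝ) (F := ℝ) (p := 2) (μ := volume)
    (by norm_num)).mono ?_
  rintro f ⟨g, hfg, hc, hg⟩
  exact ⟨g, hg, hc, Lp.ext (hfg.trans (MemLp.coeFn_toLp _).symm)⟩

/-! ### Flow maps and the change of variables -/

/-- `q` is a `C¹` diffeomorphism of the line with inverse `p` and derivative `J`. -/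
structure FlowMap (J : Cb) (q p : ℝ → ℝ) : Prop where
  pos : J ∈ PosCb
  hasDerivAt : ∀ ξ, HasDerivAt q (J ξ) ξ
  left_inv : ∀ ξ, p (q ξ) = ξ
  right_inv : ∀ x, q (p x) = x

/-- The bound J ≥ c > 0 makes q strictly increasing with at least linear growth in both directions,
hence bijective. -/
lemma exists_flowMap {J : Cb} (hJ : J ∈ PosCb) {q : ℝ → ℝ} (hq : ∀ ξ, HasDerivAt q (J ξ) ξ) :
    ∃ p, FlowMap J q p := by
  obtain ⟨c, hc, hcJ⟩ := id hJ
  have hcont : Continuous q := continuous_iff_continuousAt.2 fun ξ => (hq ξ).continuousAt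
  have hmono : StrictMono q := strictMono_of_deriv_pos fun ξ => by
    rw [(hq ξ).deriv]; exact hc.trans_le (hcJ ξ)
  have hlin : Monotone (fun ξ => q ξ - c * ξ) := by
    refine monotone_of_deriv_nonneg (fun ξ => ((hq ξ).sub
      ((hasDerivAt_id ξ).const_mul c)).differentiableAt) fun ξ => ?_
    have := ((hq ξ).sub ((hasDerivAt_id ξ).const_mul c)).deriv
    have e : deriv (fun ξ => q ξ - c * ξ) ξ = J ξ - c * 1 := this
    rw [e]; linarith [hcJ ξ]
  have htop : Tendsto q atTop atTop := by
    refine tendsto_atTop_mono' atTop (f₁ := fun ξ => q 0 + c * ξ) ?_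
      (tendsto_atTop_add_const_left _ _ (tendsto_id.const_mul_atTop hc))
    filter_upwards [eventually_ge_atTop 0] with ξ hξ
    have := hlin hξ
    simp only [mul_zero, sub_zero] at this
    linarith
  have hbot : Tendsto q atBot atBot := by
    refine tendsto_atBot_mono' atBot (f₁ := fun ξ => q 0 + c * ξ) ?_
      (tendsto_atBot_add_const_left _ _ (tendsto_id.const_mul_atBot hc))
    filter_upwards [eventually_le_atBot 0] with ξ hξ
    have := hlin hξ
    simp only [mul_zero, sub_zero] at this
    linarith
  have hsurj : Function.Surjective q := hcont.surjective htop hbot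
  exact ⟨Function.surjInv hsurj, hJ, hq,
    Function.leftInverse_surjInv ⟨hmono.injective, hsurj⟩, Function.surjInv_eq hsurj⟩

namespace FlowMap

variable {J : Cb} {q p : ℝ → ℝ}

lemma continuous_q (h : FlowMap J q p) : Continuous q :=
  continuous_iff_continuousAt.2 fun ξ => (h.hasDerivAt ξ).continuousAt

lemma J_pos (h : FlowMap J q p) (ξ : ℝ) : 0 < J ξ := by
  obtain ⟨c, hc, hcJ⟩ := h.pos
  exact hc.trans_le (hcJ ξ)

lemma strictMono (h : FlowMap J q p) : StrictMono q := strictMono_of_deriv_pos fun ξ => by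
  rw [(h.hasDerivAt ξ).deriv]; exact h.J_pos ξ

lemma surjective (h : FlowMap J q p) : Function.Surjective q := fun x => ⟨p x, h.right_inv x⟩

lemma continuous_p (h : FlowMap J q p) : Continuous p := by
  let e : ℝ ≃o ℝ := h.strictMono.orderIsoOfSurjective q h.surjective
  have : p = e.symm := by
    ext x
    apply h.strictMono.injective
    rw [h.right_inv]
    exact (e.apply_symm_apply x).symm
  rw [this]
  exact e.symm.continuous

lemma image_univ (h : FlowMap J q p) : q '' univ = univ := by
  rw [Set.image_univ, h.surjective.range_eq]

lemma integral_eq (h : FlowMap J q p) (g : ℝ → ℝ) : ∫ x, g x = ∫ ξ, g (q ξ) * J ξ := by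
  have := integral_image_eq_integral_abs_deriv_smul MeasurableSet.univ
    (fun ξ _ => (h.hasDerivAt ξ).hasDerivWithinAt) h.strictMono.injective.injOn g
  rw [h.image_univ, setIntegral_univ, setIntegral_univ] at this
  rw [this]
  congr 1
  ext ξ
  rw [abs_of_pos (h.J_pos ξ), smul_eq_mul, mul_comm]

lemma integrable_iff (h : FlowMap J q p) (g : ℝ → ℝ) :
    Integrable g ↔ Integrable (fun ξ => g (q ξ) * J ξ) := by
  have := integrableOn_image_iff_integrableOn_abs_deriv_smul MeasurableSet.univ
    (fun ξ _ => (h.hasDerivAt ξ).hasDerivWithinAt) h.strictMono.injective.injOn g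
  rw [h.image_univ, integrableOn_univ, integrableOn_univ] at this
  rw [this]
  refine integrable_congr (Eventually.of_forall fun ξ => ?_)
  dsimp only
  rw [abs_of_pos (h.J_pos ξ), smul_eq_mul, mul_comm]

lemma ae_comp (h : FlowMap J q p) {P : ℝ → Prop} (hP : ∀ᵐ ξ, P ξ) : ∀ᵐ x, P (p x) := by
  rw [ae_iff] at hP ⊢
  have : {x | ¬ P (p x)} = q '' {ξ | ¬ P ξ} := by
    ext x
    simp only [mem_ofPred_eq, mem_image]
    constructor
    · intro hx; exact ⟨p x, hx, h.right_inv x⟩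
    · rintro ⟨ξ, hξ, rfl⟩; rwa [h.left_inv]
  rw [this]
  exact addHaar_image_eq_zero_of_differentiableOn_of_addHaar_eq_zero volume
    (fun ξ _ => (h.hasDerivAt ξ).differentiableAt.differentiableWithinAt) hP

lemma memLp_comp (h : FlowMap J q p) (f : L2R) : MemLp (fun x => f (p x)) 2 volume := by
  have hm : AEStronglyMeasurable (fun x => f (p x)) volume :=
    ((Lp.stronglyMeasurable f).comp_measurable h.continuous_p.measurable).aestronglyMeasurable
  rw [memLp_two_iff_integrable_sq hm, h.integrable_iff]
  have := (integrable_L2R_mul_L2R (mulL J f) f)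
  refine this.congr ((coeFn_mulL J f).mono fun ξ hξ => ?_)
  dsimp only
  rw [hξ, h.left_inv]; ring

/-- Composition of an `L²` function with the inverse flow map. -/
def pull (h : FlowMap J q p) (f : L2R) : L2R := (h.memLp_comp f).toLp _

lemma coeFn_pull (h : FlowMap J q p) (f : L2R) : h.pull f =ᵐ[volume] fun x => f (p x) :=
  MemLp.coeFn_toLp _

lemma inner_pull (h : FlowMap J q p) (f g : L2R) :
    ⟪h.pull f, h.pull g⟫_ℝ = ⟪mulL J f, g⟫_ℝ := by
  rw [inner_L2R, inner_mulL]
  have : ∫ x, h.pull f x * h.pull g x = ∫ x, f (p x) * g (p x) := by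
    refine integral_congr_ae ?_
    filter_upwards [h.coeFn_pull f, h.coeFn_pull g] with x h1 h2
    rw [h1, h2]
  rw [this, h.integral_eq]
  congr 1; ext ξ; rw [h.left_inv]; ring

lemma norm_sq_pull (h : FlowMap J q p) (f : L2R) : ‖h.pull f‖ ^ 2 = ⟪mulL J f, f⟫_ℝ := by
  rw [← real_inner_self_eq_norm_sq, h.inner_pull]

lemma integral_pull_mul (h : FlowMap J q p) (f : L2R) (φ : ℝ → ℝ) :
    ∫ x, h.pull f x * φ x = ∫ ξ, f ξ * φ (q ξ) * J ξ := by
  have : ∫ x, h.pull f x * φ x = ∫ x, f (p x) * φ x :=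
    integral_congr_ae ((h.coeFn_pull f).mono fun x hx => by simp [hx])
  rw [this, h.integral_eq]
  simp only [h.left_inv]

/-- The flow map as a homeomorphism. -/
def homeo (h : FlowMap J q p) : ℝ ≃ₜ ℝ where
  toFun := q
  invFun := p
  left_inv := h.left_inv
  right_inv := h.right_inv
  continuous_toFun := h.continuous_q
  continuous_invFun := h.continuous_p

lemma hasCompactSupport_comp (h : FlowMap J q p) {φ : ℝ → ℝ} (hc : HasCompactSupport φ) :
    HasCompactSupport (fun ξ => φ (q ξ)) := hc.comp_homeomorph h.homeo

lemma hasDerivAt_comp (h : FlowMap J q p) {φ : ℝ → ℝ} (hφ : ContDiff ℝ 1 φ) (ξ : ℝ) :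
    HasDerivAt (fun ξ => φ (q ξ)) (deriv φ (q ξ) * J ξ) ξ :=
  (hφ.differentiable one_ne_zero (q ξ)).hasDerivAt.comp ξ (h.hasDerivAt ξ)

lemma deriv_comp (h : FlowMap J q p) {φ : ℝ → ℝ} (hφ : ContDiff ℝ 1 φ) :
    deriv (fun ξ => φ (q ξ)) = fun ξ => deriv φ (q ξ) * J ξ :=
  funext fun ξ => (h.hasDerivAt_comp hφ ξ).deriv

lemma contDiff_comp (h : FlowMap J q p) {φ : ℝ → ℝ} (hφ : ContDiff ℝ 1 φ) :
    ContDiff ℝ 1 (fun ξ => φ (q ξ)) := by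
  rw [contDiff_one_iff_deriv, h.deriv_comp hφ]
  exact ⟨fun ξ => (h.hasDerivAt_comp hφ ξ).differentiableAt,
    ((hφ.continuous_deriv le_rfl).comp h.continuous_q).mul J.continuous⟩

/-- The transported test function φ∘q is only C¹, hence not admissible in `HasWeakDeriv`; the
integration by parts is done for a primitive of the derivative instead. -/
lemma hasWeakDeriv_pull (h : FlowMap J q p) {f g : L2R} (hfg : HasWeakDeriv f (mulL J g)) :
    HasWeakDeriv (h.pull f) (h.pull g) := by
  intro φ hφ hc
  obtain ⟨F, hF, hp⟩ := hfg.exists_primitive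
  rw [h.integral_pull_mul, h.integral_pull_mul]
  have hφ1 : ContDiff ℝ 1 φ := hφ.of_le (by simp)
  have := hp.integral_mul_deriv (h.contDiff_comp hφ1) (h.hasCompactSupport_comp hc)
  rw [h.deriv_comp hφ1] at this
  have e1 : ∫ ξ, f ξ * deriv φ (q ξ) * J ξ = ∫ ξ, F ξ * (deriv φ (q ξ) * J ξ) :=
    integral_congr_ae (hF.mono fun ξ hξ => by dsimp only; rw [hξ, mul_assoc])
  have e2 : ∫ ξ, g ξ * φ (q ξ) * J ξ = ∫ ξ, mulL J g ξ * φ (q ξ) :=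
    integral_congr_ae ((coeFn_mulL J g).mono fun ξ hξ => by dsimp only; rw [hξ]; ring)
  rw [e1, e2, this]

end FlowMap

/-! ### Curves of flow maps and transport of L² functions -/

/-- The composition `x ↦ φ (x + κ x)`. -/
def compCb (φ κ : Cb) : Cb := φ.compContinuous ⟨fun x => x + κ x, by fun_prop⟩

@[simp] lemma compCb_apply (φ κ : Cb) (x : ℝ) : compCb φ κ x = φ (x + κ x) := rfl

lemma abs_taylor_one_le {φ φ' : ℝ → ℝ} {C : ℝ} (hd : ∀ x, HasDerivAt φ (φ' x) x)
    (hL : ∀ x y, |φ' x - φ' y| ≤ C * |x - y|) (x y : ℝ) :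
    |φ y - φ x - φ' x * (y - x)| ≤ C * |y - x| ^ 2 := by
  have hC : 0 ≤ C := by simpa using (abs_nonneg _).trans (hL 1 0)
  have := Convex.norm_image_sub_le_of_norm_hasDerivWithin_le (s := uIcc x y)
    (f := fun s => φ s - φ' x * s) (f' := fun s => φ' s - φ' x) (C := C * |y - x|)
    (x := x) (y := y) (fun s _ => ?_) (fun s hs => ?_) (convex_uIcc x y) left_mem_uIcc right_mem_uIcc
  · rw [Real.norm_eq_abs, Real.norm_eq_abs] at this
    calc _ = |φ y - φ' x * y - (φ x - φ' x * x)| := by congr 1; ring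
      _ ≤ _ := this
      _ = _ := by ring
  · have h : HasDerivAt (fun s => φ s - φ' x * s) (φ' s - φ' x * 1) s :=
      (hd s).sub ((hasDerivAt_id s).const_mul (φ' x))
    rw [mul_one] at h
    exact h.hasDerivWithinAt
  · rw [Real.norm_eq_abs]
    exact (hL s x).trans (mul_le_mul_of_nonneg_left (abs_sub_left_of_mem_uIcc hs) hC)

/-- Because φ' is globally Lipschitz, the first-order Taylor remainder is quadratic uniformly in x,
giving Fréchet differentiability in the sup norm. -/
lemma hasDerivAt_compCb {φ φ' : Cb} {C : ℝ} (hd : ∀ x, HasDerivAt φ (φ' x) x)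
    (hL : ∀ x y, |φ' x - φ' y| ≤ C * |x - y|) {κ : ℝ → Cb} {k : Cb} {t : ℝ}
    (hκ : HasDerivAt κ k t) :
    HasDerivAt (fun τ => compCb φ (κ τ)) (compCb φ' (κ t) * k) t := by
  have hC : 0 ≤ C := by simpa using (abs_nonneg _).trans (hL 1 0)
  let L : Cb →L[ℝ] Cb := ContinuousLinearMap.mul ℝ Cb (compCb φ' (κ t))
  have hF : HasFDerivAt (fun κ => compCb φ κ) L (κ t) := by
    rw [hasFDerivAt_iff_isLittleO]
    have hO : (fun η : Cb => compCb φ η - compCb φ (κ t) - L (η - κ t)) =O[𝓝 (κ t)]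
        fun η => ‖η - κ t‖ ^ 2 := by
      refine Asymptotics.IsBigO.of_bound C (Eventually.of_forall fun η => ?_)
      rw [norm_pow, norm_norm]
      refine (BoundedContinuousFunction.norm_le (by positivity)).2 fun x => ?_
      have h1 := abs_taylor_one_le hd hL (x + κ t x) (x + η x)
      have h2 : |x + η x - (x + κ t x)| ≤ ‖η - κ t‖ := by
        have := (η - κ t).norm_coe_le_norm x
        simpa using this
      have h3 : ‖(compCb φ η - compCb φ (κ t) - L (η - κ t)) x‖ =
          |φ (x + η x) - φ (x + κ t x) - φ' (x + κ t x) * (x + η x - (x + κ t x))| := by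
        rw [Real.norm_eq_abs]
        congr 1
        simp [L]
      rw [h3]
      refine h1.trans ?_
      gcongr
    refine hO.trans_isLittleO ?_
    have := Asymptotics.isLittleO_pow_sub_sub (κ t) (m := 2) (by norm_num)
    simpa using this
  exact hF.comp_hasDerivAt t hκ

/-- A test function as a bounded continuous function. -/
def testCb (φ : ℝ → ℝ) (h : ContDiff ℝ ∞ φ) (hc : HasCompactSupport φ) : Cb :=
  BoundedContinuousFunction.ofNormedAddCommGroup φ h.continuous
    (hc.exists_bound_of_continuous h.continuous).choose
    (hc.exists_bound_of_continuous h.continuous).choose_spec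

@[simp] lemma testCb_apply (φ : ℝ → ℝ) (h : ContDiff ℝ ∞ φ) (hc : HasCompactSupport φ) (x : ℝ) :
    testCb φ h hc x = φ x := rfl

lemma hasDerivAt_compCb_testCb (φ : ℝ → ℝ) (h : ContDiff ℝ ∞ φ) (hc : HasCompactSupport φ)
    {κ : ℝ → Cb} {k : Cb} {t : ℝ} (hκ : HasDerivAt κ k t) :
    HasDerivAt (fun τ => compCb (testCb φ h hc) (κ τ))
      (compCb (testCb (deriv φ) (contDiff_deriv_infty h) hc.deriv) (κ t) * k) t := by
  obtain ⟨C, hC⟩ := (contDiff_deriv_infty h).lipschitzWith_of_hasCompactSupport hc.deriv (by simp)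
  refine hasDerivAt_compCb (C := C) (fun x => ?_) (fun x y => ?_) hκ
  · exact (h.differentiable (by simp) x).hasDerivAt
  · simpa [Real.dist_eq] using hC.dist_le_mul x y

/-- Integration over an interval, as a functional on bounded continuous functions. -/
def integralCb (a b : ℝ) : Cb →L[ℝ] ℝ :=
  LinearMap.mkContinuous
    { toFun := fun A => ∫ x in a..b, A x
      map_add' := fun A B => by
        simp only [BoundedContinuousFunction.coe_add, Pi.add_apply]
        exact intervalIntegral.integral_add (A.continuous.intervalIntegrable _ _)
          (B.continuous.intervalIntegrable _ _)
      map_smul' := fun c A => by simp } |b - a|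
    (fun A => by
      rw [mul_comm]
      exact intervalIntegral.norm_integral_le_of_norm_le_const fun x _ => A.norm_coe_le_norm x)

@[simp] lemma integralCb_apply (a b : ℝ) (A : Cb) : integralCb a b A = ∫ x in a..b, A x := rfl

/-- The Lagrangian quantities of a flow `q_t = id + κ_t` with velocity `U = u ∘ q` and slope
`W = u_x ∘ q`, `J = q_ξ`. -/
structure LagFlow (I : Set ℝ) (J : ℝ → Cb) (U W : ℝ → H1) (κ : ℝ → Cb) : Prop where
  isOpen : IsOpen I
  ordConnected : I.OrdConnected
  zero_mem : 0 ∈ I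
  pos : ∀ t ∈ I, J t ∈ PosCb
  hasDerivAt_J : ∀ t ∈ I, HasDerivAt J (emb (W t) * J t) t
  hasDerivAt_κ : ∀ t ∈ I, HasDerivAt κ (emb (U t)) t
  U_one : ∀ t ∈ I, (U t).1 1 = mulL (J t) ((W t).1 0)
  continuousOn_U : ContinuousOn U I
  continuousOn_W : ContinuousOn W I
  J_zero : J 0 = 1
  κ_zero : κ 0 = 0

/-- The flow map `id + κ_t`. -/
def flowQ (κ : ℝ → Cb) (t ξ : ℝ) : ℝ := ξ + κ t ξ

/-- The inverse flow map. -/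
def flowP (κ : ℝ → Cb) (t : ℝ) : ℝ → ℝ := Function.invFun (flowQ κ t)

open Classical in
/-- The Eulerian form `f ∘ q_t⁻¹` of an `L²` function `f` of the Lagrangian variable. -/
def eul (κ : ℝ → Cb) (t : ℝ) (f : L2R) : L2R :=
  if h : MemLp (fun x => f (flowP κ t x)) 2 volume then h.toLp _ else 0

namespace LagFlow

variable {I : Set ℝ} {J : ℝ → Cb} {U W : ℝ → H1} {κ : ℝ → Cb}

lemma isPrimitive_emb_U (h : LagFlow I J U W κ) {t : ℝ} (ht : t ∈ I) :
    IsPrimitive (emb (U t)) (emb (W t) * J t : Cb) := by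
  refine (isPrimitive_emb (U t)).congr ?_
  rw [h.U_one t ht]
  filter_upwards [coeFn_mulL (J t) ((W t).1 0), ae_eq_emb (W t)] with x h1 h2
  rw [h1, h2, mul_comm]; rfl

/-- For fixed endpoints, κ(b) - κ(a) and the integral of J - 1 have the same time derivative, since
U_ξ = J W, and both vanish at time 0. This identifies J with the Jacobian of the flow. -/
lemma isPrimitive_κ (h : LagFlow I J U W κ) {t : ℝ} (ht : t ∈ I) :
    IsPrimitive (κ t) (J t - 1 : Cb) := by
  refine ⟨(J t - 1 : Cb).continuous.locallyIntegrable, fun a b => ?_⟩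
  let ℓ : Cb →L[ℝ] ℝ := BoundedContinuousFunction.evalCLM ℝ b - BoundedContinuousFunction.evalCLM ℝ a
  let g : ℝ → ℝ := fun τ => ℓ (κ τ) - integralCb a b (J τ - 1)
  have hd : ∀ τ ∈ I, HasDerivAt g 0 τ := fun τ hτ => by
    have h1 := ℓ.hasFDerivAt.comp_hasDerivAt τ (h.hasDerivAt_κ τ hτ)
    have h2 := (integralCb a b).hasFDerivAt.comp_hasDerivAt τ ((h.hasDerivAt_J τ hτ).sub_const 1)
    have h3 : HasDerivAt g (ℓ (emb (U τ)) - integralCb a b (emb (W τ) * J τ)) τ := h1.sub h2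
    have h4 : ℓ (emb (U τ)) - integralCb a b (emb (W τ) * J τ) = 0 := by
      rw [integralCb_apply, ← (h.isPrimitive_emb_U hτ).sub_eq]
      simp [ℓ]
    rwa [h4] at h3
  have hc := h.isOpen.is_const_of_deriv_eq_zero h.ordConnected.isPreconnected
    (fun τ hτ => (hd τ hτ).differentiableAt.differentiableWithinAt)
    (fun τ hτ => (hd τ hτ).deriv) ht h.zero_mem
  have h0 : g 0 = 0 := by simp [g, h.J_zero, h.κ_zero]
  rw [h0] at hc
  simp only [g, integralCb_apply, ℓ, sub_apply,
    BoundedContinuousFunction.evalCLM_apply] at hc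
  linarith

lemma flowMap (h : LagFlow I J U W κ) {t : ℝ} (ht : t ∈ I) :
    FlowMap (J t) (flowQ κ t) (flowP κ t) := by
  have hq : ∀ ξ, HasDerivAt (flowQ κ t) (J t ξ) ξ := fun ξ => by
    have h1 : HasDerivAt (flowQ κ t) (1 + (J t - 1 : Cb) ξ) ξ :=
      (hasDerivAt_id ξ).add ((h.isPrimitive_κ ht).hasDerivAt (J t - 1 : Cb).continuous ξ)
    simpa using h1
  obtain ⟨p, hp⟩ := exists_flowMap (h.pos t ht) hq
  exact ⟨h.pos t ht, hq, Function.leftInverse_invFun hp.strictMono.injective,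
    Function.rightInverse_invFun hp.surjective⟩

lemma eul_eq (h : LagFlow I J U W κ) {t : ℝ} (ht : t ∈ I) (f : L2R) :
    eul κ t f = (h.flowMap ht).pull f := dif_pos ((h.flowMap ht).memLp_comp f)

lemma coeFn_eul (h : LagFlow I J U W κ) {t : ℝ} (ht : t ∈ I) (f : L2R) :
    eul κ t f =ᵐ[volume] fun x => f (flowP κ t x) := by
  rw [h.eul_eq ht]; exact (h.flowMap ht).coeFn_pull f

lemma mem_nhds (h : LagFlow I J U W κ) {t : ℝ} (ht : t ∈ I) : I ∈ 𝓝 t := h.isOpen.mem_nhds ht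

/-- After the change of variables the weight φ(q)J is a curve in C_b and f no longer moves. Pairing
with the indicator of a fixed interval makes the expression continuous bilinear in the weight and f,
so time differentiation is routine. -/
lemma inner_eul_testLp (h : LagFlow I J U W κ) {t : ℝ} (ht : t ∈ I) (f : L2R) {φ : ℝ → ℝ}
    (hφ : ContDiff ℝ ∞ φ) (hc : HasCompactSupport φ) {R : ℝ}
    (hR : ∀ ξ, R < |ξ| → φ (flowQ κ t ξ) = 0) :
    ⟪eul κ t f, testLp φ hφ hc⟫_ℝ =
      ⟪indicatorConstLp 2 (measurableSet_Icc (a := -R) (b := R)) measure_Icc_lt_top.ne (1 : ℝ),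
        mulL (compCb (testCb φ hφ hc) (κ t) * J t) f⟫_ℝ := by
  rw [inner_testLp, h.eul_eq ht, FlowMap.integral_pull_mul, L2.inner_indicatorConstLp_one,
    setIntegral_eq_integral_of_ae_compl_eq_zero]
  · refine integral_congr_ae ((coeFn_mulL (compCb (testCb φ hφ hc) (κ t) * J t) f).mono
      fun ξ hξ => ?_)
    dsimp only
    rw [hξ]
    simp [flowQ]; ring
  · filter_upwards [coeFn_mulL (compCb (testCb φ hφ hc) (κ t) * J t) f] with ξ hξ hn
    have : φ (ξ + κ t ξ) = 0 := hR ξ (by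
      rw [mem_Icc, ← abs_le] at hn; exact not_le.1 hn)
    rw [hξ]; simp [this]

/-- The displacement is bounded uniformly near the given time, so the supports of φ∘q_t stay in one
compact interval. -/
lemma exists_radius (h : LagFlow I J U W κ) {s : ℝ} (hs : s ∈ I) {φ : ℝ → ℝ}
    (hc : HasCompactSupport φ) :
    ∃ R, ∀ᶠ t in 𝓝 s, ∀ ξ, R < |ξ| → φ (flowQ κ t ξ) = 0 := by
  obtain ⟨R, hR⟩ := hc.isCompact.isBounded.subset_closedBall 0
  refine ⟨R + (‖κ s‖ + 1), ?_⟩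
  have hk : ∀ᶠ t in 𝓝 s, ‖κ t‖ < ‖κ s‖ + 1 :=
    (h.hasDerivAt_κ s hs).continuousAt.norm.eventually (gt_mem_nhds (by simp))
  filter_upwards [hk] with t ht ξ hξ
  by_contra hne
  have h1 := hR (subset_tsupport _ hne)
  rw [Metric.mem_closedBall, dist_zero_right, Real.norm_eq_abs, flowQ] at h1
  have h2 := (κ t).norm_coe_le_norm ξ
  rw [Real.norm_eq_abs] at h2
  have h3 : |ξ| ≤ |ξ + κ t ξ| + |κ t ξ| := by
    have := abs_sub (ξ + κ t ξ) (κ t ξ)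
    simpa using this
  linarith

lemma continuousAt_compCb (h : LagFlow I J U W κ) {s : ℝ} (hs : s ∈ I) {φ : ℝ → ℝ}
    (hφ : ContDiff ℝ ∞ φ) (hc : HasCompactSupport φ) :
    ContinuousAt (fun t => compCb (testCb φ hφ hc) (κ t) * J t) s :=
  (hasDerivAt_compCb_testCb φ hφ hc (h.hasDerivAt_κ s hs)).continuousAt.mul
    (h.hasDerivAt_J s hs).continuousAt

/-- The Eulerian norm squared is the J-weighted Lagrangian one and the test pairings are explicit;
both are continuous in time, so weak continuity upgrades to strong. -/
lemma continuousAt_eul (h : LagFlow I J U W κ) {F : ℝ → L2R} {s : ℝ} (hs : s ∈ I)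
    (hF : ContinuousAt F s) : ContinuousAt (fun t => eul κ t (F t)) s := by
  refine continuousAt_of_inner_dense dense_testSet ?_ ?_
  · have h1 : ContinuousAt (fun t => ⟪mulL (J t) (F t), F t⟫_ℝ) s :=
      ((mulL.continuous.continuousAt.comp (h.hasDerivAt_J s hs).continuousAt).clm_apply hF).inner (𝕜 := ℝ) hF
    refine h1.congr ?_
    filter_upwards [h.mem_nhds hs] with t ht
    rw [h.eul_eq ht, FlowMap.norm_sq_pull]
  · rintro _ ⟨φ, hφ, hc, rfl⟩
    obtain ⟨R, hR⟩ := h.exists_radius hs hc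
    have h1 : ContinuousAt (fun t => ⟪indicatorConstLp 2 (measurableSet_Icc (a := -R) (b := R))
        measure_Icc_lt_top.ne (1 : ℝ), mulL (compCb (testCb φ hφ hc) (κ t) * J t) (F t)⟫_ℝ) s :=
      continuousAt_const.inner (𝕜 := ℝ)
        ((mulL.continuous.continuousAt.comp (h.continuousAt_compCb hs hφ hc)).clm_apply hF)
    refine h1.congr ?_
    filter_upwards [h.mem_nhds hs, hR] with t ht hRt
    rw [h.inner_eul_testLp ht (F t) hφ hc hRt]

/-- The Lagrangian form of the Eulerian time derivative. -/
def dtEul (J : ℝ → Cb) (U : ℝ → H1) (t : ℝ) (G F' : L2R) : L2R :=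
  G - mulL (emb (U t) * Ring.inverse (J t)) F'

/-- The integrand is almost everywhere the ξ-derivative of φ(q) U F, since U_ξ = J W. -/
lemma integral_transport (h : LagFlow I J U W κ) {t : ℝ} (ht : t ∈ I) (F : H1) {φ : ℝ → ℝ}
    (hφ : ContDiff ℝ ∞ φ) (hc : HasCompactSupport φ) :
    ∫ ξ, ((deriv φ (flowQ κ t ξ) * emb (U t) ξ * J t ξ
      + φ (flowQ κ t ξ) * (emb (W t) ξ * J t ξ)) * F.1 0 ξ
      + φ (flowQ κ t ξ) * J t ξ * (emb (U t) ξ * (J t ξ)⁻¹ * F.1 1 ξ)) = 0 := by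
  have hf := h.flowMap ht
  have hφ1 : ContDiff ℝ 1 φ := hφ.of_le (by simp)
  have p1 : IsPrimitive (fun ξ => φ (flowQ κ t ξ)) (fun ξ => deriv φ (flowQ κ t ξ) * J t ξ) :=
    IsPrimitive.of_hasDerivAt (hf.hasDerivAt_comp hφ1)
      (((hφ1.continuous_deriv le_rfl).comp hf.continuous_q).mul (J t).continuous)
  have p2 := p1.mul ((h.isPrimitive_emb_U ht).mul (isPrimitive_emb F))
  have c1 : HasCompactSupport (fun ξ => φ (flowQ κ t ξ)) := hf.hasCompactSupport_comp hc
  have c2 : HasCompactSupport (fun ξ => deriv φ (flowQ κ t ξ)) := hf.hasCompactSupport_comp hc.deriv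
  rw [← p2.integral_eq_zero c1.mul_right (c2.mul_right.mul_right.add c1.mul_right)]
  refine integral_congr_ae ?_
  filter_upwards [ae_eq_emb F] with ξ hξ
  have hJ := (hf.J_pos ξ).ne'
  rw [hξ]
  simp only [Pi.mul_apply, BoundedContinuousFunction.coe_mul]
  field_simp
  ring

/-- For f(t, x) = F(t, q_t⁻¹(x)) one has f_t = F_t - (U/J)F_ξ, as ∂_t q_t⁻¹ = -U/J. The spatial term
exists only in L², so the derivative is first taken on test pairings, where it falls on φ(q)J and is
moved back by `integral_transport`. -/
lemma hasDerivAt_eul (h : LagFlow I J U W κ) {F : ℝ → H1} {G : ℝ → L2R}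
    (hFc : ContinuousOn F I) (hF : ∀ t ∈ I, HasDerivAt (fun τ => (F τ).1 0) (G t) t)
    (hG : ContinuousOn G I) {s : ℝ} (hs : s ∈ I) :
    HasDerivAt (fun t => eul κ t ((F t).1 0)) (eul κ s (dtEul J U s (G s) ((F s).1 1))) s := by
  have hdt : ∀ t ∈ I, ContinuousAt (fun τ => dtEul J U τ (G τ) ((F τ).1 1)) t := fun t ht => by
    have hm := h.mem_nhds ht
    have hJ := (h.hasDerivAt_J t ht).continuousAt
    have hi : ContinuousAt (fun τ => Ring.inverse (J τ)) t := by
      obtain ⟨u, hu⟩ := isUnit_of_PosCb (h.pos t ht)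
      have h0 : ContinuousAt (Ring.inverse : Cb → Cb) (J t) := hu ▸ NormedRing.inverse_continuousAt u
      exact h0.comp hJ
    have hu : ContinuousAt (fun τ => emb (U τ)) t :=
      emb.continuous.continuousAt.comp (h.continuousOn_U.continuousAt hm)
    have hF1 : ContinuousAt (fun τ => (F τ).1 1) t :=
      (H1.comp 1).continuous.continuousAt.comp (hFc.continuousAt hm)
    exact (hG.continuousAt hm).sub
      ((mulL.continuous.continuousAt.comp (hu.mul hi)).clm_apply hF1)
  refine hasDerivAt_of_inner_dense (g := fun t => eul κ t (dtEul J U t (G t) ((F t).1 1)))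
    dense_testSet (h.continuousAt_eul hs (hdt s hs)) ?_
  filter_upwards [h.mem_nhds hs] with t ht
  rintro _ ⟨φ, hφ, hc, rfl⟩
  obtain ⟨R₁, hR₁⟩ := h.exists_radius ht hc
  obtain ⟨R₂, hR₂⟩ := h.exists_radius ht hc.deriv
  set R := max R₁ R₂
  have hR : ∀ᶠ t in 𝓝 t, ∀ ξ, R < |ξ| → φ (flowQ κ t ξ) = 0 :=
    hR₁.mono fun τ hτ ξ hξ => hτ ξ ((le_max_left _ _).trans_lt hξ)
  have hR' : ∀ ξ, R < |ξ| → deriv φ (flowQ κ t ξ) = 0 :=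
    fun ξ hξ => hR₂.self_of_nhds ξ ((le_max_right _ _).trans_lt hξ)
  set χ := indicatorConstLp 2 (measurableSet_Icc (a := -R) (b := R)) (μ := volume)
    measure_Icc_lt_top.ne (1 : ℝ)
  have hev : (fun τ => ⟪eul κ τ ((F τ).1 0), testLp φ hφ hc⟫_ℝ) =ᶠ[𝓝 t]
      fun τ => ⟪χ, mulL (compCb (testCb φ hφ hc) (κ τ) * J τ) ((F τ).1 0)⟫_ℝ := by
    filter_upwards [h.mem_nhds ht, hR] with τ hτ hRτ using h.inner_eul_testLp hτ _ hφ hc hRτ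
  refine HasDerivAt.congr_of_eventuallyEq ?_ hev
  have d1 := (hasDerivAt_compCb_testCb φ hφ hc (h.hasDerivAt_κ t ht)).mul (h.hasDerivAt_J t ht)
  have d2 := mulL.hasFDerivAt.comp_hasDerivAt t d1
  have d3 := d2.clm_apply (hF t ht)
  have d4 := ((innerSL ℝ) χ).hasFDerivAt.comp_hasDerivAt t d3
  refine d4.congr_deriv ?_
  rw [h.inner_eul_testLp ht _ hφ hc hR.self_of_nhds, innerSL_apply_apply]
  set A : Cb := compCb (testCb (deriv φ) (contDiff_deriv_infty hφ) hc.deriv) (κ t) * emb (U t) * J t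
    + compCb (testCb φ hφ hc) (κ t) * (emb (W t) * J t)
  set Φ : Cb := compCb (testCb φ hφ hc) (κ t) * J t
  have key : ⟪χ, mulL A ((F t).1 0) + mulL Φ (mulL (emb (U t) * Ring.inverse (J t)) ((F t).1 1))⟫_ℝ
      = 0 := by
    rw [L2.inner_indicatorConstLp_one, ← h.integral_transport ht (F t) hφ hc,
      setIntegral_eq_integral_of_ae_compl_eq_zero]
    · refine integral_congr_ae ?_
      filter_upwards [coeFn_mulL A ((F t).1 0), coeFn_mulL Φ (mulL (emb (U t) * Ring.inverse (J t))
        ((F t).1 1)), coeFn_mulL (emb (U t) * Ring.inverse (J t)) ((F t).1 1),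
        Lp.coeFn_add (mulL A ((F t).1 0))
          (mulL Φ (mulL (emb (U t) * Ring.inverse (J t)) ((F t).1 1)))] with ξ h1 h2 h3 h4
      rw [h4, Pi.add_apply, h1, h2, h3]
      simp only [A, Φ, BoundedContinuousFunction.coe_mul, BoundedContinuousFunction.coe_add,
        Pi.mul_apply, Pi.add_apply, compCb_apply, testCb_apply, inverse_Cb_apply (h.pos t ht)]
      rfl
    · filter_upwards [coeFn_mulL A ((F t).1 0), coeFn_mulL Φ (mulL (emb (U t) * Ring.inverse (J t))
        ((F t).1 1)), Lp.coeFn_add (mulL A ((F t).1 0))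
          (mulL Φ (mulL (emb (U t) * Ring.inverse (J t)) ((F t).1 1)))] with ξ h1 h2 h4 hn
      have hlt : R < |ξ| := by rw [mem_Icc, ← abs_le] at hn; exact not_le.1 hn
      have e1 : φ (ξ + κ t ξ) = 0 := hR.self_of_nhds ξ hlt
      have e2 : deriv φ (ξ + κ t ξ) = 0 := hR' ξ hlt
      rw [h4, Pi.add_apply, h1, h2]
      simp [A, Φ, e1, e2]
  rw [inner_add_right] at key
  rw [inner_add_right, dtEul, map_sub, inner_sub_right]
  have : ∀ x y z w : ℝ, x + y = 0 → x = w → w + z = z - y := fun x y z w h1 h2 => by linarith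
  exact this _ _ _ _ key rfl

end LagFlow

/-! ### From Lagrangian solutions to Eulerian solutions -/

/-- The pair `(F^(i), F^(i+1))` of consecutive derivatives of `F ∈ H^k`, as an element of `H¹`. -/
def sobPart {k : ℕ} (F : SobolevSpace k) (i : Fin k) : H1 :=
  H1.mk (F.1 i.castSucc) (F.1 i.succ) (F.2 i)

/-- `F - F''` for `F ∈ H³`. -/
def momentum (F : SobolevSpace 3) : H1 := sobPart F 0 - sobPart F 2

/-- A solution of the Lagrangian equations on `(-δ, T)`, starting from the identity flow. -/
structure LagSol (lam δ : ℝ) (T : EReal) (X : ℝ → Cb × H1) : Prop where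
  δ_pos : 0 < δ
  T_pos : 0 < T
  init : (X 0).1 = 1
  curve : IsCurveIn (lagField lam) {p | p.1 ∈ PosCb} {t : ℝ | -δ < t ∧ (t : EReal) < T} X

/-- The displacement of the flow of a Lagrangian solution. -/
def displacement (X : ℝ → Cb × H1) (t : ℝ) : Cb := ∫ s in (0 : ℝ)..t, emb (velocity (X s))

namespace LagSol

variable {lam δ : ℝ} {T : EReal} {X : ℝ → Cb × H1}

/-- The open time interval of a Lagrangian solution. -/
abbrev ival (δ : ℝ) (T : EReal) : Set ℝ := {t : ℝ | -δ < t ∧ (t : EReal) < T}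

lemma isOpen_ival (δ : ℝ) (T : EReal) : IsOpen (ival δ T) :=
  (isOpen_lt continuous_const continuous_id).inter
    (isOpen_lt continuous_coe_real_ereal continuous_const)

lemma ordConnected_ival (δ : ℝ) (T : EReal) : (ival δ T).OrdConnected :=
  ⟨fun _ ha _ hb _ hc => ⟨ha.1.trans_le hc.1, (EReal.coe_le_coe_iff.2 hc.2).trans_lt hb.2⟩⟩

lemma zero_mem (h : LagSol lam δ T X) : (0 : ℝ) ∈ ival δ T :=
  ⟨by linarith [h.δ_pos], by simpa using h.T_pos⟩

lemma timeInterval_subset (h : LagSol lam δ T X) : timeInterval T ⊆ ival δ T :=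
  fun _ ht => ⟨by linarith [h.δ_pos, ht.1], ht.2⟩

lemma pos (h : LagSol lam δ T X) {t : ℝ} (ht : t ∈ ival δ T) : (X t).1 ∈ PosCb := (h.curve t ht).1

lemma hasDerivAt (h : LagSol lam δ T X) {t : ℝ} (ht : t ∈ ival δ T) :
    HasDerivAt X (lagField lam (X t)) t := (h.curve t ht).2

lemma hasDerivAt_fst (h : LagSol lam δ T X) {t : ℝ} (ht : t ∈ ival δ T) :
    HasDerivAt (fun τ => (X τ).1) (emb (slope' (X t)) * (X t).1) t :=
  (ContinuousLinearMap.fst ℝ Cb H1).hasFDerivAt.comp_hasDerivAt t (h.hasDerivAt ht)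

lemma hasDerivAt_snd (h : LagSol lam δ T X) {t : ℝ} (ht : t ∈ ival δ T) :
    HasDerivAt (fun τ => (X τ).2) (lagField lam (X t)).2 t :=
  (ContinuousLinearMap.snd ℝ Cb H1).hasFDerivAt.comp_hasDerivAt t (h.hasDerivAt ht)

lemma hasDerivAt_velocity (h : LagSol lam δ T X) {t : ℝ} (ht : t ∈ ival δ T) :
    HasDerivAt (fun τ => velocity (X τ)) (fderiv ℝ velocity (X t) (lagField lam (X t))) t :=
  ((contDiffAt_velocity (h.pos ht)).differentiableAt one_ne_zero).hasFDerivAt.comp_hasDerivAt t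
    (h.hasDerivAt ht)

lemma hasDerivAt_slope' (h : LagSol lam δ T X) {t : ℝ} (ht : t ∈ ival δ T) :
    HasDerivAt (fun τ => slope' (X τ)) (fderiv ℝ slope' (X t) (lagField lam (X t))) t :=
  ((contDiffAt_slope' (h.pos ht)).differentiableAt one_ne_zero).hasFDerivAt.comp_hasDerivAt t
    (h.hasDerivAt ht)

lemma continuousAt_field (h : LagSol lam δ T X) {t : ℝ} (ht : t ∈ ival δ T) :
    ContinuousAt (fun τ => lagField lam (X τ)) t :=
  (contDiffAt_lagField lam (h.pos ht)).continuousAt.comp (h.hasDerivAt ht).continuousAt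

lemma continuousAt_fderiv_velocity (h : LagSol lam δ T X) {t : ℝ} (ht : t ∈ ival δ T) :
    ContinuousAt (fun τ => fderiv ℝ velocity (X τ) (lagField lam (X τ))) t := by
  have h1 : ContinuousAt (fderiv ℝ velocity) (X t) :=
    ((contDiffAt_velocity (h.pos ht)).fderiv_right (m := 0) (by simp)).continuousAt
  have h2 : ContinuousAt (fun τ => fderiv ℝ velocity (X τ)) t :=
    ContinuousAt.comp (f := X) h1 (h.hasDerivAt ht).continuousAt
  exact h2.clm_apply (h.continuousAt_field ht)

lemma continuousAt_fderiv_slope' (h : LagSol lam δ T X) {t : ℝ} (ht : t ∈ ival δ T) :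
    ContinuousAt (fun τ => fderiv ℝ slope' (X τ) (lagField lam (X τ))) t := by
  have h1 : ContinuousAt (fderiv ℝ slope') (X t) :=
    ((contDiffAt_slope' (h.pos ht)).fderiv_right (m := 0) (by simp)).continuousAt
  have h2 : ContinuousAt (fun τ => fderiv ℝ slope' (X τ)) t :=
    ContinuousAt.comp (f := X) h1 (h.hasDerivAt ht).continuousAt
  exact h2.clm_apply (h.continuousAt_field ht)

lemma continuousOn_velocity (h : LagSol lam δ T X) :
    ContinuousOn (fun τ => velocity (X τ)) (ival δ T) :=
  fun _ ht => (h.hasDerivAt_velocity ht).continuousAt.continuousWithinAt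

lemma continuousOn_slope' (h : LagSol lam δ T X) :
    ContinuousOn (fun τ => slope' (X τ)) (ival δ T) :=
  fun _ ht => (h.hasDerivAt_slope' ht).continuousAt.continuousWithinAt

lemma lagFlow (h : LagSol lam δ T X) : LagFlow (ival δ T) (fun t => (X t).1)
    (fun t => velocity (X t)) (fun t => slope' (X t)) (displacement X) where
  isOpen := isOpen_ival δ T
  ordConnected := ordConnected_ival δ T
  zero_mem := h.zero_mem
  pos := fun _ ht => h.pos ht
  hasDerivAt_J := fun _ ht => h.hasDerivAt_fst ht
  hasDerivAt_κ := fun t ht => by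
    have hc : ContinuousOn (fun s => emb (velocity (X s))) (ival δ T) :=
      emb.continuous.comp_continuousOn h.continuousOn_velocity
    have hsub : uIcc 0 t ⊆ ival δ T := (ordConnected_ival δ T).uIcc_subset h.zero_mem ht
    exact intervalIntegral.integral_hasDerivAt_right ((hc.mono hsub).intervalIntegrable)
      (hc.stronglyMeasurableAtFilter (isOpen_ival δ T) t ht)
      (hc.continuousAt ((isOpen_ival δ T).mem_nhds ht))
  U_one := fun t ht => velocity_one (h.pos ht) (X t).2
  continuousOn_U := h.continuousOn_velocity
  continuousOn_W := h.continuousOn_slope'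
  J_zero := h.init
  κ_zero := by simp [displacement]

end LagSol

lemma FlowMap.hasWeakDeriv_pull' {J : Cb} {q p : ℝ → ℝ} (h : FlowMap J q p) (F : H1) {g : L2R}
    (hg : F.1 1 = mulL J g) : HasWeakDeriv (h.pull (F.1 0)) (h.pull g) :=
  h.hasWeakDeriv_pull (hg ▸ F.hasWeakDeriv)

/-- The tuple of Eulerian spatial derivatives of a Lagrangian solution. -/
def eulTuple (X : ℝ → Cb × H1) (t : ℝ) : PiLp 2 (fun _ : Fin (3 + 1) => L2R) :=
  WithLp.toLp 2 ![eul (displacement X) t ((velocity (X t)).1 0),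
    eul (displacement X) t ((slope' (X t)).1 0),
    eul (displacement X) t ((velocity (X t) - (X t).2).1 0),
    eul (displacement X) t ((slope' (X t)).1 0 - mulL (Ring.inverse (X t).1) ((X t).2.1 1))]

/-- The Eulerian solution associated with a Lagrangian solution. -/
def eulSol (X : ℝ → Cb × H1) (t : ℝ) : SobolevSpace 3 :=
  (SobolevSpace 3).orthogonalProjectionOnto (eulTuple X t)

/-- The tuple of time derivatives of the Eulerian derivatives of orders `0`, `1`, `2`. -/
def eulDtTuple (lam : ℝ) (X : ℝ → Cb × H1) (t : ℝ) : PiLp 2 (fun _ : Fin (2 + 1) => L2R) :=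
  WithLp.toLp 2 ![
    eul (displacement X) t (LagFlow.dtEul (fun t => (X t).1) (fun t => velocity (X t)) t
      ((fderiv ℝ velocity (X t) (lagField lam (X t))).1 0) ((velocity (X t)).1 1)),
    eul (displacement X) t (LagFlow.dtEul (fun t => (X t).1) (fun t => velocity (X t)) t
      ((fderiv ℝ slope' (X t) (lagField lam (X t))).1 0) ((slope' (X t)).1 1)),
    eul (displacement X) t (LagFlow.dtEul (fun t => (X t).1) (fun t => velocity (X t)) t
      ((fderiv ℝ velocity (X t) (lagField lam (X t)) - (lagField lam (X t)).2).1 0)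
      ((velocity (X t) - (X t).2).1 1))]

/-- The time derivative of the Eulerian solution. -/
def eulDt (lam : ℝ) (X : ℝ → Cb × H1) (t : ℝ) : SobolevSpace 2 :=
  (SobolevSpace 2).orthogonalProjectionOnto (eulDtTuple lam X t)

namespace LagSol

variable {lam δ : ℝ} {T : EReal} {X : ℝ → Cb × H1}

/-- Each entry is transported by the flow, and ∂_x corresponds to (1/J)∂_ξ: U_ξ = J W, W_ξ = J(U -
M), and (U - M)_ξ = J(W - M_ξ/J). -/
lemma eulTuple_mem (h : LagSol lam δ T X) {t : ℝ} (ht : t ∈ ival δ T) :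
    eulTuple X t ∈ SobolevSpace 3 := by
  have hf := h.lagFlow.flowMap ht
  have hp := h.pos ht
  have e1 : (velocity (X t)).1 1 = mulL (X t).1 ((slope' (X t)).1 0) := velocity_one hp (X t).2
  have e2 : (slope' (X t)).1 1 = mulL (X t).1 ((velocity (X t) - (X t).2).1 0) :=
    slope'_one hp (X t).2
  have e3 : (velocity (X t) - (X t).2).1 1 = mulL (X t).1
      ((slope' (X t)).1 0 - mulL (Ring.inverse (X t).1) ((X t).2.1 1)) := by
    rw [map_sub, mulL_mulL_inverse hp, ← e1]; rfl
  intro i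
  fin_cases i
  · change HasWeakDeriv (eul _ t _) (eul _ t _)
    rw [h.lagFlow.eul_eq ht, h.lagFlow.eul_eq ht]
    exact hf.hasWeakDeriv_pull' _ e1
  · change HasWeakDeriv (eul _ t _) (eul _ t _)
    rw [h.lagFlow.eul_eq ht, h.lagFlow.eul_eq ht]
    exact hf.hasWeakDeriv_pull' _ e2
  · change HasWeakDeriv (eul _ t _) (eul _ t _)
    rw [h.lagFlow.eul_eq ht, h.lagFlow.eul_eq ht]
    exact hf.hasWeakDeriv_pull' _ e3

lemma coe_eulSol (h : LagSol lam δ T X) {t : ℝ} (ht : t ∈ ival δ T) :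
    (eulSol X t).1 = eulTuple X t :=
  Submodule.starProjection_eq_self_iff.2 (h.eulTuple_mem ht)

lemma continuousAt_eulSol (h : LagSol lam δ T X) {t : ℝ} (ht : t ∈ ival δ T) :
    ContinuousAt (eulSol X) t := by
  have hm := (isOpen_ival δ T).mem_nhds ht
  have hv := (h.hasDerivAt_velocity ht).continuousAt
  have hs := (h.hasDerivAt_slope' ht).continuousAt
  have hM := (h.hasDerivAt_snd ht).continuousAt
  have hi : ContinuousAt (fun τ => Ring.inverse (X τ).1) t := by
    obtain ⟨u, hu⟩ := isUnit_of_PosCb (h.pos ht)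
    have h0 : ContinuousAt (Ring.inverse : Cb → Cb) (X t).1 := hu ▸ NormedRing.inverse_continuousAt u
    exact ContinuousAt.comp (f := fun τ => (X τ).1) h0 (h.hasDerivAt_fst ht).continuousAt
  have hc : ∀ (i : Fin 2) {F : ℝ → H1}, ContinuousAt F t → ContinuousAt (fun τ => (F τ).1 i) t :=
    fun i F hF => (H1.comp i).continuous.continuousAt.comp hF
  have h3 : ContinuousAt (fun τ => mulL (Ring.inverse (X τ).1) ((X τ).2.1 1)) t :=
    (mulL.continuous.continuousAt.comp hi).clm_apply (hc 1 hM)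
  have : ContinuousAt (fun t => ![eul (displacement X) t ((velocity (X t)).1 0),
      eul (displacement X) t ((slope' (X t)).1 0),
      eul (displacement X) t ((velocity (X t) - (X t).2).1 0),
      eul (displacement X) t
        ((slope' (X t)).1 0 - mulL (Ring.inverse (X t).1) ((X t).2.1 1))]) t := by
    rw [continuousAt_pi]
    intro i
    fin_cases i
    · exact h.lagFlow.continuousAt_eul ht (hc 0 hv)
    · exact h.lagFlow.continuousAt_eul ht (hc 0 hs)
    · exact h.lagFlow.continuousAt_eul ht (hc 0 (hv.sub hM))
    · exact h.lagFlow.continuousAt_eul ht ((hc 0 hs).sub h3)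
  have h4 : ContinuousAt (eulTuple X) t :=
    (PiLp.continuousLinearEquiv 2 ℝ (fun _ : Fin 4 => L2R)).symm.continuous.continuousAt.comp this
  exact ((SobolevSpace 3).orthogonalProjectionOnto).continuous.continuousAt.comp h4

/-- The Eulerian derivatives of orders `0`, `1`, `2`. -/
def eulTuple2 (X : ℝ → Cb × H1) (t : ℝ) : PiLp 2 (fun _ : Fin (2 + 1) => L2R) :=
  WithLp.toLp 2 ![eul (displacement X) t ((velocity (X t)).1 0),
    eul (displacement X) t ((slope' (X t)).1 0),
    eul (displacement X) t ((velocity (X t) - (X t).2).1 0)]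

lemma coe_sobolevIncl_eulSol (h : LagSol lam δ T X) {t : ℝ} (ht : t ∈ ival δ T) :
    (sobolevIncl (eulSol X t)).1 = eulTuple2 X t := by
  ext1 i
  have : (sobolevIncl (eulSol X t)).1 i = (eulSol X t).1 i.castSucc := rfl
  rw [this, h.coe_eulSol ht]
  fin_cases i <;> rfl

lemma hasDerivAt_comp0 {F : ℝ → H1} {F' : H1} {t : ℝ} (hF : HasDerivAt F F' t) :
    HasDerivAt (fun τ => (F τ).1 0) (F'.1 0) t :=
  (H1.comp 0).hasFDerivAt.comp_hasDerivAt t hF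

lemma hasDerivAt_eulTuple2 (h : LagSol lam δ T X) {t : ℝ} (ht : t ∈ ival δ T) :
    HasDerivAt (eulTuple2 X) (eulDtTuple lam X t) t := by
  have hc : ∀ {F : ℝ → H1}, (∀ t ∈ ival δ T, ContinuousAt F t) →
      ContinuousOn (fun τ => (F τ).1 0) (ival δ T) := fun {F} hF t ht =>
    ((H1.comp 0).continuous.continuousAt.comp (hF t ht)).continuousWithinAt
  have d0 := h.lagFlow.hasDerivAt_eul h.continuousOn_velocity
    (fun t ht => hasDerivAt_comp0 (h.hasDerivAt_velocity ht))
    (hc fun t ht => h.continuousAt_fderiv_velocity ht) ht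
  have d1 := h.lagFlow.hasDerivAt_eul h.continuousOn_slope'
    (fun t ht => hasDerivAt_comp0 (h.hasDerivAt_slope' ht))
    (hc fun t ht => h.continuousAt_fderiv_slope' ht) ht
  have d2 := h.lagFlow.hasDerivAt_eul (F := fun τ => velocity (X τ) - (X τ).2)
    (fun t ht => ((h.hasDerivAt_velocity ht).sub
      (h.hasDerivAt_snd ht)).continuousAt.continuousWithinAt)
    (fun t ht => hasDerivAt_comp0 ((h.hasDerivAt_velocity ht).sub (h.hasDerivAt_snd ht)))
    (hc fun t ht => (h.continuousAt_fderiv_velocity ht).sub (h.continuousAt_field ht).snd) ht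
  have : HasDerivAt (fun t => ![eul (displacement X) t ((velocity (X t)).1 0),
      eul (displacement X) t ((slope' (X t)).1 0),
      eul (displacement X) t ((velocity (X t) - (X t).2).1 0)])
      (WithLp.ofLp (eulDtTuple lam X t)) t := by
    rw [hasDerivAt_pi]
    intro i
    fin_cases i
    · exact d0
    · exact d1
    · exact d2
  exact (PiLp.continuousLinearEquiv 2 ℝ
    (fun _ : Fin 3 => L2R)).symm.toContinuousLinearMap.hasFDerivAt.comp_hasDerivAt t this

lemma hasDerivAt_eulSol (h : LagSol lam δ T X) {t : ℝ} (ht : t ∈ ival δ T) :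
    HasDerivAt (fun s => sobolevIncl (eulSol X s)) (eulDt lam X t) t := by
  have h1 : HasDerivAt (fun s => (SobolevSpace 2).orthogonalProjectionOnto (eulTuple2 X s))
      (eulDt lam X t) t :=
    ((SobolevSpace 2).orthogonalProjectionOnto).hasFDerivAt.comp_hasDerivAt t
      (h.hasDerivAt_eulTuple2 ht)
  refine h1.congr_of_eventuallyEq ?_
  filter_upwards [(isOpen_ival δ T).mem_nhds ht] with s hs
  apply Subtype.ext
  rw [h.coe_sobolevIncl_eulSol hs]
  refine (Submodule.starProjection_eq_self_iff.2 ?_).symm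
  rw [← h.coe_sobolevIncl_eulSol hs]
  exact (sobolevIncl (eulSol X s)).2

/-- The weak-derivative relations among the time derivatives need no separate check: the curve stays
in the closed subspace H², so its derivative does too, and derivatives are unique. -/
lemma coe_eulDt (h : LagSol lam δ T X) {t : ℝ} (ht : t ∈ ival δ T) :
    (eulDt lam X t).1 = eulDtTuple lam X t := by
  have h1 := (SobolevSpace 2).subtypeL.hasFDerivAt.comp_hasDerivAt t (h.hasDerivAt_eulSol ht)
  have h2 : HasDerivAt (eulTuple2 X) (eulDt lam X t).1 t := by
    refine h1.congr_of_eventuallyEq ?_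
    filter_upwards [(isOpen_ival δ T).mem_nhds ht] with s hs
    exact (h.coe_sobolevIncl_eulSol hs).symm
  exact h2.unique (h.hasDerivAt_eulTuple2 ht)

lemma continuousAt_eulDt (h : LagSol lam δ T X) {t : ℝ} (ht : t ∈ ival δ T) :
    ContinuousAt (eulDt lam X) t := by
  have hv := (h.hasDerivAt_velocity ht).continuousAt
  have hs := (h.hasDerivAt_slope' ht).continuousAt
  have hM := (h.hasDerivAt_snd ht).continuousAt
  have hui : ContinuousAt (fun τ => emb (velocity (X τ)) * Ring.inverse (X τ).1) t := by
    obtain ⟨u, hu⟩ := isUnit_of_PosCb (h.pos ht)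
    have h0 : ContinuousAt (Ring.inverse : Cb → Cb) (X t).1 := hu ▸ NormedRing.inverse_continuousAt u
    exact (emb.continuous.continuousAt.comp hv).mul
      (ContinuousAt.comp (f := fun τ => (X τ).1) h0 (h.hasDerivAt_fst ht).continuousAt)
  have hc : ∀ (i : Fin 2) {F : ℝ → H1}, ContinuousAt F t → ContinuousAt (fun τ => (F τ).1 i) t :=
    fun i F hF => (H1.comp i).continuous.continuousAt.comp hF
  have hd : ∀ {F G : ℝ → H1}, ContinuousAt F t → ContinuousAt G t →
      ContinuousAt (fun τ => eul (displacement X) τ (LagFlow.dtEul (fun t => (X t).1)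
        (fun t => velocity (X t)) τ ((G τ).1 0) ((F τ).1 1))) t := fun {F G} hF hG =>
    h.lagFlow.continuousAt_eul ht ((hc 0 hG).sub
      ((mulL.continuous.continuousAt.comp hui).clm_apply (hc 1 hF)))
  have hV := h.continuousAt_fderiv_velocity ht
  have : ContinuousAt (fun t => WithLp.ofLp (eulDtTuple lam X t)) t := by
    rw [continuousAt_pi]
    intro i
    fin_cases i
    · exact hd hv hV
    · exact hd hs (h.continuousAt_fderiv_slope' ht)
    · exact hd (hv.sub hM) (hV.sub (h.continuousAt_field ht).snd)
  have h4 : ContinuousAt (eulDtTuple lam X) t :=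
    (PiLp.continuousLinearEquiv 2 ℝ (fun _ : Fin 3 => L2R)).symm.continuous.continuousAt.comp this
  exact ((SobolevSpace 2).orthogonalProjectionOnto).continuous.continuousAt.comp h4

end LagSol

/-- The Eulerian velocity of a Lagrangian solution, as a function. -/
def eulFun (X : ℝ → Cb × H1) (t x : ℝ) : ℝ := emb (velocity (X t)) (flowP (displacement X) t x)

namespace LagSol

variable {lam δ : ℝ} {T : EReal} {X : ℝ → Cb × H1}

lemma isContRep_eulFun (h : LagSol lam δ T X) {t : ℝ} (ht : t ∈ ival δ T) :
    IsContRep (eulSol X t) (eulFun X t) := by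
  have hf := h.lagFlow.flowMap ht
  refine ⟨(emb (velocity (X t))).continuous.comp hf.continuous_p, ?_⟩
  have e : wderiv (eulSol X t) 0 = eul (displacement X) t ((velocity (X t)).1 0) := by
    rw [wderiv, h.coe_eulSol ht]; rfl
  rw [e]
  filter_upwards [h.lagFlow.coeFn_eul ht ((velocity (X t)).1 0),
    hf.ae_comp (ae_eq_emb (velocity (X t)))] with x h1 h2
  rw [h1, h2]; rfl

lemma emb_field_snd (p : Cb × H1) (ξ : ℝ) : emb (lagField lam p).2 ξ =
    -2 * (emb (slope' p) ξ * emb p.2 ξ) - lam * emb p.2 ξ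
      + 3 * (emb (velocity p) ξ * emb (slope' p) ξ)
      - 3 * (emb (velocity p) ξ * (emb (velocity p) ξ * emb (slope' p) ξ)) := by
  simp [lagField]

lemma emb_sobPart_zero (h : LagSol lam δ T X) {t : ℝ} (ht : t ∈ ival δ T) (x : ℝ) :
    emb (sobPart (eulSol X t) 0) x = emb (velocity (X t)) (flowP (displacement X) t x) :=
  congrFun (emb_eq (h.isContRep_eulFun ht).1 (h.isContRep_eulFun ht).2.symm) x

lemma emb_sobPart_one (h : LagSol lam δ T X) {t : ℝ} (ht : t ∈ ival δ T) (x : ℝ) :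
    emb (sobPart (eulSol X t) 1) x = emb (slope' (X t)) (flowP (displacement X) t x) := by
  have hf := h.lagFlow.flowMap ht
  refine congrFun (emb_eq ((emb (slope' (X t))).continuous.comp hf.continuous_p) ?_) x
  have e : (sobPart (eulSol X t) 1).1 0 = eul (displacement X) t ((slope' (X t)).1 0) := by
    change (eulSol X t).1 1 = _
    rw [h.coe_eulSol ht]; rfl
  rw [e]
  filter_upwards [h.lagFlow.coeFn_eul ht ((slope' (X t)).1 0),
    hf.ae_comp (ae_eq_emb (slope' (X t)))] with x h1 h2
  rw [h1, h2]; rfl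

lemma emb_sobPart_two (h : LagSol lam δ T X) {t : ℝ} (ht : t ∈ ival δ T) (x : ℝ) :
    emb (sobPart (eulSol X t) 2) x =
      emb (velocity (X t) - (X t).2) (flowP (displacement X) t x) := by
  have hf := h.lagFlow.flowMap ht
  refine congrFun (emb_eq ((emb (velocity (X t) - (X t).2)).continuous.comp hf.continuous_p) ?_) x
  have e : (sobPart (eulSol X t) 2).1 0 =
      eul (displacement X) t ((velocity (X t) - (X t).2).1 0) := by
    change (eulSol X t).1 2 = _
    rw [h.coe_eulSol ht]; rfl
  rw [e]
  filter_upwards [h.lagFlow.coeFn_eul ht ((velocity (X t) - (X t).2).1 0),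
    hf.ae_comp (ae_eq_emb (velocity (X t) - (X t).2))] with x h1 h2
  rw [h1, h2]; rfl

lemma satisfiesEquation (h : LagSol lam δ T X) {t : ℝ} (ht : t ∈ ival δ T) :
    SatisfiesEquation lam (eulSol X t) (eulDt lam X t) := by
  have hL := h.lagFlow
  have hf := hL.flowMap ht
  set κ := displacement X
  set U := velocity (X t)
  set W := slope' (X t)
  set M := (X t).2
  set J := (X t).1
  set Ud := fderiv ℝ velocity (X t) (lagField lam (X t))
  set Md := (lagField lam (X t)).2
  set D0 := LagFlow.dtEul (fun t => (X t).1) (fun t => velocity (X t)) t (Ud.1 0) (U.1 1)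
  set D2 := LagFlow.dtEul (fun t => (X t).1) (fun t => velocity (X t)) t ((Ud - Md).1 0) ((U - M).1 1)
  set N := W.1 0 - mulL (Ring.inverse J) (M.1 1)
  have eU0 : wderiv (eulSol X t) 0 = eul κ t (U.1 0) := by rw [wderiv, h.coe_eulSol ht]; rfl
  have eU1 : wderiv (eulSol X t) 1 = eul κ t (W.1 0) := by rw [wderiv, h.coe_eulSol ht]; rfl
  have eU2 : wderiv (eulSol X t) 2 = eul κ t ((U - M).1 0) := by rw [wderiv, h.coe_eulSol ht]; rfl
  have eU3 : wderiv (eulSol X t) 3 = eul κ t N := by rw [wderiv, h.coe_eulSol ht]; rfl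
  have eV0 : wderiv (eulDt lam X t) 0 = eul κ t D0 := by rw [wderiv, h.coe_eulDt ht]; rfl
  have eV2 : wderiv (eulDt lam X t) 2 = eul κ t D2 := by rw [wderiv, h.coe_eulDt ht]; rfl
  -- The time derivative of the velocity, known only as an abstract Fréchet derivative, cancels in
  -- u_t - u_txx; what remains is given by the vector field.
  have hD : D0 - D2 = Md.1 0 - mulL (emb U * Ring.inverse J) (M.1 1) := by
    have a1 : (Ud - Md).1 0 = Ud.1 0 - Md.1 0 := rfl
    have a2 : (U - M).1 1 = U.1 1 - M.1 1 := rfl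
    simp only [D0, D2, LagFlow.dtEul, a1, a2, map_sub]
    simp only [U, J]
    abel
  have hpt : ∀ᵐ ξ, D0 ξ - D2 ξ + lam * (U.1 0 ξ - (U - M).1 0 ξ) + 3 * U.1 0 ξ ^ 2 * W.1 0 ξ
      = U.1 0 ξ * N ξ + 2 * W.1 0 ξ * (U - M).1 0 ξ := by
    filter_upwards [Lp.coeFn_sub D0 D2, Lp.coeFn_sub (Md.1 0)
      (mulL (emb U * Ring.inverse J) (M.1 1)), coeFn_mulL (emb U * Ring.inverse J) (M.1 1),
      Lp.coeFn_sub (W.1 0) (mulL (Ring.inverse J) (M.1 1)), coeFn_mulL (Ring.inverse J) (M.1 1),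
      ae_eq_emb U, ae_eq_emb W, ae_eq_emb Md, ae_eq_emb (U - M)] with ξ a1 a2 a3 a4 a5 a6 a7 a8 a9
    rw [hD, a2] at a1
    simp only [Pi.sub_apply] at a1 a4
    have e1 : emb Md ξ = _ := emb_field_snd (lam := lam) (X t) ξ
    have e2 : emb (U - M) ξ = emb U ξ - emb M ξ := by simp
    rw [← a1, a4, a3, a5, a6, a7, a8, a9, e1, e2]
    simp only [BoundedContinuousFunction.coe_mul, Pi.mul_apply]
    ring
  rw [SatisfiesEquation, eU0, eU1, eU2, eU3, eV0, eV2]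
  filter_upwards [hf.ae_comp hpt, hL.coeFn_eul ht (U.1 0), hL.coeFn_eul ht (W.1 0),
    hL.coeFn_eul ht ((U - M).1 0), hL.coeFn_eul ht N, hL.coeFn_eul ht D0, hL.coeFn_eul ht D2]
    with x h0 h1 h2 h3 h4 h5 h6
  rw [h1, h2, h3, h4, h5, h6]
  exact h0

/-- The evolution of the slope along the flow, in terms of the Eulerian solution. -/
lemma hasDerivAt_slope_along (h : LagSol lam δ T X) {t : ℝ} (ht : t ∈ ival δ T) (ξ : ℝ) :
    HasDerivAt (fun τ => emb (slope' (X τ)) ξ)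
      (emb (sobPart (eulDt lam X t) 1) (flowQ (displacement X) t ξ)
        + emb (sobPart (eulSol X t) 0) (flowQ (displacement X) t ξ)
          * emb (sobPart (eulSol X t) 2) (flowQ (displacement X) t ξ)) t := by
  have hL := h.lagFlow
  have hf := hL.flowMap ht
  set Wd := fderiv ℝ slope' (X t) (lagField lam (X t))
  have h1 : HasDerivAt (fun τ => emb (slope' (X τ)) ξ) (emb Wd ξ) t :=
    ((BoundedContinuousFunction.evalCLM ℝ ξ).comp emb).hasFDerivAt.comp_hasDerivAt t
      (h.hasDerivAt_slope' ht)
  refine h1.congr_deriv ?_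
  rw [h.emb_sobPart_zero ht, h.emb_sobPart_two ht, hf.left_inv]
  let a : Cb := emb Wd - emb (velocity (X t)) * emb (velocity (X t) - (X t).2)
  have h2 : ⇑(emb (sobPart (eulDt lam X t) 1)) = fun x => a (flowP (displacement X) t x) := by
    refine emb_eq (a.continuous.comp hf.continuous_p) ?_
    have e : (sobPart (eulDt lam X t) 1).1 0 = eul (displacement X) t (LagFlow.dtEul
        (fun t => (X t).1) (fun t => velocity (X t)) t (Wd.1 0) ((slope' (X t)).1 1)) := by
      change (eulDt lam X t).1 1 = _
      rw [h.coe_eulDt ht]; rfl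
    have e' : (slope' (X t)).1 1 = mulL (X t).1 ((velocity (X t) - (X t).2).1 0) :=
      slope'_one (h.pos ht) (X t).2
    rw [e, LagFlow.dtEul, e', mulL_mul, mulL_inverse_mulL (h.pos ht)]
    have hpt : ∀ᵐ ξ, (Wd.1 0 - mulL (emb (velocity (X t)))
        ((velocity (X t) - (X t).2).1 0) : L2R) ξ = a ξ := by
      filter_upwards [Lp.coeFn_sub (Wd.1 0) (mulL (emb (velocity (X t)))
        ((velocity (X t) - (X t).2).1 0)), coeFn_mulL (emb (velocity (X t)))
        ((velocity (X t) - (X t).2).1 0), ae_eq_emb Wd, ae_eq_emb (velocity (X t) - (X t).2)]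
        with ξ a1 a2 a3 a4
      rw [a1, Pi.sub_apply, a2, a3, a4]
      rfl
    filter_upwards [hL.coeFn_eul ht (Wd.1 0 - mulL (emb (velocity (X t)))
      ((velocity (X t) - (X t).2).1 0)), hf.ae_comp hpt] with x a1 a2
    rw [a1, a2]
  rw [h2]
  simp only [hf.left_inv, a]
  simp

end LagSol

/-! ### Initial data and existence of solutions -/

/-- The initial state of the Lagrangian equations with Eulerian datum `F`. -/
def lagInit (F : SobolevSpace 3) : Cb × H1 := (1, momentum F)

lemma one_mem_PosCb : (1 : Cb) ∈ PosCb := ⟨1, one_pos, fun _ => le_rfl⟩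

/-- With J = 1 the elliptic problem is U - U'' = u₀ - u₀'', whose only solution is u₀. -/
lemma velocity_lagInit (F : SobolevSpace 3) : velocity (lagInit F) = sobPart F 0 := by
  refine velocity_unique (W := sobPart F 1) one_mem_PosCb ?_ ?_
  · rw [mulL_one]; rfl
  · rw [mulL_one]
    change F.1 2 = F.1 0 - (F.1 0 - F.1 2)
    abel

lemma slope'_lagInit (F : SobolevSpace 3) : slope' (lagInit F) = sobPart F 1 := by
  apply H1.ext_zero
  have h1 := velocity_one one_mem_PosCb (momentum F)
  rw [mulL_one] at h1
  have h2 : velocity (1, momentum F) = sobPart F 0 := velocity_lagInit F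
  rw [h2] at h1
  exact h1.symm

lemma LagSol.isSolution {lam δ : ℝ} {T : EReal} {X : ℝ → Cb × H1} (h : LagSol lam δ T X)
    {F : SobolevSpace 3} {u₀ : ℝ → ℝ} (hF : IsContRep F u₀) (hX : X 0 = lagInit F) :
    IsSolution lam u₀ T (eulFun X) := by
  have hs := h.timeInterval_subset
  refine ⟨h.T_pos, ?_, eulSol X, eulDt lam X, fun t ht => h.isContRep_eulFun (hs ht),
    fun t ht => (h.continuousAt_eulSol (hs ht)).continuousWithinAt,
    fun t ht => (h.continuousAt_eulDt (hs ht)).continuousWithinAt,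
    fun t ht => (h.hasDerivAt_eulSol (hs ht)).hasDerivWithinAt,
    fun t ht => h.satisfiesEquation (hs ht)⟩
  have hq : ∀ ξ, flowQ (displacement X) 0 ξ = ξ := fun ξ => by simp [flowQ, displacement]
  have hp : ∀ x, flowP (displacement X) 0 x = x := fun x => by
    have := (h.lagFlow.flowMap h.zero_mem).left_inv x
    rwa [hq] at this
  ext x
  rw [eulFun, hp, hX, velocity_lagInit]
  exact congrFun (emb_eq hF.1 hF.2.symm) x

/-! ### Conservative form, energy decay and uniqueness -/

lemma norm_coord_le {k : ℕ} (F : SobolevSpace k) (i : Fin (k + 1)) : ‖F.1 i‖ ≤ ‖F‖ :=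
  PiLp.norm_apply_le F.1 i

lemma norm_sobPart_le {k : ℕ} (F : SobolevSpace k) (i : Fin k) : ‖sobPart F i‖ ≤ 2 * ‖F‖ := by
  have h1 := norm_coord_le F i.castSucc
  have h2 := norm_coord_le F i.succ
  have h3 := H1.norm_le (sobPart F i)
  have e1 : (sobPart F i).1 0 = F.1 i.castSucc := rfl
  have e2 : (sobPart F i).1 1 = F.1 i.succ := rfl
  rw [e1, e2] at h3
  linarith

/-- `sobPart` as a continuous linear map. -/
def sobPartL {k : ℕ} (i : Fin k) : SobolevSpace k →L[ℝ] H1 :=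
  LinearMap.mkContinuous
    { toFun := fun F => sobPart F i
      map_add' := fun _ _ => H1.ext_zero rfl
      map_smul' := fun _ _ => H1.ext_zero rfl } 2 (fun F => norm_sobPart_le F i)

lemma mulL_emb_comm (F G : H1) : mulL (emb F) (G.1 0) = mulL (emb G) (F.1 0) := by
  refine Lp.ext ?_
  filter_upwards [coeFn_mulL (emb F) (G.1 0), coeFn_mulL (emb G) (F.1 0), ae_eq_emb F, ae_eq_emb G]
    with x h1 h2 h3 h4
  rw [h1, h2, h3, h4, mul_comm]

lemma inner_mulL_comm (a : Cb) (f g : L2R) : ⟪f, mulL a g⟫_ℝ = ⟪mulL a f, g⟫_ℝ := by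
  rw [real_inner_comm, inner_mulL, inner_mulL]
  congr 1; ext x; ring

lemma abs_inner_mulL_le (a : Cb) (f g : L2R) : |⟪f, mulL a g⟫_ℝ| ≤ ‖a‖ * (‖f‖ * ‖g‖) := by
  refine (abs_real_inner_le_norm _ _).trans ?_
  have := mul_le_mul_of_nonneg_left (norm_mulL_le a g) (norm_nonneg f)
  linarith

/-- The flux `u³ - u u_xx - u_x² / 2`. -/
def flux (U : SobolevSpace 3) : H1 :=
  mulH (sobPart U 0) (mulH (sobPart U 0) (sobPart U 0)) - mulH (sobPart U 0) (sobPart U 2)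
    - (1 / 2 : ℝ) • mulH (sobPart U 1) (sobPart U 1)

lemma flux_zero (U : SobolevSpace 3) : (flux U).1 0 =
    mulL (emb (sobPart U 0)) (mulL (emb (sobPart U 0)) (U.1 0)) - mulL (emb (sobPart U 0)) (U.1 2)
      - (1 / 2 : ℝ) • mulL (emb (sobPart U 1)) (U.1 1) := rfl

/-- The conservative form of the equation. -/
lemma SatisfiesEquation.conservative {lam : ℝ} {U : SobolevSpace 3} {V : SobolevSpace 2}
    (h : SatisfiesEquation lam U V) :
    V.1 0 - V.1 2 = -(lam • (U.1 0 - U.1 2)) - (flux U).1 1 := by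
  set u := sobPart U 0
  set ux := sobPart U 1
  set uxx := sobPart U 2
  have e : (flux U).1 1 = mulL (emb u) (mulL (emb u) (U.1 1) + mulL (emb u) (U.1 1))
      + mulL (emb (mulH u u)) (U.1 1) - (mulL (emb u) (U.1 3) + mulL (emb uxx) (U.1 1))
      - (1 / 2 : ℝ) • (mulL (emb ux) (U.1 2) + mulL (emb ux) (U.1 2)) := rfl
  have e2 : mulL (emb uxx) (U.1 1) = mulL (emb ux) (U.1 2) := mulL_emb_comm uxx ux
  rw [e, e2, emb_mulH, mulL_mul]
  refine Lp.ext ?_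
  set a := mulL (emb u) (U.1 1)
  set b := mulL (emb u) a
  set c := mulL (emb u) (U.1 3)
  set d := mulL (emb ux) (U.1 2)
  have e3 : mulL (emb u) (a + a) + b - (c + d) - (1 / 2 : ℝ) • (d + d)
      = (3 : ℝ) • b - c - (2 : ℝ) • d := by
    rw [map_add]; module
  rw [e3]
  have e0 : -(lam • (U.1 0 - U.1 2)) - ((3 : ℝ) • b - c - (2 : ℝ) • d)
      = lam • U.1 2 - lam • U.1 0 - (3 : ℝ) • b + c + (2 : ℝ) • d := by module
  rw [e0]
  filter_upwards [h, coeFn_mulL (emb u) (U.1 1), coeFn_mulL (emb u) a, coeFn_mulL (emb u) (U.1 3),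
    coeFn_mulL (emb ux) (U.1 2), Lp.coeFn_sub (V.1 0) (V.1 2),
    Lp.coeFn_add (lam • U.1 2 - lam • U.1 0 - (3 : ℝ) • b + c) ((2 : ℝ) • d),
    Lp.coeFn_add (lam • U.1 2 - lam • U.1 0 - (3 : ℝ) • b) c,
    Lp.coeFn_sub (lam • U.1 2 - lam • U.1 0) ((3 : ℝ) • b),
    Lp.coeFn_sub (lam • U.1 2) (lam • U.1 0), Lp.coeFn_smul lam (U.1 2), Lp.coeFn_smul lam (U.1 0),
    Lp.coeFn_smul (3 : ℝ) b, Lp.coeFn_smul (2 : ℝ) d, ae_eq_emb u, ae_eq_emb ux]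
    with x h0 h1 h2 h3 h4 h5 h6 h7 h8 h9 h10 h11 h12 h13 h14 h15
  rw [h5, h6]
  simp only [Pi.add_apply, Pi.sub_apply, Pi.smul_apply, smul_eq_mul] at *
  rw [h7, h8, h9, h10, h11, h12, h13, h2, h3, h4, h1]
  have e4 : emb u x = wderiv U 0 x := h14.symm
  have e5 : emb ux x = wderiv U 1 x := h15.symm
  rw [e4, e5]
  change _ - _ = lam * wderiv U 2 x - lam * wderiv U 0 x
    - 3 * (wderiv U 0 x * (wderiv U 0 x * wderiv U 1 x)) + wderiv U 0 x * wderiv U 3 x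
    + 2 * (wderiv U 1 x * wderiv U 2 x)
  change wderiv V 0 x - wderiv V 2 x = _
  linarith

/-- The `H¹` pairing of a difference of solutions with its time derivative. -/
lemma inner_sub_conservative {lam : ℝ} {U U' : SobolevSpace 3} {V V' : SobolevSpace 2}
    (h : V.1 0 - V.1 2 = -(lam • (U.1 0 - U.1 2)) - (flux U).1 1)
    (h' : V'.1 0 - V'.1 2 = -(lam • (U'.1 0 - U'.1 2)) - (flux U').1 1) :
    ⟪sobPart U 0 - sobPart U' 0, sobPart V 0 - sobPart V' 0⟫_ℝ =
      -lam * ‖sobPart U 0 - sobPart U' 0‖ ^ 2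
        + ⟪U.1 1 - U'.1 1, (flux U).1 0 - (flux U').1 0⟫_ℝ := by
  -- Three integrations by parts express the H¹ pairing through w = u - u' and the difference of (1
  -- - ∂_x²)u_t, which the conservative equation supplies; the flux is left paired with w_x.
  have i1 := inner_one_zero (sobPart U 0 - sobPart U' 0) (sobPart V 1 - sobPart V' 1)
  have i2 := inner_one_zero (sobPart U 0 - sobPart U' 0) (sobPart U 1 - sobPart U' 1)
  have i3 := inner_one_zero (sobPart U 0 - sobPart U' 0) (flux U - flux U')
  rw [H1.inner_eq, H1.norm_sq, ← real_inner_self_eq_norm_sq, ← real_inner_self_eq_norm_sq]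
  change ⟪U.1 1 - U'.1 1, V.1 1 - V'.1 1⟫_ℝ = -⟪U.1 0 - U'.1 0, V.1 2 - V'.1 2⟫_ℝ at i1
  change ⟪U.1 1 - U'.1 1, U.1 1 - U'.1 1⟫_ℝ = -⟪U.1 0 - U'.1 0, U.1 2 - U'.1 2⟫_ℝ at i2
  change ⟪U.1 1 - U'.1 1, (flux U).1 0 - (flux U').1 0⟫_ℝ
    = -⟪U.1 0 - U'.1 0, (flux U).1 1 - (flux U').1 1⟫_ℝ at i3
  change ⟪U.1 0 - U'.1 0, V.1 0 - V'.1 0⟫_ℝ + ⟪U.1 1 - U'.1 1, V.1 1 - V'.1 1⟫_ℝ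
    = -lam * (⟪U.1 0 - U'.1 0, U.1 0 - U'.1 0⟫_ℝ + ⟪U.1 1 - U'.1 1, U.1 1 - U'.1 1⟫_ℝ)
      + ⟪U.1 1 - U'.1 1, (flux U).1 0 - (flux U').1 0⟫_ℝ
  rw [i1, i2, i3]
  have e : V.1 0 - V'.1 0 = (V.1 2 - V'.1 2) - lam • (U.1 0 - U'.1 0) + lam • (U.1 2 - U'.1 2)
      - ((flux U).1 1 - (flux U').1 1) := by
    have a1 : V.1 0 = V.1 2 + (-(lam • (U.1 0 - U.1 2)) - (flux U).1 1) := by rw [← h]; abel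
    have a2 : V'.1 0 = V'.1 2 + (-(lam • (U'.1 0 - U'.1 2)) - (flux U').1 1) := by rw [← h']; abel
    rw [a1, a2]; module
  rw [e]
  simp only [inner_add_right, inner_sub_right, real_inner_smul_right]
  ring

/-- The integrand u_x(u³ - u u_xx - u_x²/2) is the derivative of u⁴/4 - u u_x²/2. -/
lemma inner_flux (U : SobolevSpace 3) : ⟪U.1 1, (flux U).1 0⟫_ℝ = 0 := by
  set u := sobPart U 0
  set ux := sobPart U 1
  have i1 := inner_one_zero (mulH u u) (mulH u u)
  have i2 := inner_one_zero (mulH ux ux) u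
  rw [real_inner_comm] at i1
  have e1 : (mulH u u).1 1 = mulL (emb u) (U.1 1) + mulL (emb u) (U.1 1) := rfl
  have e2 : (mulH u u).1 0 = mulL (emb u) (U.1 0) := rfl
  have e3 : (mulH ux ux).1 1 = mulL (emb ux) (U.1 2) + mulL (emb ux) (U.1 2) := rfl
  have e4 : (mulH ux ux).1 0 = mulL (emb ux) (U.1 1) := rfl
  have e5 : u.1 0 = U.1 0 := rfl
  have e6 : u.1 1 = U.1 1 := rfl
  have e7 : mulL (emb u) (U.1 1) = mulL (emb ux) (U.1 0) := mulL_emb_comm u ux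
  rw [e1, e2, inner_add_right] at i1
  rw [e3, e4, e5, e6, inner_add_left, ← inner_mulL_comm, ← e7, inner_mulL_comm,
    real_inner_comm] at i2
  rw [flux_zero, inner_sub_right, inner_sub_right, real_inner_smul_right]
  have e8 : ⟪U.1 1, mulL (emb u) (mulL (emb u) (U.1 0))⟫_ℝ
      = ⟪mulL (emb u) (U.1 0), mulL (emb u) (U.1 1)⟫_ℝ := by
    rw [inner_mulL_comm, real_inner_comm]
  have e9 : ⟪U.1 1, mulL (emb u) (U.1 2)⟫_ℝ = ⟪mulL (emb u) (U.1 1), U.1 2⟫_ℝ :=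
    inner_mulL_comm _ _ _
  have e10 : ⟪U.1 1, mulL (emb ux) (U.1 1)⟫_ℝ = ⟪mulL (emb ux) (U.1 1), U.1 1⟫_ℝ :=
    inner_mulL_comm _ _ _
  have e11 : ⟪mulL (emb u) (U.1 1), U.1 2⟫_ℝ = ⟪mulL (emb u) (U.1 2), U.1 1⟫_ℝ := by
    rw [← inner_mulL_comm, real_inner_comm]
  rw [e8, e9, e10, e11]
  linarith

/-- The difference is arranged linearly in w = u - u' so that w_xx, which H¹ does not control, is
multiplied by u alone; paired with w_x, this term can be integrated by parts. -/
lemma flux_sub (U U' : SobolevSpace 3) : (flux U).1 0 - (flux U').1 0 =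
    mulL (emb (sobPart U 0) * emb (sobPart U 0) + emb (sobPart U 0) * emb (sobPart U' 0)
      + emb (sobPart U' 0) * emb (sobPart U' 0) - emb (sobPart U' 2)) (U.1 0 - U'.1 0)
      - mulL (emb (sobPart U 0)) (U.1 2 - U'.1 2)
      - (1 / 2 : ℝ) • mulL (emb (sobPart U 1) + emb (sobPart U' 1)) (U.1 1 - U'.1 1) := by
  have c1 : mulL (emb (sobPart U' 0)) (U.1 0) = mulL (emb (sobPart U 0)) (U'.1 0) :=
    mulL_emb_comm (sobPart U' 0) (sobPart U 0)
  have c2 : mulL (emb (sobPart U' 2)) (U.1 0) = mulL (emb (sobPart U 0)) (U'.1 2) :=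
    mulL_emb_comm (sobPart U' 2) (sobPart U 0)
  have c3 : mulL (emb (sobPart U' 2)) (U'.1 0) = mulL (emb (sobPart U' 0)) (U'.1 2) :=
    mulL_emb_comm (sobPart U' 2) (sobPart U' 0)
  have c4 : mulL (emb (sobPart U' 1)) (U.1 1) = mulL (emb (sobPart U 1)) (U'.1 1) :=
    mulL_emb_comm (sobPart U' 1) (sobPart U 1)
  have c5 : ∀ f : L2R, mulL (emb (sobPart U' 0)) (mulL (emb (sobPart U 0)) f)
      = mulL (emb (sobPart U 0)) (mulL (emb (sobPart U' 0)) f) := fun f => by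
    rw [← mulL_mul, ← mulL_mul, mul_comm]
  rw [flux_zero, flux_zero]
  simp only [map_add, map_sub, add_apply, sub_apply, mulL_mul, c1, c2, c3, c4, c5]
  module

lemma abs_inner_flux_sub_le {U U' : SobolevSpace 3} {K : ℝ} (hU : ‖U‖ ≤ K) (hU' : ‖U'‖ ≤ K) :
    |⟪U.1 1 - U'.1 1, (flux U).1 0 - (flux U').1 0⟫_ℝ| ≤
      (12 * K ^ 2 + 6 * K) * ‖sobPart U 0 - sobPart U' 0‖ ^ 2 := by
  have hK : 0 ≤ K := (norm_nonneg _).trans hU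
  have hb : ∀ (F : SobolevSpace 3) (i : Fin 3), ‖F‖ ≤ K → ‖emb (sobPart F i)‖ ≤ 2 * K :=
    fun F i hF => (norm_emb_le _).trans ((norm_sobPart_le F i).trans (by linarith))
  set w := sobPart U 0 - sobPart U' 0
  set wx := sobPart U 1 - sobPart U' 1
  have e0 : U.1 0 - U'.1 0 = w.1 0 := rfl
  have e1 : U.1 1 - U'.1 1 = w.1 1 := rfl
  have e2 : U.1 2 - U'.1 2 = wx.1 1 := rfl
  have e3 : w.1 1 = wx.1 0 := rfl
  rw [flux_sub, e0, e1, e2, inner_sub_right, inner_sub_right, real_inner_smul_right]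
  set c : Cb := emb (sobPart U 0) * emb (sobPart U 0) + emb (sobPart U 0) * emb (sobPart U' 0)
      + emb (sobPart U' 0) * emb (sobPart U' 0) - emb (sobPart U' 2)
  have hc : ‖c‖ ≤ 12 * K ^ 2 + 2 * K := by
    have hmul : ∀ a b : Cb, ‖a‖ ≤ 2 * K → ‖b‖ ≤ 2 * K → ‖a * b‖ ≤ 4 * K ^ 2 := fun a b ha hb => by
      refine (norm_mul_le a b).trans ?_
      nlinarith [norm_nonneg a, norm_nonneg b, mul_le_mul ha hb (norm_nonneg b) (by linarith)]
    have h1 := hmul _ _ (hb U 0 hU) (hb U 0 hU)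
    have h2 := hmul _ _ (hb U 0 hU) (hb U' 0 hU')
    have h3 := hmul _ _ (hb U' 0 hU') (hb U' 0 hU')
    have h4 := hb U' 2 hU'
    have := norm_sub_le (emb (sobPart U 0) * emb (sobPart U 0)
      + emb (sobPart U 0) * emb (sobPart U' 0) + emb (sobPart U' 0) * emb (sobPart U' 0))
      (emb (sobPart U' 2))
    have h5 := norm_add₃_le (a := emb (sobPart U 0) * emb (sobPart U 0))
      (b := emb (sobPart U 0) * emb (sobPart U' 0)) (c := emb (sobPart U' 0) * emb (sobPart U' 0))
    simp only [c]
    linarith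
  have k1 := abs_inner_mulL_le c (w.1 1) (w.1 0)
  -- The dangerous term: ∫ w_x u w_xx = -½ ∫ u_x w_x².
  have k2 : |⟪w.1 1, mulL (emb (sobPart U 0)) (wx.1 1)⟫_ℝ| ≤ K * ‖w.1 1‖ ^ 2 := by
    have ibp := inner_one_zero wx (mulH (sobPart U 0) wx)
    rw [mulH_zero, mulH_one, inner_add_right] at ibp
    have f1 : mulL (emb wx) ((sobPart U 0).1 1) = mulL (emb (sobPart U 1)) (wx.1 0) :=
      mulL_emb_comm wx (sobPart U 1)
    rw [f1, inner_mulL_comm, real_inner_comm, inner_mulL_comm] at ibp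
    rw [← inner_mulL_comm] at ibp
    have f2 := abs_inner_mulL_le (emb (sobPart U 1)) (wx.1 0) (wx.1 0)
    rw [e3]
    have f3 := hb U 1 hU
    have f4 : ⟪wx.1 0, mulL (emb (sobPart U 0)) (wx.1 1)⟫_ℝ
        = -(1 / 2) * ⟪wx.1 0, mulL (emb (sobPart U 1)) (wx.1 0)⟫_ℝ := by linarith
    rw [f4, abs_mul]
    have f5 : |(-(1 / 2) : ℝ)| = 1 / 2 := by norm_num
    rw [f5]
    nlinarith [mul_le_mul_of_nonneg_right f3 (mul_nonneg (norm_nonneg (wx.1 0))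
      (norm_nonneg (wx.1 0)))]
  have k3 := abs_inner_mulL_le (emb (sobPart U 1) + emb (sobPart U' 1)) (w.1 1) (w.1 1)
  have h3 : ‖emb (sobPart U 1) + emb (sobPart U' 1)‖ ≤ 4 * K :=
    (norm_add_le _ _).trans (by linarith [hb U 1 hU, hb U' 1 hU'])
  have hw := H1.norm_sq w
  have k1' : ‖c‖ * (‖w.1 1‖ * ‖w.1 0‖) ≤ (12 * K ^ 2 + 2 * K) * (‖w.1 1‖ * ‖w.1 0‖) := by gcongr
  have k3' : ‖emb (sobPart U 1) + emb (sobPart U' 1)‖ * (‖w.1 1‖ * ‖w.1 1‖)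
      ≤ 4 * K * (‖w.1 1‖ * ‖w.1 1‖) := by gcongr
  have k4 : ‖w.1 1‖ * ‖w.1 0‖ ≤ (‖w.1 1‖ ^ 2 + ‖w.1 0‖ ^ 2) / 2 := by
    nlinarith [sq_nonneg (‖w.1 1‖ - ‖w.1 0‖)]
  have k5 := mul_le_mul_of_nonneg_left k4 (show 0 ≤ 12 * K ^ 2 + 2 * K by positivity)
  have k6 : ∀ a b c : ℝ, |a - b - 1 / 2 * c| ≤ |a| + |b| + 1 / 2 * |c| := fun a b c => by
    rw [abs_le]
    constructor <;> linarith [neg_abs_le a, le_abs_self a, neg_abs_le b, le_abs_self b,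
      neg_abs_le c, le_abs_self c]
  refine (k6 _ _ _).trans ?_
  rw [hw]
  nlinarith [mul_nonneg hK (sq_nonneg ‖w.1 0‖), mul_nonneg hK (sq_nonneg ‖w.1 1‖),
    mul_nonneg (sq_nonneg K) (sq_nonneg ‖w.1 0‖), mul_nonneg (sq_nonneg K) (sq_nonneg ‖w.1 1‖)]

lemma IsContRep.emb_eq {k : ℕ} {F : SobolevSpace (k + 1)} {f : ℝ → ℝ} (h : IsContRep F f) :
    ⇑(emb (sobPart F 0)) = f := _root_.emb_eq h.1 h.2.symm

lemma IsContRep.hasDerivAt {k : ℕ} {F : SobolevSpace (k + 2)} {f : ℝ → ℝ} (h : IsContRep F f)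
    (x : ℝ) : HasDerivAt f (emb (sobPart F 1) x) x := by
  rw [← h.emb_eq]
  exact hasDerivAt_emb (emb (sobPart F 1)).continuous (ae_eq_emb (sobPart F 1)) x

lemma IsContRep.deriv_eq {k : ℕ} {F : SobolevSpace (k + 2)} {f : ℝ → ℝ} (h : IsContRep F f) :
    deriv f = emb (sobPart F 1) := funext fun x => (h.hasDerivAt x).deriv

lemma IsContRep.h1Norm_eq {k : ℕ} {F : SobolevSpace (k + 2)} {f : ℝ → ℝ} (h : IsContRep F f) :
    h1Norm f = ‖sobPart F 0‖ := by
  rw [h1Norm, h.deriv_eq]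
  rw [Real.sqrt_eq_iff_eq_sq (by positivity) (norm_nonneg _), H1.norm_sq, norm_sq_L2R, norm_sq_L2R]
  congr 1
  · exact integral_congr_ae (h.2.mono fun x hx => by dsimp only; rw [hx]; rfl)
  · exact integral_congr_ae ((ae_eq_emb (sobPart F 1)).mono fun x hx => by dsimp only; rw [← hx]; rfl)

lemma hasDerivWithinAt_sobPart {U : ℝ → SobolevSpace 3} {V : SobolevSpace 2} {s : Set ℝ} {t : ℝ}
    (h : HasDerivWithinAt (fun τ => sobolevIncl (U τ)) V s t) :
    HasDerivWithinAt (fun τ => sobPart (U τ) 0) (sobPart V 0) s t :=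
  (sobPartL (k := 2) 0).hasFDerivAt.comp_hasDerivWithinAt t h

lemma timeInterval_Icc_subset {T : EReal} {b : ℝ} (hb : b ∈ timeInterval T) :
    Icc 0 b ⊆ timeInterval T := fun _ ht =>
  ⟨ht.1, (EReal.coe_le_coe_iff.2 ht.2).trans_lt hb.2⟩

lemma timeInterval_mono {T T' : EReal} (h : T ≤ T') : timeInterval T ⊆ timeInterval T' :=
  fun _ ht => ⟨ht.1, ht.2.trans_le h⟩

lemma timeInterval_mem_nhdsGE {T : EReal} {t : ℝ} (ht : t ∈ timeInterval T) :
    timeInterval T ∈ 𝓝[≥] t := by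
  have h1 : {s : ℝ | (s : EReal) < T} ∈ 𝓝 t :=
    (isOpen_lt continuous_coe_real_ereal continuous_const).mem_nhds ht.2
  filter_upwards [mem_nhdsWithin_of_mem_nhds h1, self_mem_nhdsWithin] with s hs hs'
  exact ⟨ht.1.trans hs', hs⟩

/-- The energy `‖u(t)‖_{H¹}` does not increase. -/
lemma energy_le {lam : ℝ} (hlam : 0 ≤ lam) {T : EReal} {U : ℝ → SobolevSpace 3}
    {V : ℝ → SobolevSpace 2}
    (hd : ∀ t ∈ timeInterval T,
      HasDerivWithinAt (fun s => sobolevIncl (U s)) (V t) (timeInterval T) t)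
    (he : ∀ t ∈ timeInterval T, SatisfiesEquation lam (U t) (V t))
    {t : ℝ} (ht : t ∈ timeInterval T) : ‖sobPart (U t) 0‖ ≤ ‖sobPart (U 0) 0‖ := by
  have hder : ∀ s ∈ timeInterval T, HasDerivWithinAt (fun τ => ‖sobPart (U τ) 0‖ ^ 2)
      (2 * (-lam * ‖sobPart (U s) 0‖ ^ 2)) (timeInterval T) s := fun s hs => by
    have h1 := (hasDerivWithinAt_sobPart (hd s hs)).norm_sq
    have h2 := (he s hs).conservative
    -- Comparison with the zero solution turns the identity for differences into the energy law:
    -- ‖u‖² has derivative -2λ‖u‖².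
    have h0 : ((0 : SobolevSpace 2).1 0 - (0 : SobolevSpace 2).1 2 : L2R) =
        -(lam • ((0 : SobolevSpace 3).1 0 - (0 : SobolevSpace 3).1 2))
          - (flux (0 : SobolevSpace 3)).1 1 := by
      have e0 : ∀ i, sobPart (0 : SobolevSpace 3) i = 0 := fun i => H1.ext_zero rfl
      have e1 : flux (0 : SobolevSpace 3) = 0 := by simp [flux, e0]
      rw [e1]; simp
    have h3 := inner_sub_conservative h2 h0
    have e0 : sobPart (0 : SobolevSpace 3) 0 = 0 := H1.ext_zero rfl
    have e0' : sobPart (0 : SobolevSpace 2) 0 = 0 := H1.ext_zero rfl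
    have e1 : (flux (0 : SobolevSpace 3)).1 0 = 0 := by rw [flux_zero]; simp
    have e2 : (0 : SobolevSpace 3).1 1 = 0 := rfl
    rw [e0, e0', e1, e2, sub_zero, sub_zero, sub_zero, sub_zero, inner_flux, add_zero] at h3
    rw [h3] at h1
    exact h1
  have hsub := timeInterval_Icc_subset ht
  have hanti : AntitoneOn (fun τ => ‖sobPart (U τ) 0‖ ^ 2) (Icc 0 t) := by
    refine antitoneOn_of_hasDerivWithinAt_nonpos (convex_Icc 0 t)
      (fun s hs => ((hder s (hsub hs)).continuousWithinAt).mono hsub)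
      (fun s hs => (hder s (hsub (interior_subset hs))).mono (interior_subset.trans hsub))
      (fun s hs => ?_)
    nlinarith [mul_nonneg hlam (sq_nonneg ‖sobPart (U s) 0‖)]
  have := hanti ⟨le_rfl, ht.1⟩ ⟨ht.1, le_rfl⟩ ht.1
  exact abs_le_of_sq_le_sq' this (norm_nonneg _) |>.2

/-- Uniqueness for the Cauchy problem. -/
theorem IsSolution.unique {lam : ℝ} {u₀ : ℝ → ℝ} {T T' : EReal} {u v : ℝ → ℝ → ℝ}
    (hu : IsSolution lam u₀ T u) (hv : IsSolution lam u₀ T' v) (hT : T ≤ T') :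
    ∀ t ∈ timeInterval T, v t = u t := by
  obtain ⟨-, hu0, U, V, hrep, hUc, -, hUd, hUe⟩ := hu
  obtain ⟨-, hv0, U', V', hrep', hUc', -, hUd', hUe'⟩ := hv
  intro t ht
  have hsub := timeInterval_Icc_subset ht
  have hsub' := hsub.trans (timeInterval_mono hT)
  -- H³ bounds on the compact interval provide the constant in the difference estimate; Grönwall
  -- then forces the H¹ distance to vanish.
  obtain ⟨K₁, hK₁⟩ := isCompact_Icc.exists_bound_of_continuousOn (hUc.mono hsub)
  obtain ⟨K₂, hK₂⟩ := isCompact_Icc.exists_bound_of_continuousOn (hUc'.mono hsub')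
  set K := max K₁ K₂
  let E : ℝ → ℝ := fun τ => ‖sobPart (U τ) 0 - sobPart (U' τ) 0‖ ^ 2
  have hEd : ∀ s ∈ Icc 0 t, HasDerivWithinAt E (2 * (-lam * ‖sobPart (U s) 0 - sobPart (U' s) 0‖ ^ 2
      + ⟪(U s).1 1 - (U' s).1 1, (flux (U s)).1 0 - (flux (U' s)).1 0⟫_ℝ)) (timeInterval T) s := by
    intro s hs
    have h1 := ((hasDerivWithinAt_sobPart (hUd s (hsub hs))).sub
      ((hasDerivWithinAt_sobPart (hUd' s (hsub' hs))).mono (timeInterval_mono hT))).norm_sq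
    have h2 := inner_sub_conservative (hUe s (hsub hs)).conservative
      (hUe' s (hsub' hs)).conservative
    rw [← h2]
    exact h1
  have hE0 : E 0 = 0 := by
    have h0 := left_mem_Icc.2 ht.1
    have e1 := (hrep 0 (hsub h0)).emb_eq
    have e2 := (hrep' 0 (hsub' h0)).emb_eq
    have : sobPart (U 0) 0 = sobPart (U' 0) 0 := by
      apply emb_injective
      apply DFunLike.coe_injective
      rw [e1, e2, hu0, hv0]
    simp [E, this]
  have := eq_zero_of_abs_deriv_le_mul_abs_self_of_eq_zero_right (f := E)
    (K := 2 * (|lam| + (12 * K ^ 2 + 6 * K))) (a := 0) (b := t)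
    (fun s hs => (hEd s hs).continuousWithinAt.mono hsub)
    (fun s hs => (hEd s (Ico_subset_Icc_self hs)).mono_of_mem_nhdsWithin
      (timeInterval_mem_nhdsGE (hsub (Ico_subset_Icc_self hs)))) hE0 (fun s hs => ?_) t
    (right_mem_Icc.2 ht.1)
  · have hw : sobPart (U t) 0 = sobPart (U' t) 0 := by
      simpa [E, sub_eq_zero] using this
    rw [← (hrep t ht).emb_eq, ← (hrep' t (timeInterval_mono hT ht)).emb_eq, hw]
  · have hs' := Ico_subset_Icc_self hs
    have h1 := abs_inner_flux_sub_le ((hK₁ s hs').trans (le_max_left K₁ K₂))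
      ((hK₂ s hs').trans (le_max_right K₁ K₂))
    have hE : 0 ≤ E s := sq_nonneg _
    rw [Real.norm_eq_abs, Real.norm_eq_abs, abs_of_nonneg hE, abs_mul, abs_two, mul_assoc]
    refine mul_le_mul_of_nonneg_left ?_ zero_le_two
    refine (abs_add_le _ _).trans ?_
    rw [add_mul, abs_mul, abs_neg]
    refine add_le_add ?_ h1
    rw [abs_of_nonneg (sq_nonneg ‖sobPart (U s) 0 - sobPart (U' s) 0‖)]

/-! ### The pointwise bound behind the Riccati inequality -/

/-- A bounded subsolution of `A' = A - h` is controlled by the integral of the positive part of the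
source to the right. -/
lemma le_integral_Ioi_of_hasDerivAt {A h k : ℝ → ℝ} {C : ℝ}
    (hA : ∀ x, HasDerivAt A (A x - h x) x) (hC : ∀ x, |A x| ≤ C) (hhk : ∀ x, h x ≤ k x)
    (hk0 : ∀ x, 0 ≤ k x) (hkc : Continuous k) (hki : Integrable k) (x : ℝ) :
    A x ≤ ∫ y in Ioi x, k y := by
  -- The integrating factor gives (e^{-y}A)' = -e^{-y}h ≥ -e^{-x}k for y ≥ x. The added integral
  -- makes `G` nondecreasing, and boundedness of `A` removes the term at infinity.
  let G : ℝ → ℝ := fun y => Real.exp (-y) * A y + Real.exp (-x) * ∫ s in x..y, k s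
  have hG : ∀ y, HasDerivAt G (Real.exp (-x) * k y - Real.exp (-y) * h y) y := fun y => by
    have h1 : HasDerivAt (fun y => Real.exp (-y)) (Real.exp (-y) * (-1)) y :=
      (hasDerivAt_neg y).exp
    have h2 : HasDerivAt (fun y => ∫ s in x..y, k s) (k y) y :=
      intervalIntegral.integral_hasDerivAt_right (hkc.intervalIntegrable _ _)
        (hkc.stronglyMeasurableAtFilter _ _) hkc.continuousAt
    exact ((h1.mul (hA y)).add (h2.const_mul (Real.exp (-x)))).congr_deriv (by ring)
  have hmono : MonotoneOn G (Ici x) := by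
    refine monotoneOn_of_hasDerivWithinAt_nonneg (convex_Ici x)
      (fun y _ => (hG y).continuousAt.continuousWithinAt)
      (fun y _ => (hG y).hasDerivWithinAt) (fun y hy => ?_)
    rw [interior_Ici] at hy
    have e1 : Real.exp (-y) ≤ Real.exp (-x) := Real.exp_le_exp.2 (by linarith [mem_Ioi.1 hy])
    have e2 := mul_le_mul_of_nonneg_left (hhk y) (Real.exp_pos (-y)).le
    have e3 := mul_le_mul_of_nonneg_right e1 (hk0 y)
    linarith
  have hle : ∀ y ∈ Ici x, Real.exp (-x) * A x
      ≤ Real.exp (-y) * C + Real.exp (-x) * ∫ s in Ioi x, k s := fun y hy => by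
    have h1 := hmono self_mem_Ici hy hy
    simp only [G, intervalIntegral.integral_same, mul_zero, add_zero] at h1
    refine h1.trans (add_le_add ?_ ?_)
    · exact mul_le_mul_of_nonneg_left ((le_abs_self _).trans (hC y)) (Real.exp_pos _).le
    · refine mul_le_mul_of_nonneg_left ?_ (Real.exp_pos _).le
      rw [intervalIntegral.integral_of_le hy]
      exact setIntegral_mono_set hki.integrableOn (Eventually.of_forall hk0)
        Ioc_subset_Ioi_self.eventuallyLE
  have hlim : Tendsto (fun y => Real.exp (-y) * C + Real.exp (-x) * ∫ s in Ioi x, k s) atTop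
      (𝓝 (0 * C + Real.exp (-x) * ∫ s in Ioi x, k s)) :=
    ((Real.tendsto_exp_neg_atTop_nhds_zero).mul_const C).add tendsto_const_nhds
  have := ge_of_tendsto hlim ((eventually_ge_atTop x).mono hle)
  rw [zero_mul, zero_add] at this
  exact le_of_mul_le_mul_left this (Real.exp_pos _)

/-- The bound `P ≤ ½ ∫ k` for bounded solutions of `P - P'' = h` with `h ≤ k`. -/
lemma two_mul_le_integral_of_helmholtz {P Q : Cb} {h k : ℝ → ℝ}
    (hP : ∀ x, HasDerivAt P (Q x) x) (hQ : ∀ x, HasDerivAt Q (P x - h x) x)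
    (hhk : ∀ x, h x ≤ k x) (hk0 : ∀ x, 0 ≤ k x) (hkc : Continuous k) (hki : Integrable k)
    (x : ℝ) : 2 * P x ≤ ∫ y, k y := by
  -- Factorisation of 1 - ∂_x²: P + Q is estimated by the source to the right of x and P - Q, after
  -- reflection, by the source to the left. Their sum is 2P.
  have h1 := le_integral_Ioi_of_hasDerivAt (A := fun x => P x + Q x) (h := h) (C := ‖P + Q‖)
    (fun x => ((hP x).add (hQ x)).congr_deriv (by ring))
    (fun x => (P + Q).norm_coe_le_norm x) hhk hk0 hkc hki x
  have h2 := le_integral_Ioi_of_hasDerivAt (A := fun x => P (-x) - Q (-x)) (h := fun x => h (-x))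
    (k := fun x => k (-x)) (C := ‖P - Q‖)
    (fun x => (((hP (-x)).sub (hQ (-x))).comp x (hasDerivAt_neg x)).congr_deriv (by ring))
    (fun x => (P - Q).norm_coe_le_norm (-x)) (fun x => hhk (-x)) (fun x => hk0 (-x))
    (by fun_prop) hki.comp_neg (-x)
  rw [integral_comp_neg_Ioi, neg_neg] at h2
  rw [← intervalIntegral.integral_Iic_add_Ioi (b := x) hki.integrableOn hki.integrableOn]
  linarith

/-- The convective derivative of the slope satisfies a Riccati type inequality. -/
lemma SatisfiesEquation.slope_le {lam : ℝ} {U : SobolevSpace 3} {V : SobolevSpace 2}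
    (h : SatisfiesEquation lam U V) {c : ℝ} (hc : 0 ≤ c) (hU : ‖sobPart U 0‖ ^ 2 ≤ 2 * c ^ 2)
    (x : ℝ) :
    emb (sobPart V 1) x + emb (sobPart U 0) x * emb (sobPart U 2) x ≤
      -lam * emb (sobPart U 1) x - emb (sobPart U 1) x ^ 2 / 2 + (c ^ 2 / 2 + 2 * c ^ 3) := by
  set u := sobPart U 0
  set ux := sobPart U 1
  set uxx := sobPart U 2
  -- The conservative equation integrated once: P' = Q and Q' = P - `hs`. Working with P avoids the
  -- nonlocal operator (1 - ∂_x²)⁻¹.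
  let P : H1 := sobPart V 1 + lam • ux + (1 / 2 : ℝ) • mulH u u - flux U
  let Q : H1 := sobPart V 0 + lam • u + mulH u ux
  have hPv : ∀ x, emb P x = emb (sobPart V 1) x + lam * emb ux x + 1 / 2 * emb u x ^ 2
      - (emb u x ^ 3 - emb u x * emb uxx x - 1 / 2 * emb ux x ^ 2) := fun x => by
    simp only [P, flux, map_add, map_sub, map_smul, emb_mulH]
    simp only [BoundedContinuousFunction.coe_add, BoundedContinuousFunction.coe_sub, Pi.add_apply,
      Pi.sub_apply, BoundedContinuousFunction.coe_smul, BoundedContinuousFunction.coe_mul,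
      Pi.mul_apply, smul_eq_mul, u, ux, uxx]
    ring
  have hP1 : P.1 1 = Q.1 0 := by
    have e1 : P.1 1 = V.1 2 + lam • U.1 2
        + (1 / 2 : ℝ) • (mulL (emb u) (U.1 1) + mulL (emb u) (U.1 1)) - (flux U).1 1 := rfl
    have e2 : Q.1 0 = V.1 0 + lam • U.1 0 + mulL (emb u) (U.1 1) := rfl
    have e3 := h.conservative
    have e4 : V.1 0 = V.1 2 + (-(lam • (U.1 0 - U.1 2)) - (flux U).1 1) := by rw [← e3]; abel
    rw [e1, e2, e4]
    module
  let hs : ℝ → ℝ := fun x => 1 / 2 * emb u x ^ 2 - emb u x ^ 3 - 1 / 2 * emb ux x ^ 2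
  let R : H1 := sobPart V 1 + lam • ux + mulH ux ux + mulH u uxx
  have hRv : ∀ x, emb R x = emb P x - hs x := fun x => by
    rw [hPv]
    simp only [R, hs, map_add, map_smul, emb_mulH]
    simp only [BoundedContinuousFunction.coe_add, Pi.add_apply,
      BoundedContinuousFunction.coe_smul, BoundedContinuousFunction.coe_mul,
      Pi.mul_apply, smul_eq_mul]
    ring
  have hQ1 : Q.1 1 = R.1 0 := by
    have e1 : Q.1 1 = V.1 1 + lam • U.1 1 + (mulL (emb u) (U.1 2) + mulL (emb ux) (U.1 1)) := rfl
    have e2 : R.1 0 = V.1 1 + lam • U.1 1 + mulL (emb ux) (U.1 1) + mulL (emb u) (U.1 2) := rfl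
    rw [e1, e2]; abel
  have hPd : ∀ x, HasDerivAt (emb P) (emb Q x) x := fun x =>
    hasDerivAt_emb (emb Q).continuous (hP1 ▸ ae_eq_emb Q) x
  have hQd : ∀ x, HasDerivAt (emb Q) (emb P x - hs x) x := fun x => by
    rw [← hRv]
    exact hasDerivAt_emb (emb R).continuous (hQ1 ▸ ae_eq_emb R) x
  have hu : ∀ x, |emb u x| ≤ c := fun x =>
    abs_le_of_sq_le_sq (by linarith [two_mul_emb_sq_le u x]) hc
  have hcube : ∀ x, |emb u x ^ 3| ≤ c * emb u x ^ 2 := fun x => by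
    rw [abs_pow, pow_succ', sq_abs]
    exact mul_le_mul_of_nonneg_right (hu x) (sq_nonneg _)
  have hsq : (fun x => U.1 0 x ^ 2) =ᵐ[volume] fun x => emb u x ^ 2 :=
    (ae_eq_emb u).mono fun x hx => by dsimp only; rw [← hx]; rfl
  have hi : Integrable (fun x => emb u x ^ 2) :=
    (Lp.memLp (U.1 0)).integrable_sq.congr hsq
  have hint : ∫ x, emb u x ^ 2 ≤ 2 * c ^ 2 := by
    rw [← integral_congr_ae hsq, ← norm_sq_L2R]
    have := H1.norm_sq u
    have e : u.1 0 = U.1 0 := rfl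
    rw [e] at this
    nlinarith [sq_nonneg ‖u.1 1‖]
  -- Dropping -u_x²/2 and using |u| ≤ c leaves the source (1/2 + c)u², of integral at most (1 +
  -- 2c)c². Thus P ≤ c²/2 + c³; the remaining u³ contributes the second c³.
  have key := two_mul_le_integral_of_helmholtz (h := hs) (k := fun x => (1 / 2 + c) * emb u x ^ 2)
    hPd hQd (fun x => ?_) (fun x => by positivity) (by fun_prop) (hi.const_mul _) x
  · rw [integral_const_mul] at key
    have h1 := mul_le_mul_of_nonneg_left hint (show 0 ≤ 1 / 2 + c by linarith)
    have h2 := (le_abs_self _).trans (hcube x)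
    have h3 : emb u x ^ 2 ≤ c ^ 2 := sq_le_sq' (by linarith [(abs_le.1 (hu x)).1]) (abs_le.1 (hu x)).2
    have h4 := mul_le_mul_of_nonneg_left h3 hc
    have h5 := hPv x
    nlinarith [sq_nonneg (emb u x)]
  · have h2 := (neg_abs_le _).trans' (neg_le_neg (hcube x))
    simp only [hs]
    nlinarith [sq_nonneg (emb ux x)]

/-! ### Continuation as long as the slope is bounded below -/

section Bounds

variable {E : Type*} [NormedAddCommGroup E] [NormedSpace ℝ E]

lemma exists_bound_of_norm_deriv_le {f f' : ℝ → E} {b K ε : ℝ}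
    (hd : ∀ t ∈ Ico 0 b, HasDerivAt f (f' t) t)
    (hK : ∀ t ∈ Ico 0 b, ‖f' t‖ ≤ K * ‖f t‖ + ε) : ∃ C, ∀ t ∈ Ico 0 b, ‖f t‖ ≤ C := by
  refine ⟨gronwallBound ‖f 0‖ |K| |ε| b, fun t ht => ?_⟩
  have hsub : Icc 0 t ⊆ Ico 0 b := fun s hs => ⟨hs.1, hs.2.trans_lt ht.2⟩
  have h1 := norm_le_gronwallBound_of_norm_deriv_right_le (f := f) (f' := f') (δ := ‖f 0‖) (K := |K|)
    (ε := |ε|) (a := 0) (b := t) (fun s hs => (hd s (hsub hs)).continuousAt.continuousWithinAt)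
    (fun s hs => (hd s (hsub (Ico_subset_Icc_self hs))).hasDerivWithinAt) le_rfl
    (fun s hs => (hK s (hsub (Ico_subset_Icc_self hs))).trans
      (add_le_add (mul_le_mul_of_nonneg_right (le_abs_self K) (norm_nonneg _)) (le_abs_self ε)))
    t (right_mem_Icc.2 ht.1)
  exact h1.trans (gronwallBound_mono (norm_nonneg _) (abs_nonneg _) (abs_nonneg _)
    (by linarith [ht.2]))

lemma exists_tendsto_of_norm_deriv_le [CompleteSpace E] {f f' : ℝ → E} {b C : ℝ} (hb : 0 < b)
    (hd : ∀ t ∈ Ico 0 b, HasDerivAt f (f' t) t) (hC : ∀ t ∈ Ico 0 b, ‖f' t‖ ≤ C) :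
    ∃ z, Tendsto f (𝓝[<] b) (𝓝 z) := by
  have hC0 : 0 ≤ C := (norm_nonneg _).trans (hC 0 ⟨le_rfl, hb⟩)
  have hL : ∀ s ∈ Ico 0 b, ∀ t ∈ Ico 0 b, ‖f t - f s‖ ≤ C * ‖t - s‖ := fun s hs t ht =>
    Convex.norm_image_sub_le_of_norm_hasDerivWithin_le
      (fun r hr => (hd r hr).hasDerivWithinAt) hC (convex_Ico 0 b) hs ht
  refine cauchy_map_iff_exists_tendsto.1 (Metric.cauchy_iff.2 ⟨inferInstance, fun ε hε => ?_⟩)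
  refine ⟨f '' (Ico 0 b ∩ Ioo (b - ε / (C + 1)) b), image_mem_map (inter_mem
    (Ico_mem_nhdsLT hb) (Ioo_mem_nhdsLT (by linarith [show 0 < ε / (C + 1) by positivity]))), ?_⟩
  rintro _ ⟨s, hs, rfl⟩ _ ⟨t, ht, rfl⟩
  rw [dist_eq_norm]
  refine (hL t ht.1 s hs.1).trans_lt ?_
  have h1 : ‖s - t‖ < ε / (C + 1) := by
    rw [Real.norm_eq_abs, abs_lt]
    constructor <;> linarith [hs.2.1, hs.2.2, ht.2.1, ht.2.2]
  have h2 : (C + 1) * ‖s - t‖ < ε := by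
    have := mul_lt_mul_of_pos_left h1 (show 0 < C + 1 by linarith)
    rwa [mul_div_cancel₀ _ (by linarith : C + 1 ≠ 0)] at this
  linarith [norm_nonneg (s - t)]

end Bounds

namespace LagSol

variable {lam δ : ℝ} {T : EReal} {X : ℝ → Cb × H1}

lemma norm_sobPart_le (h : LagSol lam δ T X) (hlam : 0 ≤ lam) {t : ℝ} (ht : t ∈ timeInterval T) :
    ‖sobPart (eulSol X t) 0‖ ≤ ‖sobPart (eulSol X 0) 0‖ :=
  energy_le hlam (V := eulDt lam X)
    (fun _ hs => (h.hasDerivAt_eulSol (h.timeInterval_subset hs)).hasDerivWithinAt)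
    (fun _ hs => h.satisfiesEquation (h.timeInterval_subset hs)) ht

/-- The Riccati inequality for the slope along the flow. -/
lemma exists_hasDerivAt_slope_le (h : LagSol lam δ T X) (hlam : 0 ≤ lam) {c : ℝ} (hc : 0 ≤ c)
    (hU : ‖sobPart (eulSol X 0) 0‖ ^ 2 ≤ 2 * c ^ 2) {t : ℝ} (ht : t ∈ timeInterval T) (ξ : ℝ) :
    ∃ w' : ℝ, HasDerivAt (fun τ => emb (slope' (X τ)) ξ) w' t ∧
      w' ≤ -lam * emb (slope' (X t)) ξ - emb (slope' (X t)) ξ ^ 2 / 2 + (c ^ 2 / 2 + 2 * c ^ 3) := by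
  have hi := h.timeInterval_subset ht
  refine ⟨_, h.hasDerivAt_slope_along hi ξ, ?_⟩
  have h1 := (h.satisfiesEquation hi).slope_le hc
    ((pow_le_pow_left₀ (norm_nonneg _) (h.norm_sobPart_le hlam ht) 2).trans hU)
    (flowQ (displacement X) t ξ)
  rwa [h.emb_sobPart_one hi, (h.lagFlow.flowMap hi).left_inv] at h1

/-- Discarding -w²/2 in the Riccati inequality, e^{λt}w grows at most linearly, uniformly in ξ.
Hence breaking can only occur through slopes tending to -∞. -/
lemma emb_slope_le (h : LagSol lam δ T X) (hlam : 0 ≤ lam) {b : ℝ} (hT : T = (b : EReal)) :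
    ∃ C, ∀ t ∈ Ico 0 b, ∀ ξ, emb (slope' (X t)) ξ ≤ C := by
  set c := ‖sobPart (eulSol X 0) 0‖
  have hc : 0 ≤ c := norm_nonneg _
  set K := c ^ 2 / 2 + 2 * c ^ 3
  have hK : 0 ≤ K := by positivity
  refine ⟨‖emb (slope' (X 0))‖ + Real.exp (lam * b) * K * b, fun t ht ξ => ?_⟩
  have hsub : Icc 0 t ⊆ timeInterval T := fun s hs => ⟨hs.1, by
    rw [hT]; exact EReal.coe_lt_coe_iff.2 (hs.2.trans_lt ht.2)⟩
  have key : ∀ s ∈ Icc 0 t, ∃ w' : ℝ, HasDerivAt (fun τ => emb (slope' (X τ)) ξ) w' s ∧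
      w' ≤ -lam * emb (slope' (X s)) ξ - emb (slope' (X s)) ξ ^ 2 / 2 + K := fun s hs =>
    h.exists_hasDerivAt_slope_le hlam hc (by nlinarith [sq_nonneg c]) (hsub hs) ξ
  choose! w' hw' hle using key
  let g : ℝ → ℝ := fun s => Real.exp (lam * s) * emb (slope' (X s)) ξ - Real.exp (lam * b) * K * s
  have hg : ∀ s ∈ Icc 0 t, HasDerivAt g (Real.exp (lam * s) * (lam * 1) * emb (slope' (X s)) ξ
      + Real.exp (lam * s) * w' s - Real.exp (lam * b) * K * 1) s := fun s hs =>
    ((((hasDerivAt_id s).const_mul lam).exp).mul (hw' s hs)).sub ((hasDerivAt_id s).const_mul _)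
  have hanti : AntitoneOn g (Icc 0 t) := by
    refine antitoneOn_of_hasDerivWithinAt_nonpos (convex_Icc 0 t)
      (fun s hs => (hg s hs).continuousAt.continuousWithinAt)
      (fun s hs => (hg s (interior_subset hs)).hasDerivWithinAt) (fun s hs => ?_)
    have hs' := interior_subset hs
    have e1 := mul_le_mul_of_nonneg_left (hle s hs') (Real.exp_pos (lam * s)).le
    have e2 : Real.exp (lam * s) ≤ Real.exp (lam * b) :=
      Real.exp_le_exp.2 (mul_le_mul_of_nonneg_left (hs'.2.trans ht.2.le) hlam)
    have e3 := mul_le_mul_of_nonneg_right e2 hK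
    nlinarith [mul_nonneg (Real.exp_pos (lam * s)).le (sq_nonneg (emb (slope' (X s)) ξ))]
  have h1 := hanti (left_mem_Icc.2 ht.1) (right_mem_Icc.2 ht.1) ht.1
  simp only [g, mul_zero, Real.exp_zero, one_mul, sub_zero] at h1
  have h2 : emb (slope' (X 0)) ξ ≤ ‖emb (slope' (X 0))‖ :=
    (le_abs_self _).trans ((emb (slope' (X 0))).norm_coe_le_norm ξ)
  have h3 : Real.exp (lam * b) * K * t ≤ Real.exp (lam * b) * K * b :=
    mul_le_mul_of_nonneg_left ht.2.le (by positivity)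
  have h4 : 1 ≤ Real.exp (lam * t) := Real.one_le_exp (mul_nonneg hlam ht.1)
  have h5 : 0 ≤ Real.exp (lam * b) * K * b :=
    mul_nonneg (by positivity) (ht.1.trans ht.2.le)
  rcases le_total (emb (slope' (X t)) ξ) 0 with h0 | h0
  · linarith [norm_nonneg (emb (slope' (X 0)))]
  · nlinarith [mul_le_mul_of_nonneg_right h4 h0]

/-- The flow can be continued as long as the slope stays bounded from below. -/
theorem exists_tendsto_of_le_slope (h : LagSol lam δ T X) (hlam : 0 ≤ lam) {b B : ℝ}
    (hT : T = (b : EReal)) (hB : ∀ t ∈ Ico 0 b, ∀ ξ, B ≤ emb (slope' (X t)) ξ) :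
    ∃ z ∈ {p : Cb × H1 | p.1 ∈ PosCb}, Tendsto X (𝓝[<] b) (𝓝 z) := by
  have hb : 0 < b := by have := h.T_pos; rw [hT] at this; exact_mod_cast this
  have htI : ∀ t ∈ Ico 0 b, t ∈ timeInterval T := fun t ht =>
    ⟨ht.1, by rw [hT]; exact EReal.coe_lt_coe_iff.2 ht.2⟩
  have hI : ∀ t ∈ Ico 0 b, t ∈ ival δ T := fun t ht => h.timeInterval_subset (htI t ht)
  have hb0 : (0 : ℝ) ∈ Ico 0 b := ⟨le_rfl, hb⟩
  obtain ⟨C₁, hC₁⟩ := h.emb_slope_le hlam hT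
  obtain ⟨A, hA0, hA⟩ : ∃ A, 0 ≤ A ∧ ∀ t ∈ Ico 0 b, ‖emb (slope' (X t))‖ ≤ A := by
    refine ⟨max |B| |C₁|, by positivity, fun t ht => ?_⟩
    refine (BoundedContinuousFunction.norm_le (by positivity)).2 fun ξ => ?_
    rw [Real.norm_eq_abs, abs_le]
    constructor
    · linarith [hB t ht ξ, le_max_left |B| |C₁|, neg_abs_le B]
    · exact (hC₁ t ht ξ).trans ((le_abs_self _).trans (le_max_right _ _))
  have hdJ : ∀ t ∈ Ico 0 b, HasDerivAt (fun τ => (X τ).1) (emb (slope' (X t)) * (X t).1) t :=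
    fun t ht => h.hasDerivAt_fst (hI t ht)
  obtain ⟨Cj, hCj⟩ := exists_bound_of_norm_deriv_le hdJ (K := A) (ε := 0) fun t ht => by
    rw [add_zero]
    exact (norm_mul_le _ _).trans (mul_le_mul_of_nonneg_right (hA t ht) (norm_nonneg _))
  have hCj0 : 0 ≤ Cj := (norm_nonneg _).trans (hCj 0 hb0)
  -- From ∂_t J = W J with |W| ≤ A, the function e^{At}J is nondecreasing and starts at 1.
  obtain ⟨c, hc, hcJ⟩ : ∃ c > 0, ∀ t ∈ Ico 0 b, ∀ ξ, c ≤ (X t).1 ξ := by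
    refine ⟨Real.exp (-(A * b)), Real.exp_pos _, fun t ht ξ => ?_⟩
    have hsub : Icc 0 t ⊆ Ico 0 b := fun s hs => ⟨hs.1, hs.2.trans_lt ht.2⟩
    let g : ℝ → ℝ := fun s => Real.exp (A * s) * (X s).1 ξ
    have hg : ∀ s ∈ Icc 0 t, HasDerivAt g (Real.exp (A * s) * (A * 1) * (X s).1 ξ
        + Real.exp (A * s) * (emb (slope' (X s)) ξ * (X s).1 ξ)) s := fun s hs => by
      let ℓ : Cb →L[ℝ] ℝ := BoundedContinuousFunction.evalCLM ℝ ξ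
      have h1 : HasDerivAt (fun τ => (X τ).1 ξ) (emb (slope' (X s)) ξ * (X s).1 ξ) s :=
        ℓ.hasFDerivAt.comp_hasDerivAt s (hdJ s (hsub hs))
      exact (((hasDerivAt_id s).const_mul A).exp).mul h1
    have hmono : MonotoneOn g (Icc 0 t) := by
      refine monotoneOn_of_hasDerivWithinAt_nonneg (convex_Icc 0 t)
        (fun s hs => (hg s hs).continuousAt.continuousWithinAt)
        (fun s hs => (hg s (interior_subset hs)).hasDerivWithinAt) (fun s hs => ?_)
      have hs' := hsub (interior_subset hs)
      have e1 : 0 ≤ A + emb (slope' (X s)) ξ := by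
        have := ((emb (slope' (X s))).norm_coe_le_norm ξ).trans (hA s hs')
        rw [Real.norm_eq_abs] at this
        linarith [(abs_le.1 this).1]
      have e2 : 0 ≤ (X s).1 ξ := by
        obtain ⟨c, hc, hcJ⟩ := h.pos (hI s hs')
        exact hc.le.trans (hcJ ξ)
      have := mul_nonneg (Real.exp_pos (A * s)).le (mul_nonneg e1 e2)
      linarith
    have h1 := hmono (left_mem_Icc.2 ht.1) (right_mem_Icc.2 ht.1) ht.1
    simp only [g, mul_zero, Real.exp_zero, one_mul, h.init, BoundedContinuousFunction.coe_one,
      Pi.one_apply] at h1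
    have h2 : Real.exp (A * t) ≤ Real.exp (A * b) :=
      Real.exp_le_exp.2 (mul_le_mul_of_nonneg_left ht.2.le hA0)
    have h3 : 0 ≤ (X t).1 ξ := by
      by_contra hn
      push Not at hn
      nlinarith [Real.exp_pos (A * t)]
    rw [Real.exp_neg, inv_le_iff_one_le_mul₀ (Real.exp_pos _), mul_comm]
    exact h1.trans (mul_le_mul_of_nonneg_right h2 h3)
  set N := ‖sobPart (eulSol X 0) 0‖
  have hN : 0 ≤ N := norm_nonneg _
  have hEul : ∀ t ∈ Ico 0 b, ‖sobPart (eulSol X t) 0‖ ≤ N := fun t ht =>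
    h.norm_sobPart_le hlam (htI t ht)
  have hembU : ∀ t ∈ Ico 0 b, ‖emb (velocity (X t))‖ ≤ N := fun t ht => by
    refine (BoundedContinuousFunction.norm_le hN).2 fun ξ => ?_
    have e := h.emb_sobPart_zero (hI t ht) (flowQ (displacement X) t ξ)
    rw [(h.lagFlow.flowMap (hI t ht)).left_inv] at e
    rw [← e]
    exact ((emb _).norm_coe_le_norm _).trans ((norm_emb_le _).trans (hEul t ht))
  -- The energy bounds Eulerian L² norms by N. These are J-weighted Lagrangian norms, so J ≥ c costs
  -- the factor 1/√c.
  set S := N / √c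
  have hS0 : 0 ≤ S := by positivity
  have hL2 : ∀ t ∈ Ico 0 b, ∀ f : L2R, ‖eul (displacement X) t f‖ ≤ N → ‖f‖ ≤ S := by
    intro t ht f hf
    have h1 := le_inner_mulL_self (hcJ t ht) f
    rw [h.lagFlow.eul_eq (hI t ht)] at hf
    rw [← (h.lagFlow.flowMap (hI t ht)).norm_sq_pull] at h1
    rw [le_div_iff₀ (Real.sqrt_pos.2 hc)]
    refine abs_le_of_sq_le_sq' ?_ hN |>.2
    rw [mul_pow, Real.sq_sqrt hc.le, mul_comm]
    exact h1.trans (pow_le_pow_left₀ (norm_nonneg _) hf 2)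
  have hU0 : ∀ t ∈ Ico 0 b, ‖(velocity (X t)).1 0‖ ≤ S := fun t ht => by
    refine hL2 t ht _ ((le_of_eq ?_).trans ((H1.norm_zero_le _).trans (hEul t ht)))
    change _ = ‖(eulSol X t).1 0‖
    rw [h.coe_eulSol (hI t ht)]; rfl
  have hW0 : ∀ t ∈ Ico 0 b, ‖(slope' (X t)).1 0‖ ≤ S := fun t ht => by
    refine hL2 t ht _ ((le_of_eq ?_).trans ((H1.norm_one_le _).trans (hEul t ht)))
    change _ = ‖(eulSol X t).1 1‖
    rw [h.coe_eulSol (hI t ht)]; rfl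
  have hU : ∀ t ∈ Ico 0 b, ‖velocity (X t)‖ ≤ S + Cj * S := fun t ht => by
    refine (H1.norm_le _).trans (add_le_add (hU0 t ht) ?_)
    have e : (velocity (X t)).1 1 = mulL (X t).1 ((slope' (X t)).1 0) :=
      velocity_one (h.pos (hI t ht)) (X t).2
    rw [e]
    exact (norm_mulL_le _ _).trans (mul_le_mul (hCj t ht) (hW0 t ht) (norm_nonneg _) hCj0)
  have hW : ∀ t ∈ Ico 0 b, ‖slope' (X t)‖ ≤ S + Cj * (S + ‖(X t).2‖) := fun t ht => by
    refine (H1.norm_le _).trans (add_le_add (hW0 t ht) ?_)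
    have e : (slope' (X t)).1 1 = mulL (X t).1 ((velocity (X t)).1 0 - (X t).2.1 0) :=
      slope'_one (h.pos (hI t ht)) (X t).2
    rw [e]
    refine (norm_mulL_le _ _).trans (mul_le_mul (hCj t ht) ?_ (norm_nonneg _) hCj0)
    exact (norm_sub_le _ _).trans (add_le_add (hU0 t ht) (H1.norm_zero_le _))
  have hdM : ∀ t ∈ Ico 0 b, HasDerivAt (fun τ => (X τ).2) (lagField lam (X t)).2 t :=
    fun t ht => h.hasDerivAt_snd (hI t ht)
  have hfield : ∀ t, (lagField lam (X t)).2 = (-(2 : ℝ)) • mulH (slope' (X t)) (X t).2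
      - lam • (X t).2 + (3 : ℝ) • mulH (velocity (X t)) (slope' (X t))
      - (3 : ℝ) • mulH (velocity (X t)) (mulH (velocity (X t)) (slope' (X t))) := fun t => rfl
  have hnorm4 : ∀ {G : Type} [NormedAddCommGroup G] [NormedSpace ℝ G] (x y z w : G),
      ‖(-(2 : ℝ)) • x - lam • y + (3 : ℝ) • z - (3 : ℝ) • w‖
        ≤ 2 * ‖x‖ + lam * ‖y‖ + 3 * ‖z‖ + 3 * ‖w‖ := by
    intro G _ _ x y z w
    refine (norm_sub_le _ _).trans (add_le_add ((norm_add_le _ _).trans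
      (add_le_add ((norm_sub_le _ _).trans (add_le_add ?_ ?_)) ?_)) ?_) <;>
      rw [norm_smul] <;> simp [abs_of_nonneg hlam]
  -- The sup norm of M comes first, by Grönwall in C_b. Only with it bounded is the H¹ estimate
  -- below linear in ‖M‖, because the slope's own H¹ bound contains ‖M‖.
  obtain ⟨Cm, hCm⟩ := exists_bound_of_norm_deriv_le (f := fun t => emb (X t).2)
    (f' := fun t => emb (lagField lam (X t)).2) (b := b) (K := 2 * A + lam)
    (ε := 3 * (N * A) + 3 * (N * (N * A)))
    (fun t ht => emb.hasFDerivAt.comp_hasDerivAt t (hdM t ht)) fun t ht => by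
      rw [hfield]
      simp only [map_add, map_sub, map_smul, emb_mulH]
      refine (hnorm4 _ _ _ _).trans ?_
      have e1 := (norm_mul_le (emb (slope' (X t))) (emb (X t).2)).trans
        (mul_le_mul_of_nonneg_right (hA t ht) (norm_nonneg _))
      have e2 := (norm_mul_le (emb (velocity (X t))) (emb (slope' (X t)))).trans
        (mul_le_mul (hembU t ht) (hA t ht) (norm_nonneg _) hN)
      have e3 := (norm_mul_le (emb (velocity (X t)))
        (emb (velocity (X t)) * emb (slope' (X t)))).trans
        (mul_le_mul (hembU t ht) e2 (norm_nonneg _) hN)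
      linarith
  have hCm0 : 0 ≤ Cm := (norm_nonneg _).trans (hCm 0 hb0)
  set D₁ := S + Cj * S
  have hD₁ : 0 ≤ D₁ := by positivity
  have hfb : ∀ t ∈ Ico 0 b, ‖(lagField lam (X t)).2‖ ≤
      (4 * A + 2 * Cm * Cj + lam + 6 * N * Cj + 12 * N ^ 2 * Cj) * ‖(X t).2‖
        + (2 * Cm * D₁ + 6 * N * D₁ + 3 * A * D₁ + 12 * N ^ 2 * D₁ + 9 * N * A * D₁) := by
    intro t ht
    rw [hfield]
    refine (hnorm4 _ _ _ _).trans ?_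
    set m := ‖(X t).2‖
    have hm : 0 ≤ m := norm_nonneg _
    have hW' : ‖slope' (X t)‖ ≤ D₁ + Cj * m := (hW t ht).trans (le_of_eq (by simp only [D₁]; ring))
    have hD₂ : 0 ≤ D₁ + Cj * m := by positivity
    have e1 : ‖mulH (slope' (X t)) (X t).2‖ ≤ 2 * A * m + Cm * (D₁ + Cj * m) := by
      refine (norm_mulH_le _ _).trans (add_le_add ?_ ?_)
      · exact mul_le_mul_of_nonneg_right (by linarith [hA t ht]) hm
      · exact mul_le_mul (hCm t ht) hW' (norm_nonneg _) hCm0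
    have e2 : ‖mulH (velocity (X t)) (slope' (X t))‖ ≤ 2 * N * (D₁ + Cj * m) + A * D₁ := by
      refine (norm_mulH_le _ _).trans (add_le_add ?_ ?_)
      · exact mul_le_mul (by linarith [hembU t ht]) hW' (norm_nonneg _) (by linarith)
      · exact mul_le_mul (hA t ht) (hU t ht) (norm_nonneg _) hA0
    have e3 : ‖mulH (velocity (X t)) (mulH (velocity (X t)) (slope' (X t)))‖
        ≤ 2 * N * (2 * N * (D₁ + Cj * m) + A * D₁) + N * A * D₁ := by
      refine (norm_mulH_le _ _).trans (add_le_add ?_ ?_)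
      · exact mul_le_mul (by linarith [hembU t ht]) e2 (norm_nonneg _) (by linarith)
      · rw [emb_mulH]
        exact mul_le_mul ((norm_mul_le _ _).trans (mul_le_mul (hembU t ht) (hA t ht)
          (norm_nonneg _) hN)) (hU t ht) (norm_nonneg _) (by positivity)
    refine (add_le_add (add_le_add (add_le_add (mul_le_mul_of_nonneg_left e1 zero_le_two)
      (mul_le_mul_of_nonneg_left (le_refl m) hlam)) (mul_le_mul_of_nonneg_left e2 zero_le_three))
      (mul_le_mul_of_nonneg_left e3 zero_le_three)).trans (le_of_eq ?_)
    ring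
  obtain ⟨CM, hCM⟩ := exists_bound_of_norm_deriv_le hdM hfb
  obtain ⟨J, hJ⟩ := exists_tendsto_of_norm_deriv_le hb hdJ (C := A * Cj) fun t ht =>
    (norm_mul_le _ _).trans (mul_le_mul (hA t ht) (hCj t ht) (norm_nonneg _) hA0)
  obtain ⟨M, hM⟩ := exists_tendsto_of_norm_deriv_le hb hdM fun t ht =>
    (hfb t ht).trans (add_le_add_left (mul_le_mul_of_nonneg_left (hCM t ht) (by positivity)) _)
  refine ⟨(J, M), ⟨c, hc, fun ξ => ?_⟩, hJ.prodMk_nhds hM⟩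
  have h1 : Tendsto (fun t => (X t).1 ξ) (𝓝[<] b) (𝓝 (J ξ)) :=
    ((BoundedContinuousFunction.evalCLM ℝ ξ).continuous.tendsto J).comp hJ
  exact ge_of_tendsto h1 (by filter_upwards [Ico_mem_nhdsLT hb] with t ht using hcJ t ht ξ)

end LagSol

/-! ### Riccati comparison and the breaking time -/

section Riccati

/-- Below a threshold where the right-hand side of the Riccati inequality is negative, solutions
stay below their value. -/
lemma le_of_riccati {w : ℝ → ℝ} {lam K θ s t : ℝ} (hst : s ≤ t)
    (hw : ∀ r ∈ Icc s t, ∃ w' : ℝ, HasDerivAt w w' r ∧ w' ≤ -lam * w r - w r ^ 2 / 2 + K)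
    (hθ : ∀ v ≤ θ, -lam * v - v ^ 2 / 2 + K < 0) (hs : w s ≤ θ) : w t ≤ w s := by
  choose! w' hw' hle using hw
  refine image_le_of_deriv_right_lt_deriv_boundary (f' := w') (B := fun _ => w s) (B' := fun _ => 0)
    (fun r hr => (hw' r hr).continuousAt.continuousWithinAt)
    (fun r hr => (hw' r (Ico_subset_Icc_self hr)).hasDerivWithinAt) le_rfl
    (fun r => hasDerivAt_const r _) (fun r hr he => ?_) (right_mem_Icc.2 hst)
  exact (hle r (Ico_subset_Icc_self hr)).trans_lt (hθ _ (he.le.trans hs))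

/-- The substitution -1/w linearises the inequality: e^{-λr}(-1/w) + (ε/2)E is nonincreasing, and
its first term stays positive as long as w exists and is negative. -/
lemma riccati_time_lt {w E : ℝ → ℝ} {lam ε t : ℝ} (ht : 0 ≤ t)
    (hw : ∀ r ∈ Icc 0 t, ∃ w' : ℝ, HasDerivAt w w' r ∧ w' ≤ -lam * w r - ε / 2 * w r ^ 2)
    (hneg : ∀ r ∈ Icc 0 t, w r < 0) (hE0 : E 0 = 0)
    (hE : ∀ r, HasDerivAt E (Real.exp (-(lam * r))) r) : ε / 2 * E t < -(w 0)⁻¹ := by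
  choose! w' hw' hle using hw
  let g : ℝ → ℝ := fun r => Real.exp (-(lam * r)) * -(w r)⁻¹ + ε / 2 * E r
  have hg : ∀ r ∈ Icc 0 t, HasDerivAt g (Real.exp (-(lam * r)) * -(lam * 1) * -(w r)⁻¹
      + Real.exp (-(lam * r)) * -(-w' r / w r ^ 2) + ε / 2 * Real.exp (-(lam * r))) r :=
    fun r hr => ((((hasDerivAt_id r).const_mul lam).neg.exp).mul
      ((hw' r hr).inv (hneg r hr).ne).neg).add ((hE r).const_mul _)
  have hanti : AntitoneOn g (Icc 0 t) := by
    refine antitoneOn_of_hasDerivWithinAt_nonpos (convex_Icc 0 t)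
      (fun s hs => (hg s hs).continuousAt.continuousWithinAt)
      (fun s hs => (hg s (interior_subset hs)).hasDerivWithinAt) (fun s hs => ?_)
    have hs' := interior_subset hs
    have h0 := (hneg s hs').ne
    have h1 : w' s / w s ^ 2 ≤ -lam * (w s)⁻¹ - ε / 2 := by
      rw [div_le_iff₀ (by positivity)]
      refine (hle s hs').trans (le_of_eq ?_)
      field_simp
    have h2 := mul_le_mul_of_nonneg_left h1 (Real.exp_pos (-(lam * s))).le
    have e : -(-w' s / w s ^ 2) = w' s / w s ^ 2 := by ring
    rw [e]
    linarith
  have h1 := hanti (left_mem_Icc.2 ht) (right_mem_Icc.2 ht) ht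
  simp only [g, mul_zero, neg_zero, Real.exp_zero, one_mul, hE0, add_zero] at h1
  have h2 : 0 < -(w t)⁻¹ := neg_pos.2 (inv_lt_zero.2 (hneg t (right_mem_Icc.2 ht)))
  have h3 := mul_pos (Real.exp_pos (-(lam * t))) h2
  linarith

/-- A primitive of `exp (-lam t)`, vanishing at `0`, reaches `-4 / a` before time `T₊`. -/
lemma exists_primitive_exp {lam a : ℝ} (hlam : 0 ≤ lam) (ha : a + 4 * lam < 0) :
    ∃ E : ℝ → ℝ, E 0 = 0 ∧ (∀ r, HasDerivAt E (Real.exp (-(lam * r))) r) ∧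
      0 ≤ (if 0 < lam then 1 / lam * Real.log (a / (a + 4 * lam)) else -8 / a) ∧
      -4 / a ≤ E (if 0 < lam then 1 / lam * Real.log (a / (a + 4 * lam)) else -8 / a) := by
  have ha0 : a < 0 := by linarith
  rcases hlam.eq_or_lt with h | h
  · subst h
    refine ⟨fun r => r, rfl, fun r => by simpa using hasDerivAt_id' r, ?_, ?_⟩
    · rw [if_neg (lt_irrefl _)]
      exact div_nonneg_of_nonpos (by norm_num) ha0.le
    · rw [if_neg (lt_irrefl _)]
      have : 0 ≤ -4 / a := div_nonneg_of_nonpos (by norm_num) ha0.le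
      -- When λ = 0 the stated bound is twice the time that the Riccati argument gives.
      have e : -8 / a = -4 / a + -4 / a := by ring
      dsimp only
      linarith
  · refine ⟨fun r => (1 - Real.exp (-(lam * r))) / lam, by simp, fun r => ?_, ?_, ?_⟩
    · have h1 := ((((hasDerivAt_id r).const_mul lam).neg.exp).const_sub 1).div_const lam
      refine h1.congr_deriv ?_
      change -(Real.exp (-(lam * r)) * -(lam * 1)) / lam = _
      field_simp
    · rw [if_pos h]
      refine mul_nonneg (by positivity) (Real.log_nonneg ?_)
      rw [one_le_div_of_neg ha]
      linarith
    · rw [if_pos h]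
      have hpos : 0 < a / (a + 4 * lam) := div_pos_of_neg_of_neg ha0 ha
      have e1 : -(lam * (1 / lam * Real.log (a / (a + 4 * lam))))
          = Real.log ((a / (a + 4 * lam))⁻¹) := by
        rw [Real.log_inv]; field_simp
      dsimp only
      rw [e1, Real.exp_log (inv_pos.2 hpos), inv_div]
      refine le_of_eq ?_
      have ha1 := ha0.ne
      field_simp
      ring

end Riccati

/-! ### Wave breaking -/

lemma IsContRep.bddBelow_range_deriv {k : ℕ} {F : SobolevSpace (k + 2)} {f : ℝ → ℝ}
    (h : IsContRep F f) : BddBelow (range (deriv f)) := by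
  refine ⟨-‖emb (sobPart F 1)‖, ?_⟩
  rintro _ ⟨x, rfl⟩
  rw [h.deriv_eq]
  exact (abs_le.1 ((emb (sobPart F 1)).norm_coe_le_norm x)).1

lemma IsContRep.le_infSlope {k : ℕ} {F : SobolevSpace (k + 2)} {f : ℝ → ℝ}
    (h : IsContRep F f) : -(2 * ‖F‖) ≤ infSlope f := by
  refine le_ciInf fun x => ?_
  rw [h.deriv_eq]
  have := ((emb (sobPart F 1)).norm_coe_le_norm x).trans
    ((norm_emb_le _).trans (norm_sobPart_le F 1))
  exact (abs_le.1 this).1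

namespace LagSol

variable {lam δ : ℝ} {T : EReal} {X : ℝ → Cb × H1}

lemma infSlope_le (h : LagSol lam δ T X) {t : ℝ} (ht : t ∈ ival δ T) (ξ : ℝ) :
    infSlope (eulFun X t) ≤ emb (slope' (X t)) ξ := by
  have hr := h.isContRep_eulFun ht
  have h1 := ciInf_le hr.bddBelow_range_deriv (flowQ (displacement X) t ξ)
  have h2 := h.emb_sobPart_one ht (flowQ (displacement X) t ξ)
  rw [(h.lagFlow.flowMap ht).left_inv] at h2
  rw [← h2, ← hr.deriv_eq]
  exact h1

end LagSol

/-- Settling for half the infimum avoids having to show that it is attained. The loss is compatible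
with λ₀: a slope at most y/2 turns λ < -ε₀y/4 into λ + (ε₀/2)v < 0. -/
lemma exists_deriv_le_of_infSlope_neg {f : ℝ → ℝ} (hy : infSlope f < 0) (x₀ : ℝ) :
    ∃ ξ, deriv f ξ ≤ deriv f x₀ ∧ deriv f ξ ≤ infSlope f / 2 := by
  rcases le_total (deriv f x₀) (infSlope f / 2) with h | h
  · exact ⟨x₀, le_rfl, h⟩
  · obtain ⟨ξ, hξ⟩ := exists_lt_of_ciInf_lt (show infSlope f < infSlope f / 2 by linarith)
    exact ⟨ξ, hξ.le.trans h, hξ.le⟩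

/-- Since v ≤ d ≤ 0, the constant K = (1 - ε)d²/2 is absorbed by the fraction 1 - ε of v²/2. -/
lemma riccati_rhs_le {lam ε K d y v : ℝ} (hε : ε ≤ 1) (hd : d ≤ 0)
    (hK : K = (1 - ε) * d ^ 2 / 2) (hv : v ≤ min d (y / 2)) :
    -lam * v - v ^ 2 / 2 + K ≤ -lam * v - ε / 2 * v ^ 2 := by
  have h1 : v ≤ d := hv.trans (min_le_left _ _)
  have h2 : d ^ 2 ≤ v ^ 2 := by nlinarith
  nlinarith [mul_le_mul_of_nonneg_left h2 (show 0 ≤ 1 - ε by linarith)]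

/-- After absorbing K the expression is -v(λ + εv/2), with v < 0 and the bracket negative. -/
lemma riccati_rhs_neg {lam ε K d y v : ℝ} (hε0 : 0 < ε) (hε : ε ≤ 1) (hd : d < 0)
    (hK : K = (1 - ε) * d ^ 2 / 2) (hlam : ε * y + 4 * lam < 0) (hv : v ≤ min d (y / 2)) :
    -lam * v - v ^ 2 / 2 + K < 0 := by
  refine (riccati_rhs_le hε hd.le hK hv).trans_lt ?_
  have h1 : v < 0 := (hv.trans (min_le_left _ _)).trans_lt hd
  have h2 : v ≤ y / 2 := hv.trans (min_le_right _ _)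
  have h3 : lam + ε / 2 * v < 0 := by nlinarith
  nlinarith

/-- Wave breaking for a maximal Lagrangian solution. -/
theorem LagSol.breaking {lam δ : ℝ} {T : EReal} {X : ℝ → Cb × H1} (h : LagSol lam δ T X)
    {F : SobolevSpace 3} {u₀ : ℝ → ℝ} (hF : IsContRep F u₀) (hX : X 0 = lagInit F)
    (hmax : ∀ b : ℝ, T = b → ∀ z ∈ {p : Cb × H1 | p.1 ∈ PosCb}, ¬Tendsto X (𝓝[<] b) (𝓝 z))
    {x₀ : ℝ} (hx₀ : deriv u₀ x₀ < -√(√2 * h1Norm u₀ ^ 3 + 1 / 2 * h1Norm u₀ ^ 2))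
    (hlam : 0 ≤ lam) (hlam_lt : lam < lambdaZero u₀ x₀) :
    ∃ b : ℝ, T = (b : EReal) ∧ b ≤ tPlus lam u₀ x₀ ∧
      (∀ t ∈ Ico 0 b, ∀ x, |eulFun X t x| ≤ h1Norm u₀) ∧
      Tendsto (fun t => infSlope (eulFun X t)) (𝓝[<] b) atBot := by
  set N := h1Norm u₀
  set d := deriv u₀ x₀
  set y := infSlope u₀
  set ε := epsilonZero u₀ x₀
  have hN : 0 ≤ N := Real.sqrt_nonneg _
  have h2 : √2 ^ 2 = 2 := Real.sq_sqrt zero_le_two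
  have h2pos : 0 < √2 := by positivity
  -- The sup bound c = ‖u₀‖_{H¹}/√2 from the Sobolev inequality. With it the square of the threshold
  -- in the hypothesis equals 2K.
  set c := √2 / 2 * N
  have hc : 0 ≤ c := by positivity
  have hcN : N ^ 2 = 2 * c ^ 2 := by simp only [c]; rw [mul_pow, div_pow, h2]; ring
  set K := c ^ 2 / 2 + 2 * c ^ 3
  have hK0 : 0 ≤ K := by positivity
  have hKN : 2 * K = √2 * N ^ 3 + 1 / 2 * N ^ 2 := by
    have e : c ^ 3 = √2 * N ^ 3 / 4 := by
      simp only [c]; rw [mul_pow, div_pow, pow_succ √2 2, h2]; ring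
    have e' : c ^ 2 = N ^ 2 / 2 := by rw [hcN]; ring
    simp only [K]; rw [e, e']; ring
  have hd : d < 0 := hx₀.trans_le (neg_nonpos.2 (Real.sqrt_nonneg _))
  have hd2 : 2 * K < d ^ 2 := by
    rw [hKN]
    have := Real.lt_sq_of_sqrt_lt (show √(√2 * N ^ 3 + 1 / 2 * N ^ 2) < -d by linarith)
    rwa [neg_sq] at this
  have hd0 : d ≠ 0 := hd.ne
  have hd2pos : 0 < d ^ 2 := by positivity
  have hεK : K = (1 - ε) * d ^ 2 / 2 := by
    have e : ε = 1 - (2 * √2 * N ^ 3 + N ^ 2) / (2 * d ^ 2) := rfl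
    have e' : 2 * √2 * N ^ 3 + N ^ 2 = 4 * K := by linarith
    rw [e, e']
    field_simp
    ring
  have hε0 : 0 < ε := by nlinarith
  have hε1 : ε ≤ 1 := by
    by_contra hcon
    push Not at hcon
    nlinarith
  have hyd : y ≤ d := ciInf_le hF.bddBelow_range_deriv x₀
  have hy : y < 0 := hyd.trans_lt hd
  have hl : ε * y + 4 * lam < 0 := by
    have e : lambdaZero u₀ x₀ = -(ε * y / 4) := rfl
    rw [e] at hlam_lt
    linarith
  have hN0 : ‖sobPart (eulSol X 0) 0‖ = N := by
    have := (h.isContRep_eulFun h.zero_mem).h1Norm_eq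
    rw [(h.isSolution hF hX).2.1] at this
    exact this.symm
  have hw : ∀ t ∈ timeInterval T, ∀ ξ, ∃ w' : ℝ, HasDerivAt (fun τ => emb (slope' (X τ)) ξ) w' t ∧
      w' ≤ -lam * emb (slope' (X t)) ξ - emb (slope' (X t)) ξ ^ 2 / 2 + K := fun t ht ξ =>
    h.exists_hasDerivAt_slope_le hlam hc (by rw [hN0, hcN]) ht ξ
  have hmono : ∀ ξ s t, 0 ≤ s → s ≤ t → t ∈ timeInterval T →
      emb (slope' (X s)) ξ ≤ min d (y / 2) → emb (slope' (X t)) ξ ≤ emb (slope' (X s)) ξ :=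
    fun ξ s t hs hst ht hθ => le_of_riccati hst
      (fun r hr => hw r (timeInterval_Icc_subset ht ⟨hs.trans hr.1, hr.2⟩) ξ)
      (fun v hv => riccati_rhs_neg hε0 hε1 hd hεK hl hv) hθ
  obtain ⟨ξ₀, hξ₁, hξ₂⟩ := exists_deriv_le_of_infSlope_neg hy x₀
  have hw0 : emb (slope' (X 0)) ξ₀ = deriv u₀ ξ₀ := by rw [hX, slope'_lagInit, hF.deriv_eq]
  have hθ0 : emb (slope' (X 0)) ξ₀ ≤ min d (y / 2) := by rw [hw0]; exact le_min hξ₁ hξ₂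
  obtain ⟨E, hE0, hE, hTp, hET⟩ := exists_primitive_exp hlam hl
  change 0 ≤ tPlus lam u₀ x₀ at hTp
  change -4 / (ε * y) ≤ E (tPlus lam u₀ x₀) at hET
  have hTle : T ≤ (tPlus lam u₀ x₀ : EReal) := by
    by_contra hcon
    push Not at hcon
    have hmem : tPlus lam u₀ x₀ ∈ timeInterval T := ⟨hTp, hcon⟩
    have hsub := timeInterval_Icc_subset hmem
    have hbelow : ∀ r ∈ Icc 0 (tPlus lam u₀ x₀), emb (slope' (X r)) ξ₀ ≤ min d (y / 2) :=
      fun r hr => (hmono ξ₀ 0 r le_rfl hr.1 (hsub hr) hθ0).trans hθ0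
    have h1 := riccati_time_lt (ε := ε) (lam := lam) (w := fun τ => emb (slope' (X τ)) ξ₀) hTp
      (fun r hr => by
        obtain ⟨w', hd', hle'⟩ := hw r (hsub hr) ξ₀
        exact ⟨w', hd', hle'.trans (riccati_rhs_le hε1 hd.le hεK (hbelow r hr))⟩)
      (fun r hr => ((hbelow r hr).trans (min_le_left _ _)).trans_lt hd) hE0 hE
    have h3 : -(emb (slope' (X 0)) ξ₀)⁻¹ ≤ -(y / 2)⁻¹ := by
      rw [neg_le_neg_iff]
      exact (inv_le_inv_of_neg (by linarith) (by rw [hw0]; linarith)).2 (by rw [hw0]; exact hξ₂)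
    -- Here -4/(εy) is the value of E at which a trajectory of initial slope at most y/2 must have
    -- blown up.
    have h4 : ε / 2 * (-4 / (ε * y)) = -(y / 2)⁻¹ := by
      field_simp
      norm_num
    have h5 := mul_le_mul_of_nonneg_left hET (show 0 ≤ ε / 2 by positivity)
    linarith
  obtain ⟨b, hb⟩ : ∃ b : ℝ, T = (b : EReal) := by
    have h1 : T ≠ ⊤ := fun e => by rw [e] at hTle; exact (EReal.coe_lt_top _).not_ge hTle
    have h3 : T ≠ ⊥ := fun e => by have := h.T_pos; rw [e] at this; exact not_lt_bot this
    exact ⟨T.toReal, (EReal.coe_toReal h1 h3).symm⟩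
  have hbpos : 0 < b := by have := h.T_pos; rw [hb] at this; exact_mod_cast this
  have hI : ∀ t ∈ Ico 0 b, t ∈ timeInterval T := fun t ht =>
    ⟨ht.1, by rw [hb]; exact EReal.coe_lt_coe_iff.2 ht.2⟩
  refine ⟨b, hb, by rw [hb] at hTle; exact_mod_cast hTle, fun t ht x => ?_, ?_⟩
  · have hi := h.timeInterval_subset (hI t ht)
    rw [← (h.isContRep_eulFun hi).emb_eq, ← hN0]
    exact ((emb _).norm_coe_le_norm x).trans ((norm_emb_le _).trans
      (h.norm_sobPart_le hlam (hI t ht)))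
  · rw [tendsto_atBot]
    intro L
    -- If no slope went below this level, the curve would converge in the domain, against
    -- maximality. Including the Riccati threshold in the level ensures that the slope stays below L
    -- for all later times.
    obtain ⟨t, ht, ξ, hlt⟩ : ∃ t ∈ Ico 0 b, ∃ ξ, emb (slope' (X t)) ξ < min L (min d (y / 2)) := by
      by_contra hcon
      push Not at hcon
      obtain ⟨z, hz, hzt⟩ := h.exists_tendsto_of_le_slope hlam hb hcon
      exact hmax b hb z hz hzt
    filter_upwards [Ico_mem_nhdsLT ht.2] with s hs
    have hs' := hI s ⟨ht.1.trans hs.1, hs.2⟩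
    calc infSlope (eulFun X s) ≤ emb (slope' (X s)) ξ := h.infSlope_le (h.timeInterval_subset hs') ξ
      _ ≤ emb (slope' (X t)) ξ := hmono ξ t s ht.1 hs.1 hs' (hlt.le.trans (min_le_right _ _))
      _ ≤ L := hlt.le.trans (min_le_left _ _)

end

theorem theorem1p3 (u₀ : ℝ → ℝ) (hu₀ : MemHSobolev 3 u₀) (hne : u₀ ≠ 0)
    (lam : ℝ) (T : EReal) (u : ℝ → ℝ → ℝ) (hu : IsMaximalSolution lam u₀ T u)
    (x₀ : ℝ)
    (hx₀ : deriv u₀ x₀ < -√(√2 * h1Norm u₀ ^ 3 + 1 / 2 * h1Norm u₀ ^ 2))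
    (hlam_nonneg : 0 ≤ lam) (hlam_lt : lam < lambdaZero u₀ x₀) :
    ∃ Tb : ℝ, T = (Tb : EReal) ∧ Tb ≤ tPlus lam u₀ x₀ ∧
      (∃ M : ℝ, ∀ t ∈ Ico 0 Tb, ∀ x : ℝ, |u t x| ≤ M) ∧
      Tendsto (fun t => infSlope (u t)) (𝓝[<] Tb) atBot := by
  obtain ⟨F, hF⟩ := hu₀
  obtain ⟨δ, S, X, hδ, hS, hX, hcurve, hmax⟩ := exists_maximal_curve isOpen_PosCb_prod
    (fun _ hp => contDiffAt_lagField lam hp) (show lagInit F ∈ _ from one_mem_PosCb)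
  have hL : LagSol lam δ S X := ⟨hδ, hS, by rw [hX]; rfl, hcurve⟩
  have hsol := hL.isSolution hF hX
  -- If the constructed solution lived at least as long, it would extend the given one by
  -- uniqueness, and maximality of T applies.
  have hST : S ≤ T := by
    rcases le_total S T with h | h
    · exact h
    · exact hu.2 S (eulFun X) hsol (hu.1.unique hsol h)
  have heq : ∀ t ∈ timeInterval S, u t = eulFun X t := hsol.unique hu.1 hST
  obtain ⟨b, hb, hbT, hbd, hinf⟩ := hL.breaking hF hX hmax hx₀ hlam_nonneg hlam_lt
  have hb0 : 0 < b := by rw [hb] at hS; exact_mod_cast hS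
  have heq' : ∀ t ∈ Ico 0 b, u t = eulFun X t := fun t ht =>
    heq t ⟨ht.1, by rw [hb]; exact EReal.coe_lt_coe_iff.2 ht.2⟩
  have hinf' : Tendsto (fun t => infSlope (u t)) (𝓝[<] b) atBot := by
    refine hinf.congr' ?_
    filter_upwards [Ico_mem_nhdsLT hb0] with t ht
    rw [heq' t ht]
  refine ⟨b, ?_, hbT, ⟨h1Norm u₀, fun t ht x => by rw [heq' t ht]; exact hbd t ht x⟩, hinf'⟩
  -- If T exceeded b, the given solution would be bounded in H³ on [0, b], hence its slopes too,
  -- contradicting the blow-up just shown.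
  refine le_antisymm ?_ (hb ▸ hST)
  by_contra hlt
  push Not at hlt
  obtain ⟨-, -, U, V, hrep, hUc, -⟩ := hu.1
  have hsub := timeInterval_Icc_subset (show b ∈ timeInterval T from ⟨hb0.le, hlt⟩)
  obtain ⟨C, hC⟩ := isCompact_Icc.exists_bound_of_continuousOn (hUc.mono hsub)
  obtain ⟨t, ht, ht'⟩ := ((hinf'.eventually_lt_atBot (-(2 * C))).and (Ico_mem_nhdsLT hb0)).exists
  have hmem := Ico_subset_Icc_self ht'
  have h1 := (hrep t (hsub hmem)).le_infSlope
  linarith [hC t hmem]
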